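/- **Setting.** Let $\lambda$ be a regular cardinal and let $\mathcal V=(\mathcal V_0,\otimes,I)$ be a symmetric monoidal closed category that is locally $\lambda$-presentable as a closed category: $\mathcal V_0$ is locally $\lambda$-presentable and its $\lambda$-presentable objects contain $I$ and are closed under $\otimes$. Write $\mathcal V_\lambda$ for the full subcategory of $\lambda$-presentable objects and $A^X=[X,A]$ for the internal hom. An enriched factorization system on $\mathcal V$ is an orthogonal factorization system $(\mathcal E,\mathcal M)$ on $\mathcal V_0$ with $\mathcal E$ closed under $Z\otimes-$ for all $Z\in\mathcal V$; it is proper if $\mathcal E$ consists of epimorphisms and $\mathcal M$ of monomorphisms. An object $X$ is $\mathcal E$-projective if $\mathcal V_0(X,-)$ sends maps of $\mathcal E$ to surjections, and $\mathcal E$-stable if $e^X\in\mathcal E$ for all $e\in\mathcal E$. An $\mathcal E$-generator of $\mathcal V_\lambda$ is a set $\mathcal G\subseteq\mathcal V_\lambda$ such that every $X\in\mathcal V_\lambda$ admits a map $Y\to X$ in $\mathcal E$ with $Y\in\mathcal G$. Let $\mathbb L$ be a single-sorted language given by sets of function symbols $f\colon(X,Y)$ and of relation symbols $R\colon X$. Suppose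 that it is $\lambda$-ary: all these arities lie in $\mathcal V_\lambda$. For an enriched factorization system $(\mathcal E,\mathcal M)$ with $\mathcal M$ consisting of monomorphisms, an $\mathbb L$-structure is an object $A$ with maps $f_A\colon A^X\to A^Y$ and $\mathcal M$-subobjects $R_A\rightarrowtail A^X$. Let $\mathrm{Str}(\mathbb L)$ be the $\mathcal V$-category of $\mathbb L$-structures; its hom-object $\mathrm{Str}(\mathbb L)(A,B)$ is the largest subobject of $[A,B]$ that is compatible with all function symbols and whose maps $[A,B]\to[A^X,B^X]\to[R_A,B^X]$ factor through $[R_A,R_B]$ for all relation symbols $R\colon X$. Let $\mathrm{Str}(\mathbb L)_\lambda$ consist of the $A$ for which $\mathrm{Str}(\mathbb L)(A,-)$ preserves $\lambda$-filtered colimits. *Formulas.* $(X,Y)$-ary terms are built from the morphisms $Y\to X$ of $\mathcal V$ and the function symbols by powers ($t\colon(X,Y)$ gives $t^Z\colon(X\otimes Z,Y\otimes Z)$), composition, and families (terms $t_j\colon(X,Y_j)$ give an $(X,\sum_jY_j)$-ary term); they are interpreted as maps $t_A\colon A^X\to A^Y$. Atomic formulas are $s(x)=t(x)$ and $R^Y(t(z))$,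 where $R\colon X$ and $t\colon(Z,X\otimes Y)$. An $X$-ary formula $\varphi$ is interpreted as an $\mathcal M$-subobject $\varphi_A\rightarrowtail A^X$: equations by the $(\mathcal E,\mathcal M)$-image of the equalizer, $R^Y(t(z))$ by pulling back $R_A^Y\rightarrowtail (A^X)^Y\cong A^{X\otimes Y}$ along $t_A$, conjunctions by intersections, $(\exists y)\psi(x,y)$ by the $(\mathcal E,\mathcal M)$-image of $\psi_A\to A^{X+Y}\to A^X$, and disjunctions by the $(\mathcal E,\mathcal M)$-image of $\sum_j(\varphi_j)_A\to A^X$. A positive-primitive formula is $(\exists y)\varphi$ with $\varphi$ a conjunction of atomic formulas; a positive-existential formula is a disjunction of positive-primitive ones. A formula is in $\mathbb L_{\lambda\lambda}$ if all arities occurring in it are $\lambda$-presentable and all its families (conjunctions, disjunctions, families of terms) have fewer than $\lambda$ members. A morphism $f\colon K\to L$ of $\mathbb L$-structures is *elementary for* an $X$-ary formula $\psi$ if the square with vertical maps $\psi_K\rightarrowtail K^X$ and $\psi_L\rightarrowtail L^X$ over $f^X\colon K^X\to L^X$ is a pullback. It is $\lambda$-elementary if it is elementary for all positive-primitive $\psi$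 in $\mathbb L_{\lambda\lambda}$. The $\lambda$-elementary morphisms are *$\lambda$-p.e. stable* in $\mathrm{Str}(\mathbb L)$ if every $\lambda$-elementary $f$ is elementary for all positive-existential $\psi$ in $\mathbb L_{\lambda\lambda}$. For a family of morphisms $g=(g_j\colon A\to B_j)_{j\in J}$ in $\mathrm{Str}(\mathbb L)$, let $\bigvee_{j}\mathrm{Str}(\mathbb L)(B_j,K)$ be the $(\mathcal E,\mathcal M)$-image of the map $\sum_{j}\mathrm{Str}(\mathbb L)(B_j,K)\to\mathrm{Str}(\mathbb L)(A,K)$ induced by precomposition with the $g_j$. A morphism $f\colon K\to L$ induces a square $$\begin{array}{ccc}\bigvee_{j}\mathrm{Str}(\mathbb L)(B_j,K)&\longrightarrow&\bigvee_{j}\mathrm{Str}(\mathbb L)(B_j,L)\\ \downarrow&&\downarrow\\ \mathrm{Str}(\mathbb L)(A,K)&\xrightarrow{\ \mathrm{Str}(\mathbb L)(A,f)\ }&\mathrm{Str}(\mathbb L)(A,L)\end{array}\qquad(\ast)$$ The morphism $f$ is *$(\lambda,\mathcal E)$-pure* if for every single morphism $g\colon A\to B$ with $A,B\in\mathrm{Str}(\mathbb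 L)_\lambda$ the square formed in the same way by the $(\mathcal E,\mathcal M)$-images of $\mathrm{Str}(\mathbb L)(g,K)$ and $\mathrm{Str}(\mathbb L)(g,L)$ is a pullback. **Statement.** Let $(\mathcal E_0,\mathcal M_0)$ and $(\mathcal E,\mathcal M)$ be proper enriched factorization systems on $\mathcal V$ such that $\mathcal M_0$ and $\mathcal M$ are closed under $\lambda$-filtered colimits in the arrow category $\mathcal V^\to$ and $\mathcal E_0\subseteq\mathcal E$. Let $\mathbb L$ be a $\lambda$-ary language such that either $\mathbb L$ has no function symbols, or the input arities of the function symbols and the arities of the relation symbols are $\mathcal E_0$-stable and $\mathcal V_\lambda$ has an $\mathcal E_0$-generator consisting of $\mathcal E_0$-projective objects. Let structures and formulas be taken with respect to $(\mathcal E,\mathcal M)$, and assume that the inclusion of $\mathrm{Str}(\mathbb L)$ into the $\mathcal V$-category $\mathrm{Str}(\mathbb L)^0$ of $\mathbb L$-structures with respect to $(\mathcal E_0,\mathcal M_0)$ preserves $\lambda$-presentable objects. Then the $\lambda$-elementary morphisms are $\lambda$-p.e. stable in $\mathrm{Str}(\mathbb L)$ if and only if, for every $(\lambda,\mathcal E)$-pure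 morphism $f\colon K\to L$ in $\mathrm{Str}(\mathbb L)$ and every family $(g_j\colon A\to B_j)_{j\in J}$ with $|J|<\lambda$ and $A,B_j\in\mathrm{Str}(\mathbb L)_\lambda$, the square $(\ast)$ is a pullback in $\mathcal V$. -/

import Mathlib

open CategoryTheory MonoidalCategory Limits Opposite

universe u v

noncomputable section

namespace EnrichedLogic

/-! ### The base of enrichment -/

theorem hasColimits_of_isLocallyPresentable (V : Type u) [Category.{v} V]
    [IsLocallyPresentable.{v} V] : HasColimits V := by
  obtain ⟨κ, _, _⟩ := IsLocallyPresentable.exists_cardinal.{v} V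
  infer_instance

theorem hasLimits_of_isLocallyPresentable (V : Type u) [Category.{v} V]
    [IsLocallyPresentable.{v} V] : HasLimits V := by
  obtain ⟨κ, _, _⟩ := IsLocallyPresentable.exists_cardinal.{v} V
  let F := (equivSmallModel.{v} (isCardinalPresentable V κ).FullSubcategory).inverse ⋙
    (isCardinalPresentable V κ).ι
  have : F.IsDense := by dsimp [F]; infer_instance
  let adj := Presheaf.uliftYonedaAdjunction.{v} (A := F)
    (Functor.leftKanExtension uliftYoneda.{v} F) (Functor.leftKanExtensionUnit uliftYoneda.{v} F)
  let _ : Reflective (Presheaf.restrictedULiftYoneda.{v} F) := ⟨_, adj⟩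
  exact hasLimits_of_reflective (Presheaf.restrictedULiftYoneda.{v} F)

attribute [instance] hasColimits_of_isLocallyPresentable hasLimits_of_isLocallyPresentable

/-- `V` is locally `κ`-presentable as a (symmetric) monoidal closed category: `V` is locally
`κ`-presentable, and the `κ`-presentable objects contain the unit and are closed under `⊗`. -/
structure IsLocallyPresentableAsClosed (V : Type u) [Category.{v} V] [MonoidalCategory V]
    (κ : Cardinal.{v}) [Fact κ.IsRegular] : Prop where
  locallyPresentable : IsCardinalLocallyPresentable V κ
  unit : IsCardinalPresentable (𝟙_ V) κ
  tensor : ∀ X Y : V, IsCardinalPresentable X κ → IsCardinalPresentable Y κ →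
    IsCardinalPresentable (X ⊗ Y) κ

section Factorization

variable (V : Type u) [Category.{v} V] [MonoidalCategory V]

/-- An enriched (orthogonal) factorization system `(E, M)` on the base `V`. -/
structure EnrichedFactorizationSystem where
  E : MorphismProperty V
  M : MorphismProperty V
  E_iso : ∀ {X Y : V} (f : X ⟶ Y), IsIso f → E f
  M_iso : ∀ {X Y : V} (f : X ⟶ Y), IsIso f → M f
  E_comp : ∀ {X Y Z : V} (f : X ⟶ Y) (g : Y ⟶ Z), E f → E g → E (f ≫ g)
  M_comp : ∀ {X Y Z : V} (f : X ⟶ Y) (g : Y ⟶ Z), M f → M g → M (f ≫ g)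
  hasFactorization : E.HasFactorization M
  orthogonal : ∀ {X Y Z W : V} (e : X ⟶ Y) (m : Z ⟶ W), E e → M m →
    ∀ (a : X ⟶ Z) (b : Y ⟶ W), a ≫ m = e ≫ b → ∃! d : Y ⟶ Z, e ≫ d = a ∧ d ≫ m = b
  E_tensor : ∀ (Z : V) {X Y : V} (f : X ⟶ Y), E f → E (Z ◁ f)

variable {V}

namespace EnrichedFactorizationSystem

variable (F : EnrichedFactorizationSystem V)

/-- A (chosen) `(E, M)`-factorization of `f`. -/
def factorization {X Y : V} (f : X ⟶ Y) : F.E.MapFactorizationData F.M f :=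
  haveI := F.hasFactorization
  F.E.factorizationData F.M f

/-- The `(E, M)`-image of `f`. -/
def image {X Y : V} (f : X ⟶ Y) : V := (F.factorization f).Z

/-- The `E`-part `X ⟶ image f`. -/
def toImage {X Y : V} (f : X ⟶ Y) : X ⟶ F.image f := (F.factorization f).i

/-- The `M`-part `image f ⟶ Y`. -/
def imageι {X Y : V} (f : X ⟶ Y) : F.image f ⟶ Y := (F.factorization f).p

theorem E_toImage {X Y : V} (f : X ⟶ Y) : F.E (F.toImage f) := (F.factorization f).hi

theorem M_imageι {X Y : V} (f : X ⟶ Y) : F.M (F.imageι f) := (F.factorization f).hp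

theorem toImage_imageι {X Y : V} (f : X ⟶ Y) : F.toImage f ≫ F.imageι f = f :=
  (F.factorization f).fac

/-- A proper factorization system: `E` consists of epimorphisms and `M` of monomorphisms. -/
structure IsProper : Prop where
  epi : ∀ {X Y : V} (f : X ⟶ Y), F.E f → Epi f
  mono : ∀ {X Y : V} (f : X ⟶ Y), F.M f → Mono f

/-- The right class is closed in `V^→` under `κ`-filtered colimits. -/
def MClosedUnderFilteredColimits (κ : Cardinal.{v}) [Fact κ.IsRegular] : Prop :=
  ∀ (J : Type v) [SmallCategory J] [IsCardinalFiltered J κ], F.M.IsStableUnderColimitsOfShape J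

/-- The map induced on `(E, M)`-images by a commutative square with vertical maps `a`, `b`
and horizontal maps `p` (top), `q` (bottom) exists and makes the lower square a pullback:
```
    X  --p-->  X'
    |          |
  im a -----> im b
    |          |
    Y  --q-->  Y'
```
-/
def ImageSquareIsPullback {X Y X' Y' : V} (a : X ⟶ Y) (b : X' ⟶ Y') (p : X ⟶ X') (q : Y ⟶ Y') :
    Prop :=
  ∃ t : F.image a ⟶ F.image b,
    F.toImage a ≫ t = p ≫ F.toImage b ∧ IsPullback t (F.imageι a) (F.imageι b) q

variable {F} in
theorem M_le_of_E_le {F₀ : EnrichedFactorizationSystem V} (h : F₀.E ≤ F.E) : F.M ≤ F₀.M := by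
  intro X Y m hm
  obtain ⟨d, ⟨hd₁, hd₂⟩, -⟩ := F.orthogonal _ _ (h _ (F₀.E_toImage m)) hm (𝟙 X) (F₀.imageι m)
    (by rw [Category.id_comp, F₀.toImage_imageι])
  obtain ⟨w, -, hw⟩ := F₀.orthogonal _ _ (F₀.E_toImage m) (F₀.M_imageι m) (F₀.toImage m)
    (F₀.imageι m) rfl
  have h₁ : d ≫ F₀.toImage m = w :=
    hw _ ⟨by rw [← Category.assoc, hd₁, Category.id_comp],
      by rw [Category.assoc, F₀.toImage_imageι, hd₂]⟩
  have h₂ : 𝟙 _ = w := hw _ ⟨Category.comp_id _, Category.id_comp _⟩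
  have : IsIso (F₀.toImage m) := ⟨d, hd₁, h₁.trans h₂.symm⟩
  rw [← F₀.toImage_imageι m]
  exact F₀.M_comp _ _ (F₀.M_iso _ this) (F₀.M_imageι m)

/-- `X` is `E`-projective. -/
def IsProjective (X : V) : Prop :=
  ∀ {A B : V} (e : A ⟶ B), F.E e → Function.Surjective (fun x : X ⟶ A => x ≫ e)

/-- `X` is `E`-stable. -/
def IsStable [MonoidalClosed V] (X : V) : Prop :=
  ∀ {A B : V} (e : A ⟶ B), F.E e → F.E ((ihom X).map e)

/-- `G` is an `E`-generator for the subcategory of `κ`-presentable objects. -/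
def IsGenerator (κ : Cardinal.{v}) [Fact κ.IsRegular] (G : Set V) : Prop :=
  (∀ Y ∈ G, IsCardinalPresentable Y κ) ∧
    ∀ X : V, IsCardinalPresentable X κ → ∃ Y ∈ G, ∃ e : Y ⟶ X, F.E e

end EnrichedFactorizationSystem

end Factorization

/-! ### Languages and structures -/

/-- A single-sorted language over `V`: function symbols `f : (X, Y)` and relation symbols `R : X`,
with arities in `V`. -/
structure Lang (V : Type u) where
  Fn : Type v
  dom : Fn → V
  cod : Fn → V
  Rel : Type v
  arity : Rel → V

/-- All the arities appearing in the language are `κ`-presentable. -/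
def Lang.IsAry {V : Type u} [Category.{v} V] (L : Lang.{u, v} V)
    (κ : Cardinal.{v}) [Fact κ.IsRegular] : Prop :=
  (∀ f, IsCardinalPresentable (L.dom f) κ) ∧ (∀ f, IsCardinalPresentable (L.cod f) κ) ∧
    ∀ R, IsCardinalPresentable (L.arity R) κ

/-- A relational language. -/
def Lang.IsRelational {V : Type u} (L : Lang.{u, v} V) : Prop := IsEmpty L.Fn

variable {V : Type u} [Category.{v} V] [MonoidalCategory V] [MonoidalClosed V]

/-- An `L`-structure, with relation symbols interpreted by `M`-subobjects (monomorphisms in `M`).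
The power `A^X` is `(ihom X).obj A`. -/
structure Str (L : Lang.{u, v} V) (M : MorphismProperty V) where
  carrier : V
  fn : ∀ f : L.Fn, (ihom (L.dom f)).obj carrier ⟶ (ihom (L.cod f)).obj carrier
  rel : L.Rel → V
  incl : ∀ R : L.Rel, rel R ⟶ (ihom (L.arity R)).obj carrier
  incl_mem : ∀ R : L.Rel, M (incl R)
  incl_mono : ∀ R : L.Rel, Mono (incl R)

namespace Str

variable {L : Lang.{u, v} V} {M : MorphismProperty V}

/-- Morphisms of `L`-structures. -/
@[ext]
structure Hom (A B : Str L M) where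
  map : A.carrier ⟶ B.carrier
  fn_comm : ∀ f : L.Fn,
    (ihom (L.dom f)).map map ≫ B.fn f = A.fn f ≫ (ihom (L.cod f)).map map
  rel_lift : ∀ R : L.Rel, ∃ h : A.rel R ⟶ B.rel R,
    h ≫ B.incl R = A.incl R ≫ (ihom (L.arity R)).map map

instance : Category (Str L M) where
  Hom := Hom
  id A :=
    { map := 𝟙 _
      fn_comm := fun f => by simp
      rel_lift := fun R => ⟨𝟙 _, by simp⟩ }
  comp {A B C} g h :=
    { map := g.map ≫ h.map
      fn_comm := fun f => by
        rw [Functor.map_comp, Functor.map_comp, Category.assoc, h.fn_comm, ← Category.assoc,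
          g.fn_comm, Category.assoc]
      rel_lift := fun R => by
        obtain ⟨a, ha⟩ := g.rel_lift R
        obtain ⟨b, hb⟩ := h.rel_lift R
        exact ⟨a ≫ b, by
          rw [Category.assoc, hb, ← Category.assoc, ha, Category.assoc, Functor.map_comp]⟩ }
  id_comp _ := Hom.ext (Category.id_comp _)
  comp_id _ := Hom.ext (Category.comp_id _)
  assoc _ _ _ := Hom.ext (Category.assoc _ _ _)

@[simp] theorem comp_map {A B C : Str L M} (f : A ⟶ B) (g : B ⟶ C) :
    (f ≫ g).map = f.map ≫ g.map := rfl

@[simp] theorem id_map (A : Str L M) : Hom.map (𝟙 A) = 𝟙 A.carrier := rfl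

/-- If `M ≤ M₀`, a structure for `M` is a structure for `M₀`. This is the object part of the
inclusion of the category of `L`-structures for `M` into the one for `M₀`. -/
def ofLE {M₀ : MorphismProperty V} (h : M ≤ M₀) (A : Str L M) : Str L M₀ where
  carrier := A.carrier
  fn := A.fn
  rel := A.rel
  incl := A.incl
  incl_mem R := h _ (A.incl_mem R)
  incl_mono := A.incl_mono

end Str

/-! ### The hom-objects of the `V`-category of structures -/

/-- The action `[A, B] ⟶ [A^X, B^X]` of the power `V`-functor `(-)^X`. -/
def powAct (X A B : V) :
    (ihom A).obj B ⟶ (ihom ((ihom X).obj A)).obj ((ihom X).obj B) :=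
  MonoidalClosed.curry (MonoidalClosed.comp X A B)

theorem uncurry_uncurry_powAct (X A B : V) :
    MonoidalClosed.uncurry (MonoidalClosed.uncurry (powAct X A B)) =
      (α_ _ _ _).inv ≫ (ihom.ev X).app A ▷ _ ≫ (ihom.ev A).app B := by
  rw [powAct, MonoidalClosed.uncurry_curry, MonoidalClosed.comp_eq, MonoidalClosed.uncurry_curry,
    MonoidalClosed.compTranspose_eq]

theorem powAct_post (X A : V) {B C : V} (h : B ⟶ C) :
    powAct X A B ≫ (ihom ((ihom X).obj A)).map ((ihom X).map h) =
      (ihom A).map h ≫ powAct X A C := by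
  apply MonoidalClosed.uncurry_injective
  apply MonoidalClosed.uncurry_injective
  rw [MonoidalClosed.uncurry_natural_right, MonoidalClosed.uncurry_natural_right,
    uncurry_uncurry_powAct, MonoidalClosed.uncurry_natural_left,
    MonoidalClosed.uncurry_natural_left, uncurry_uncurry_powAct]
  simp only [Category.assoc]
  rw [associator_inv_naturality_right_assoc, whisker_exchange_assoc]
  exact congrArg (fun k => (α_ X ((ihom X).obj A) ((ihom A).obj B)).inv ≫
    (ihom.ev X).app A ▷ ((ihom A).obj B) ≫ k) (ihom.ev_naturality A h).symm

theorem powAct_pre (X : V) {A B : V} (C : V) (g : A ⟶ B) :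
    powAct X B C ≫ (MonoidalClosed.pre ((ihom X).map g)).app ((ihom X).obj C) =
      (MonoidalClosed.pre g).app C ≫ powAct X A C := by
  apply MonoidalClosed.uncurry_injective
  apply MonoidalClosed.uncurry_injective
  rw [MonoidalClosed.uncurry_pre_app, MonoidalClosed.uncurry_natural_left,
    MonoidalClosed.uncurry_natural_left, MonoidalClosed.uncurry_natural_left,
    uncurry_uncurry_powAct, uncurry_uncurry_powAct, associator_inv_naturality_middle_assoc,
    associator_inv_naturality_right_assoc, whisker_exchange_assoc, ← comp_whiskerRight_assoc,
    ihom.ev_naturality, comp_whiskerRight_assoc]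
  exact congrArg (fun k => (α_ X ((ihom X).obj A) ((ihom B).obj C)).inv ≫
    (ihom.ev X).app A ▷ ((ihom B).obj C) ≫ k)
      (MonoidalClosed.id_tensor_pre_app_comp_ev g C).symm

namespace Str

variable {L : Lang.{u, v} V} {M : MorphismProperty V}

/-- A generalized element of `[A, B]` satisfies all the conditions. -/
structure IsHomElement {A B : Str L M} {Z : V} (z : Z ⟶ (ihom A.carrier).obj B.carrier) :
    Prop where
  fn : ∀ f : L.Fn,
    z ≫ powAct (L.dom f) A.carrier B.carrier ≫
        (ihom ((ihom (L.dom f)).obj A.carrier)).map (B.fn f) =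
      z ≫ powAct (L.cod f) A.carrier B.carrier ≫
        (MonoidalClosed.pre (A.fn f)).app ((ihom (L.cod f)).obj B.carrier)
  rel : ∀ R : L.Rel, ∃ w : Z ⟶ (ihom (A.rel R)).obj (B.rel R),
    z ≫ powAct (L.arity R) A.carrier B.carrier ≫
        (MonoidalClosed.pre (A.incl R)).app ((ihom (L.arity R)).obj B.carrier) =
      w ≫ (ihom (A.rel R)).map (B.incl R)

theorem IsHomElement.post {A K N : Str L M} (f : K ⟶ N) {Z : V}
    {z : Z ⟶ (ihom A.carrier).obj K.carrier} (hz : IsHomElement z) :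
    IsHomElement (B := N) (z ≫ (ihom A.carrier).map f.map) := by
  constructor
  · intro s
    have h := hz.fn s
    calc (z ≫ (ihom A.carrier).map f.map) ≫ powAct (L.dom s) A.carrier N.carrier ≫
          (ihom ((ihom (L.dom s)).obj A.carrier)).map (N.fn s)
        = (z ≫ powAct (L.dom s) A.carrier K.carrier ≫
          (ihom ((ihom (L.dom s)).obj A.carrier)).map (K.fn s)) ≫
          (ihom ((ihom (L.dom s)).obj A.carrier)).map ((ihom (L.cod s)).map f.map) := by
          simp only [Category.assoc]
          rw [← reassoc_of% (powAct_post (L.dom s) A.carrier f.map), ← Functor.map_comp,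
            f.fn_comm s, Functor.map_comp]
      _ = _ := by
          rw [h]
          simp only [Category.assoc]
          rw [← reassoc_of% (powAct_post (L.cod s) A.carrier f.map),
            MonoidalClosed.pre_comm_ihom_map]
  · intro R
    obtain ⟨w, hw⟩ := hz.rel R
    obtain ⟨r, hr⟩ := f.rel_lift R
    refine ⟨w ≫ (ihom (A.rel R)).map r, ?_⟩
    rw [Category.assoc, Category.assoc, ← Functor.map_comp, hr, Functor.map_comp,
      ← reassoc_of% hw, ← reassoc_of% (powAct_post (L.arity R) A.carrier f.map),
      MonoidalClosed.pre_comm_ihom_map]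

theorem IsHomElement.pre {A B K : Str L M} (g : A ⟶ B) {Z : V}
    {z : Z ⟶ (ihom B.carrier).obj K.carrier} (hz : IsHomElement z) :
    IsHomElement (A := A) (z ≫ (MonoidalClosed.pre g.map).app K.carrier) := by
  constructor
  · intro s
    have h := hz.fn s
    rw [Category.assoc, Category.assoc, ← reassoc_of% (powAct_pre (L.dom s) K.carrier g.map),
      ← reassoc_of% (powAct_pre (L.cod s) K.carrier g.map), MonoidalClosed.pre_comm_ihom_map,
      reassoc_of% h, ← NatTrans.comp_app, ← NatTrans.comp_app, ← MonoidalClosed.pre_map,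
      ← MonoidalClosed.pre_map, g.fn_comm s]
  · intro R
    obtain ⟨w, hw⟩ := hz.rel R
    obtain ⟨r, hr⟩ := g.rel_lift R
    refine ⟨w ≫ (MonoidalClosed.pre r).app _, ?_⟩
    rw [Category.assoc, Category.assoc, MonoidalClosed.pre_comm_ihom_map, ← reassoc_of% hw,
      ← reassoc_of% (powAct_pre (L.arity R) K.carrier g.map), ← NatTrans.comp_app,
      ← NatTrans.comp_app, ← MonoidalClosed.pre_map, ← MonoidalClosed.pre_map, hr]

variable [IsLocallyPresentable.{v} V]

/-- The conditions cutting the hom-object of structures out of `[A, B]`: for a function symbol,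
commutation with its interpretations; for a relation symbol, factorization through
`[R_A, R_B]`. -/
def homCondObj (A B : Str L M) : L.Fn ⊕ L.Rel → V
  | Sum.inl f =>
      equalizer
        (powAct (L.dom f) A.carrier B.carrier ≫
          (ihom ((ihom (L.dom f)).obj A.carrier)).map (B.fn f))
        (powAct (L.cod f) A.carrier B.carrier ≫
          (MonoidalClosed.pre (A.fn f)).app ((ihom (L.cod f)).obj B.carrier))
  | Sum.inr R =>
      pullback
        (powAct (L.arity R) A.carrier B.carrier ≫
          (MonoidalClosed.pre (A.incl R)).app ((ihom (L.arity R)).obj B.carrier))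
        ((ihom (A.rel R)).map (B.incl R))

/-- The inclusion of a condition into `[A, B]`. -/
def homCondι (A B : Str L M) :
    ∀ i : L.Fn ⊕ L.Rel, homCondObj A B i ⟶ (ihom A.carrier).obj B.carrier
  | Sum.inl _ => equalizer.ι _ _
  | Sum.inr _ => pullback.fst _ _

/-- The hom-object `Str(L)(A, B)` in `V`: the intersection of all the conditions. -/
def homObj (A B : Str L M) : V :=
  widePullback ((ihom A.carrier).obj B.carrier) (homCondObj A B) (homCondι A B)

/-- The inclusion `Str(L)(A, B) ⟶ [A, B]`. -/
def homι (A B : Str L M) : homObj A B ⟶ (ihom A.carrier).obj B.carrier :=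
  WidePullback.base (homCondι A B)

instance mono_homCondι (A B : Str L M) (i : L.Fn ⊕ L.Rel) : Mono (homCondι A B i) := by
  cases i with
  | inl f => exact equalizer.ι_mono
  | inr R =>
    have := B.incl_mono R
    have : Mono ((ihom (A.rel R)).map (B.incl R)) := inferInstance
    exact pullback.fst_of_mono

/-- The projection of the hom-object to a condition. -/
def homπ (A B : Str L M) (i : L.Fn ⊕ L.Rel) : homObj A B ⟶ homCondObj A B i :=
  WidePullback.π (homCondι A B) i

theorem homπ_homCondι (A B : Str L M) (i : L.Fn ⊕ L.Rel) :
    homπ A B i ≫ homCondι A B i = homι A B :=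
  WidePullback.π_arrow _ _

instance mono_homι (A B : Str L M) : Mono (homι A B) := by
  constructor
  intro Z g h w
  refine WidePullback.hom_ext _ _ _ (fun i => ?_) w
  have key : (g ≫ homπ A B i) ≫ homCondι A B i = (h ≫ homπ A B i) ≫ homCondι A B i := by
    rw [Category.assoc, Category.assoc, homπ_homCondι, w]
  exact (cancel_mono (homCondι A B i)).1 key

theorem isHomElement_homι (A B : Str L M) : IsHomElement (homι A B) := by
  constructor
  · intro f
    rw [← homπ_homCondι A B (Sum.inl f), Category.assoc, Category.assoc]
    exact congrArg _ (equalizer.condition _ _)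
  · intro R
    let p : homCondObj A B (Sum.inr R) ⟶ (ihom (A.rel R)).obj (B.rel R) := pullback.snd _ _
    refine ⟨homπ A B (Sum.inr R) ≫ p, ?_⟩
    rw [← homπ_homCondι A B (Sum.inr R), Category.assoc, Category.assoc]
    exact congrArg _ pullback.condition

/-- The universal property of the hom-object. -/
theorem exists_homLift {A B : Str L M} {Z : V} (z : Z ⟶ (ihom A.carrier).obj B.carrier)
    (hz : IsHomElement z) : ∃ l : Z ⟶ homObj A B, l ≫ homι A B = z := by
  have key : ∀ i, ∃ l : Z ⟶ homCondObj A B i, l ≫ homCondι A B i = z := by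
    rintro (f | R)
    · exact ⟨equalizer.lift z (hz.fn f), equalizer.lift_ι _ _⟩
    · obtain ⟨w, hw⟩ := hz.rel R
      exact ⟨pullback.lift z w hw, pullback.lift_fst _ _ _⟩
  choose l hl using key
  exact ⟨WidePullback.lift z l hl, WidePullback.lift_base _ _ _ _⟩

/-- The factorization of an element of `[A, B]` satisfying the conditions through the
hom-object. -/
def homLift {A B : Str L M} {Z : V} (z : Z ⟶ (ihom A.carrier).obj B.carrier)
    (hz : IsHomElement z) : Z ⟶ homObj A B := (exists_homLift z hz).choose

theorem homLift_homι {A B : Str L M} {Z : V} (z : Z ⟶ (ihom A.carrier).obj B.carrier)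
    (hz : IsHomElement z) : homLift z hz ≫ homι A B = z := (exists_homLift z hz).choose_spec

/-- `Str(L)(A, f) : Str(L)(A, K) ⟶ Str(L)(A, N)`. -/
def homPost (A : Str L M) {K N : Str L M} (f : K ⟶ N) : homObj A K ⟶ homObj A N :=
  homLift (homι A K ≫ (ihom A.carrier).map f.map) ((isHomElement_homι A K).post f)

/-- `Str(L)(g, K) : Str(L)(B, K) ⟶ Str(L)(A, K)`. -/
def homPre {A B : Str L M} (g : A ⟶ B) (K : Str L M) : homObj B K ⟶ homObj A K :=
  homLift (homι B K ≫ (MonoidalClosed.pre g.map).app K.carrier) ((isHomElement_homι B K).pre g)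

/-- The functor `Str(L)(A, -)` from the underlying category of `Str(L)` to `V`. -/
def homFunctor (A : Str L M) : Str L M ⥤ V where
  obj K := homObj A K
  map f := homPost A f
  map_id K := by
    rw [← cancel_mono (homι A K), homPost, homLift_homι]
    simp
  map_comp f g := by
    rw [← cancel_mono (homι A _), Category.assoc, homPost, homPost, homPost, homLift_homι,
      homLift_homι, reassoc_of% homLift_homι]
    simp

/-- `A` is a `κ`-presentable object of the `V`-category of structures: `Str(L)(A, -)`
preserves `κ`-filtered colimits. -/
def IsPresentable (κ : Cardinal.{v}) [Fact κ.IsRegular] (A : Str L M) : Prop :=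
  (homFunctor A).IsCardinalAccessible κ

end Str

/-! ### Terms and formulas -/

variable [SymmetricCategory V]

section Formulas

variable [IsLocallyPresentable.{v} V]

/-- `(X, Y)`-ary terms over `L`. The superposition of `s : (∐ Y, W)` with a family `t j : (X, Y j)`
is `comp (tuple Y t) s`. -/
inductive Term (L : Lang.{u, v} V) : V → V → Type (max u (v + 1))
  | ofHom {X Y : V} (f : Y ⟶ X) : Term L X Y
  | symb (f : L.Fn) : Term L (L.dom f) (L.cod f)
  | pow {X Y : V} (Z : V) (t : Term L X Y) : Term L (X ⊗ Z) (Y ⊗ Z)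
  | tuple {X : V} {J : Type v} (Y : J → V) (t : ∀ j, Term L X (Y j)) : Term L X (∐ Y)
  | comp {X Y W : V} (t : Term L X Y) (s : Term L Y W) : Term L X W

/-- Formulas over `L`, indexed by their arity. -/
inductive Formula (L : Lang.{u, v} V) : V → Type (max u (v + 1))
  | eq {X Y : V} (s t : Term L X Y) : Formula L X
  | rel {Z : V} (R : L.Rel) (Y : V) (t : Term L Z (L.arity R ⊗ Y)) : Formula L Z
  | conj {X : V} {J : Type v} (φ : J → Formula L X) : Formula L X
  | ex {X : V} (Y : V) (ψ : Formula L (X ⨿ Y)) : Formula L X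
  | disj {X : V} {J : Type v} (φ : J → Formula L X) : Formula L X

variable (κ : Cardinal.{v}) [Fact κ.IsRegular]

/-- All arities involved are `κ`-presentable, and all families of terms are of size
less than `κ`. -/
def Term.IsAry {L : Lang.{u, v} V} : ∀ {X Y : V}, Term L X Y → Prop
  | X, Y, .ofHom _ => IsCardinalPresentable X κ ∧ IsCardinalPresentable Y κ
  | _, _, .symb f => IsCardinalPresentable (L.dom f) κ ∧ IsCardinalPresentable (L.cod f) κ
  | _, _, .pow Z t => IsCardinalPresentable Z κ ∧ t.IsAry
  | X, _, .tuple (J := J) _ t =>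
      IsCardinalPresentable X κ ∧ Cardinal.mk J < κ ∧ ∀ j, (t j).IsAry
  | _, _, .comp t s => t.IsAry ∧ s.IsAry

namespace Formula

variable {L : Lang.{u, v} V}

/-- The formula belongs to `L_{κκ}`: all arities involved are `κ`-presentable, and all conjunctions
and disjunctions are of fewer than `κ` formulas. -/
def IsAry : ∀ {X : V}, Formula L X → Prop
  | _, .eq s t => s.IsAry κ ∧ t.IsAry κ
  | _, .rel R Y t => IsCardinalPresentable (L.arity R) κ ∧ IsCardinalPresentable Y κ ∧ t.IsAry κ
  | X, .conj (J := J) φ =>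
      IsCardinalPresentable X κ ∧ Cardinal.mk J < κ ∧ ∀ j, (φ j).IsAry
  | X, .ex Y ψ => IsCardinalPresentable X κ ∧ IsCardinalPresentable Y κ ∧ ψ.IsAry
  | X, .disj (J := J) φ =>
      IsCardinalPresentable X κ ∧ Cardinal.mk J < κ ∧ ∀ j, (φ j).IsAry

/-- Atomic formulas. -/
def IsAtomic : ∀ {X : V}, Formula L X → Prop
  | _, .eq _ _ => True
  | _, .rel _ _ _ => True
  | _, _ => False

/-- Positive-primitive formulas: `∃ y, φ` with `φ` a conjunction of atomic formulas. -/
def IsPositivePrimitive {X : V} (ψ : Formula L X) : Prop :=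
  ∃ (Y : V) (J : Type v) (φ : J → Formula L (X ⨿ Y)),
    ψ = .ex Y (.conj φ) ∧ ∀ j, (φ j).IsAtomic

/-- Positive-existential formulas: disjunctions of positive-primitive formulas. -/
def IsPositiveExistential {X : V} (ψ : Formula L X) : Prop :=
  ∃ (J : Type v) (φ : J → Formula L X), ψ = .disj φ ∧ ∀ j, (φ j).IsPositivePrimitive

end Formula

end Formulas

/-! ### Interpretation -/

/-- The isomorphism `A^{X ⊗ Y} ≅ (A^X)^Y`. -/
def powTensor (X Y A : V) : (ihom (X ⊗ Y)).obj A ≅ (ihom Y).obj ((ihom X).obj A) where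
  hom := MonoidalClosed.curry (MonoidalClosed.curry ((α_ X Y _).inv ≫ (ihom.ev (X ⊗ Y)).app A))
  inv := MonoidalClosed.curry
    ((α_ X Y _).hom ≫ X ◁ (ihom.ev Y).app ((ihom X).obj A) ≫ (ihom.ev X).app A)
  hom_inv_id := by
    apply MonoidalClosed.uncurry_injective
    rw [MonoidalClosed.uncurry_natural_left, MonoidalClosed.uncurry_curry,
      MonoidalClosed.uncurry_id_eq_ev, associator_naturality_right_assoc,
      ← MonoidalCategory.whiskerLeft_comp_assoc, ← MonoidalClosed.uncurry_eq,
      ← MonoidalClosed.uncurry_eq, MonoidalClosed.uncurry_curry, MonoidalClosed.uncurry_curry]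
    simp
  inv_hom_id := by
    apply MonoidalClosed.uncurry_injective
    apply MonoidalClosed.uncurry_injective
    rw [MonoidalClosed.uncurry_natural_left, MonoidalClosed.uncurry_curry,
      MonoidalClosed.uncurry_natural_left, MonoidalClosed.uncurry_curry,
      associator_inv_naturality_right_assoc, ← MonoidalClosed.uncurry_eq,
      MonoidalClosed.uncurry_curry, MonoidalClosed.uncurry_id_eq_ev, MonoidalClosed.uncurry_eq]
    simp

variable [IsLocallyPresentable.{v} V]

/-- The map `B ⟶ A^{∐ Y}` with components `t j : B ⟶ A^{Y j}`. -/
def tupleMap {J : Type v} (Y : J → V) (A B : V) (t : ∀ j, B ⟶ (ihom (Y j)).obj A) :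
    B ⟶ (ihom (∐ Y)).obj A :=
  MonoidalClosed.curry ((β_ (∐ Y) B).hom ≫ MonoidalClosed.uncurry (Sigma.desc fun j =>
    MonoidalClosed.curry ((β_ B (Y j)).hom ≫ MonoidalClosed.uncurry (t j))))

theorem tupleMap_pre_ι {J : Type v} (Y : J → V) (A B : V) (t : ∀ j, B ⟶ (ihom (Y j)).obj A) (j : J) :
    tupleMap Y A B t ≫ (MonoidalClosed.pre (Sigma.ι Y j)).app A = t j := by
  apply MonoidalClosed.uncurry_injective
  rw [MonoidalClosed.uncurry_pre_app, tupleMap, MonoidalClosed.uncurry_curry,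
    BraidedCategory.braiding_naturality_left_assoc, ← MonoidalClosed.uncurry_natural_left,
    Sigma.ι_desc, MonoidalClosed.uncurry_curry, SymmetricCategory.symmetry_assoc]

/-- The interpretation `t_A : A^X ⟶ A^Y` of an `(X, Y)`-ary term. -/
def Term.interp {L : Lang.{u, v} V} {M : MorphismProperty V} (A : Str L M) :
    ∀ {X Y : V}, Term L X Y → ((ihom X).obj A.carrier ⟶ (ihom Y).obj A.carrier)
  | _, _, .ofHom f => (MonoidalClosed.pre f).app A.carrier
  | _, _, .symb f => A.fn f
  | _, _, .pow (X := X) (Y := Y) Z t =>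
      (powTensor X Z A.carrier).hom ≫ (ihom Z).map (t.interp A) ≫ (powTensor Y Z A.carrier).inv
  | _, _, .tuple Y t => tupleMap Y A.carrier _ (fun j => (t j).interp A)
  | _, _, .comp t s => t.interp A ≫ s.interp A

/-- The interpretation `φ_A ↣ A^X` of an `X`-ary formula, as an object over `A^X`. -/
def Formula.interp (F : EnrichedFactorizationSystem V) {L : Lang.{u, v} V} (A : Str L F.M) :
    ∀ {X : V}, Formula L X → Over ((ihom X).obj A.carrier)
  | _, .eq s t => Over.mk (F.imageι (equalizer.ι (s.interp A) (t.interp A)))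
  | _, .rel R Y t =>
      Over.mk (pullback.fst (t.interp A)
        ((ihom Y).map (A.incl R) ≫ (powTensor (L.arity R) Y A.carrier).inv))
  | X, .conj φ =>
      Over.mk (WidePullback.base (B := (ihom X).obj A.carrier)
        (fun j => ((φ j).interp F A).hom))
  | _, .ex _ ψ =>
      Over.mk (F.imageι ((ψ.interp F A).hom ≫ (MonoidalClosed.pre coprod.inl).app A.carrier))
  | _, .disj φ =>
      Over.mk (F.imageι (Sigma.desc fun j => ((φ j).interp F A).hom))

/-! ### Elementary and pure morphisms -/

section Stability

variable (F : EnrichedFactorizationSystem V) {L : Lang.{u, v} V}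
  (κ : Cardinal.{v}) [Fact κ.IsRegular]

/-- The square formed by `φ_K`, `φ_N`, `K^X` and `N^X` is a pullback. -/
def IsElementaryFor {K N : Str L F.M} (f : K ⟶ N) {X : V} (φ : Formula L X) : Prop :=
  ∃ t : (φ.interp F K).left ⟶ (φ.interp F N).left,
    IsPullback t (φ.interp F K).hom (φ.interp F N).hom ((ihom X).map f.map)

/-- `κ`-elementary morphisms of structures. -/
def IsElementary {K N : Str L F.M} (f : K ⟶ N) : Prop :=
  ∀ (X : V) (φ : Formula L X), φ.IsAry κ → φ.IsPositivePrimitive → IsElementaryFor F f φ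

variable (L) in
/-- `κ`-elementary morphisms of `L`-structures are `κ`-positive-existentially stable. -/
def ElementaryIsPEStable : Prop :=
  ∀ (K N : Str L F.M) (f : K ⟶ N), IsElementary F κ f →
    ∀ (X : V) (φ : Formula L X), φ.IsAry κ → φ.IsPositiveExistential → IsElementaryFor F f φ

/-- `(κ, E)`-pure morphisms in `Str(L)`: for every `g : A ⟶ B` between `κ`-presentable structures,
the square formed by the `(E, M)`-images of `Str(L)(g, K)` and `Str(L)(g, N)`, over
`Str(L)(A, f)`, is a pullback. -/
def IsPure {K N : Str L F.M} (f : K ⟶ N) : Prop :=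
  ∀ (A B : Str L F.M), A.IsPresentable κ → B.IsPresentable κ → ∀ g : A ⟶ B,
    F.ImageSquareIsPullback (Str.homPre g K) (Str.homPre g N) (Str.homPost B f) (Str.homPost A f)

/-- The map `∑_j Str(L)(B_j, K) ⟶ Str(L)(A, K)` induced by a cone `g_j : A ⟶ B_j`. -/
def coneMap {A : Str L F.M} {J : Type v} {B : J → Str L F.M} (g : ∀ j, A ⟶ B j) (K : Str L F.M) :
    (∐ fun j => Str.homObj (B j) K) ⟶ Str.homObj A K :=
  Sigma.desc fun j => Str.homPre (g j) K

/-- The square formed by the `(E, M)`-images of `∑_j Str(L)(B_j, -) ⟶ Str(L)(A, -)` at `K` and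
`N`, over `Str(L)(A, f)`, is a pullback. -/
def ConeImageSquareIsPullback {K N : Str L F.M} (f : K ⟶ N) {A : Str L F.M} {J : Type v}
    {B : J → Str L F.M} (g : ∀ j, A ⟶ B j) : Prop :=
  F.ImageSquareIsPullback (coneMap F g K) (coneMap F g N)
    (Limits.Sigma.map fun j => Str.homPost (B j) f) (Str.homPost A f)

end Stability

end EnrichedLogic

end

set_option linter.unusedSectionVars false

noncomputable section

namespace EnrichedLogic

/-! ### Factoring through a morphism -/

/-! The two sides are linked by a dictionary between κ-presentable structures and conjunctions of
fewer than κ atomic formulas. Say that A represents an X-ary conjunction φ if it carries a generic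
element x₀ : X ⟶ A such that morphisms A ⟶ K are exactly the elements X ⟶ K satisfying φ (`IsRep`).
Restriction along x₀ then identifies Str(A, K) with the subobject φ_K of K^X, and this inclusion
lies in M. If g : A ⟶ B and B represents a conjunction χ(x, z) whose x-part is g(x₀), the image of
Str(g, K), regarded inside K^X, is the part of the interpretation of (∃z)χ lying in Str(A, K), which
is all of it (`factors_imageι_homPre_iff`). For a family g_j one gets the disjunction of such
formulas (`factors_imageι_coneMap_iff`). A square of images of hom-objects is therefore a pullback
iff the corresponding formula is preserved and reflected on the elements of K^X coming from Str(A,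
K).

Taking A free on X, where Str(A, K) is all of K^X, shows that pure morphisms are elementary, and
that pullback squares (∗) give elementarity for positive-existential formulas. Presentations of
arbitrary presentable A and B give both converses. The theorem is the formal combination of these
four implications.

Two points need work. The first is the existence and presentability of representing structures.
Structures embed fully into a category of spans X_k ⊗ B_i ⟶ A, whose colimits are componentwise. The
embedding has a left adjoint (`exists_reflection`) and preserves κ-filtered colimits
(`preservesColimitsOfShape_spanFunctor`). Hence structures have colimits, and conjunctions are
represented by coequalizers, pushouts and wide pushouts of free structures (`exists_rep`). The
enriched universal property follows from the ordinary one, because maps W ⟶ Str(A, K) are morphisms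
A ⟶ K^W and atomic formulas hold pointwise in the power K^W.

The second point is that every presentable structure has a presentation (`exists_presentation`).
Presentable structures arise under κ-small colimits from structures freely generated by an element
or by an element of a relation (`isPresentable_induction`). To present a colimit or a morphism, the
image of one generic element must be written as a term in another. Without function symbols the
generic element can be chosen invertible and variables suffice. Otherwise, stability and
projectivity with respect to E₀ show that each presentable element y is a term value after
precomposition with an epimorphism e (`IsRep.lifts`). The equation e(x) = t(z) still determines x
because e is epi. -/

/-- `y` factors through `m`. -/
def Factors {C : Type u} [Category.{v} C] {S Y P : C} (m : S ⟶ Y) (y : P ⟶ Y) : Prop :=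
  ∃ h : P ⟶ S, h ≫ m = y

section

variable {C : Type u} [Category.{v} C]

theorem Factors.comp_left {S Y P P' : C} {m : S ⟶ Y} {y : P ⟶ Y} (h : Factors m y) (p : P' ⟶ P) :
    Factors m (p ≫ y) := by
  obtain ⟨h, rfl⟩ := h
  exact ⟨p ≫ h, by simp⟩

theorem factors_self {S Y : C} (m : S ⟶ Y) : Factors m m := ⟨𝟙 _, by simp⟩

theorem factors_comp_mono_iff {S Y Z P : C} (m : S ⟶ Y) (n : Y ⟶ Z) [Mono n] (y : P ⟶ Y) :
    Factors (m ≫ n) (y ≫ n) ↔ Factors m y := by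
  constructor
  · rintro ⟨h, hh⟩
    exact ⟨h, by rwa [← cancel_mono n, Category.assoc]⟩
  · rintro ⟨h, rfl⟩
    exact ⟨h, by simp⟩

theorem factors_iff_of_isPullback {P' X Y Z P : C} {t : P' ⟶ X} {m' : P' ⟶ Y} {m : X ⟶ Z}
    {q : Y ⟶ Z} (h : IsPullback t m' m q) (y : P ⟶ Y) : Factors m' y ↔ Factors m (y ≫ q) := by
  constructor
  · rintro ⟨l, rfl⟩
    exact ⟨l ≫ t, by simp [h.w]⟩
  · rintro ⟨l, hl⟩
    exact ⟨h.lift l y hl, by simp⟩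

/-- Since both vertical maps are monic, the universal property of the pullback reduces to saying
which generalized elements of the base belong to the subobject. All pullback squares of subobjects
below are compared through this criterion. -/
theorem exists_isPullback_iff {S S' Y Y' : C} (m : S ⟶ Y) (m' : S' ⟶ Y') [Mono m] [Mono m']
    (q : Y ⟶ Y') : (∃ t : S ⟶ S', IsPullback t m m' q) ↔
      ∀ (P : C) (y : P ⟶ Y), Factors m y ↔ Factors m' (y ≫ q) := by
  constructor
  · rintro ⟨t, ht⟩ P y
    exact factors_iff_of_isPullback ht y
  · intro h
    obtain ⟨t, ht⟩ := (h S m).1 (factors_self m)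
    refine ⟨t, ⟨⟨ht⟩, ⟨PullbackCone.IsLimit.mk _
      (fun s => ((h _ s.snd).2 ⟨s.fst, s.condition⟩).choose) (fun s => ?_) (fun s => ?_)
      (fun s l _ h₂ => ?_)⟩⟩⟩
    · rw [← cancel_mono m', Category.assoc, ht,
        reassoc_of% ((h _ s.snd).2 ⟨s.fst, s.condition⟩).choose_spec, s.condition]
    · exact ((h _ s.snd).2 ⟨s.fst, s.condition⟩).choose_spec
    · rw [← cancel_mono m, h₂, ((h _ s.snd).2 ⟨s.fst, s.condition⟩).choose_spec]

end

/-! ### Proper factorization systems: locality of membership, and images. -/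

namespace EnrichedFactorizationSystem

variable {V : Type u} [Category.{v} V] [MonoidalCategory V] {F : EnrichedFactorizationSystem V}

theorem exists_lift {X Y Z W : V} {e : X ⟶ Y} {m : Z ⟶ W} (he : F.E e) (hm : F.M m)
    {a : X ⟶ Z} {b : Y ⟶ W} (w : a ≫ m = e ≫ b) : ∃ d : Y ⟶ Z, e ≫ d = a ∧ d ≫ m = b :=
  (F.orthogonal e m he hm a b w).exists

/-- Orthogonality read as descent: membership in an M-subobject is local along maps of E. -/
theorem factors_of_E {X Y Z W : V} {e : X ⟶ Y} {m : Z ⟶ W} (he : F.E e) (hm : F.M m)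
    {b : Y ⟶ W} (h : Factors m (e ≫ b)) : Factors m b := by
  obtain ⟨a, ha⟩ := h
  obtain ⟨d, -, hd⟩ := exists_lift he hm ha
  exact ⟨d, hd⟩

theorem mono_imageι (hF : F.IsProper) {X Y : V} (f : X ⟶ Y) : Mono (F.imageι f) :=
  hF.mono _ (F.M_imageι f)

/-- Existence of fillers suffices: a filler against the image of `m` is a retraction of the E-part,
and it is an inverse because the M-part is monic. -/
theorem M_of_lift (hF : F.IsProper) {Z W : V} (m : Z ⟶ W)
    (h : ∀ {X Y : V} (e : X ⟶ Y), F.E e → ∀ (a : X ⟶ Z) (b : Y ⟶ W), a ≫ m = e ≫ b →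
      ∃ d : Y ⟶ Z, e ≫ d = a ∧ d ≫ m = b) : F.M m := by
  obtain ⟨d, hd₁, hd₂⟩ := h (F.toImage m) (F.E_toImage m) (𝟙 _) (F.imageι m)
    (by rw [Category.id_comp, F.toImage_imageι])
  have := mono_imageι hF m
  have : IsIso (F.toImage m) := ⟨d, hd₁, by
    rw [← cancel_mono (F.imageι m), Category.assoc, F.toImage_imageι, hd₂, Category.id_comp]⟩
  rw [← F.toImage_imageι m]
  exact F.M_comp _ _ (F.M_iso _ this) (F.M_imageι m)

theorem M_of_mono_of_factors (hF : F.IsProper) {Z W : V} (m : Z ⟶ W) [Mono m]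
    (h : ∀ {X Y : V} (e : X ⟶ Y), F.E e → ∀ (b : Y ⟶ W), Factors m (e ≫ b) → Factors m b) :
    F.M m := by
  refine M_of_lift hF m (fun e he a b w => ?_)
  obtain ⟨d, hd⟩ := h e he b ⟨a, w⟩
  exact ⟨d, by rw [← cancel_mono m, Category.assoc, hd, w], hd⟩

/-- Tested on the image of `e` itself, the condition splits the M-part, which is then invertible
since it is monic. -/
theorem E_of_lift (hF : F.IsProper) {X Y : V} (e : X ⟶ Y)
    (h : ∀ {Z W : V} (m : Z ⟶ W), F.M m → ∀ (b : Y ⟶ W), Factors m (e ≫ b) → Factors m b) :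
    F.E e := by
  obtain ⟨d, hd⟩ := h (F.imageι e) (F.M_imageι e) (𝟙 _)
    ⟨F.toImage e, by rw [Category.comp_id, F.toImage_imageι]⟩
  have := mono_imageι hF e
  have : IsIso (F.imageι e) := ⟨d, by
    rw [← cancel_mono (F.imageι e), Category.assoc, hd, Category.comp_id, Category.id_comp], hd⟩
  rw [← F.toImage_imageι e]
  exact F.E_comp _ _ (F.E_toImage e) (F.E_iso _ this)

theorem M_of_isPullback (hF : F.IsProper) {P' X Y Z : V} {t : P' ⟶ X} {m' : P' ⟶ Y} {m : X ⟶ Z}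
    {q : Y ⟶ Z} (h : IsPullback t m' m q) (hm : F.M m) : F.M m' := by
  have := hF.mono m hm
  have : Mono m' := ⟨fun a b hab => h.hom_ext (by
    rw [← cancel_mono m, Category.assoc, Category.assoc, h.w, reassoc_of% hab]) hab⟩
  refine M_of_mono_of_factors hF m' (fun e he b hb => ?_)
  rw [factors_iff_of_isPullback h] at hb ⊢
  rw [Category.assoc] at hb
  exact factors_of_E he hm hb

/-- Equality of two maps can be checked after an epimorphism, so subobjects cut out by an equation
are E-local. This makes the image in the interpretation of equations harmless. -/
theorem M_of_regularMono (hF : F.IsProper) {X Y Z : V} (m : X ⟶ Y) [Mono m] (s t : Y ⟶ Z)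
    (h : ∀ {P : V} (y : P ⟶ Y), Factors m y ↔ y ≫ s = y ≫ t) : F.M m := by
  refine M_of_mono_of_factors hF m (fun e he b hb => ?_)
  rw [h] at hb ⊢
  have := hF.epi e he
  rwa [← cancel_epi e, ← Category.assoc, ← Category.assoc]

/-- Transposition turns locality along `e` for the power into locality along `W ◁ e` for `m`; the
latter map is in E because the factorization system is enriched. -/
theorem M_ihom (hF : F.IsProper) [MonoidalClosed V] (W : V) {X Y : V} (m : X ⟶ Y) (hm : F.M m) :
    F.M ((ihom W).map m) := by
  have := hF.mono m hm
  have : Mono ((ihom W).map m) := inferInstance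
  refine M_of_mono_of_factors hF _ (fun e he b hb => ?_)
  obtain ⟨a, ha⟩ := hb
  obtain ⟨d, hd⟩ := factors_of_E (F.E_tensor W _ he) hm (b := MonoidalClosed.uncurry b)
    ⟨MonoidalClosed.uncurry a, by
      rw [← MonoidalClosed.uncurry_natural_right, ha, MonoidalClosed.uncurry_natural_left]⟩
  exact ⟨MonoidalClosed.curry d, by
    rw [← MonoidalClosed.curry_natural_right, hd, MonoidalClosed.curry_uncurry]⟩

theorem factors_widePullback_base_iff {C : Type u} [Category.{v} C] {J : Type v} {B P : C}
    (S : J → C) (m : ∀ j, S j ⟶ B) [HasWidePullback B S m] (y : P ⟶ B) :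
    Factors (WidePullback.base m) y ↔ ∀ j, Factors (m j) y := by
  constructor
  · rintro ⟨h, rfl⟩ j
    exact ⟨h ≫ WidePullback.π m j, by simp⟩
  · intro h
    choose l hl using h
    exact ⟨WidePullback.lift y l hl, WidePullback.lift_base _ _ _ _⟩

theorem M_widePullback (hF : F.IsProper) {J : Type v} {B : V} (S : J → V) (m : ∀ j, S j ⟶ B)
    [HasWidePullback B S m] (hm : ∀ j, F.M (m j)) : F.M (WidePullback.base m) := by
  have hmono := fun j => hF.mono _ (hm j)
  have : Mono (WidePullback.base m) := ⟨fun a b hab => WidePullback.hom_ext _ _ _ (fun j => by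
    rw [← cancel_mono (m j)]; simpa using hab) hab⟩
  refine M_of_mono_of_factors hF _ (fun e he b hb => ?_)
  rw [factors_widePullback_base_iff] at hb ⊢
  exact fun j => factors_of_E he (hm j) (hb j)

theorem E_sigmaMap (hF : F.IsProper) {J : Type v} (S T : J → V) [HasCoproduct S] [HasCoproduct T]
    (e : ∀ j, S j ⟶ T j) (he : ∀ j, F.E (e j)) : F.E (Limits.Sigma.map e) := by
  refine E_of_lift hF _ (fun m hm b hb => ?_)
  have : ∀ j, Factors m (Sigma.ι T j ≫ b) := fun j => factors_of_E (he j) hm (by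
    have := hb.comp_left (Sigma.ι S j)
    simpa using this)
  choose l hl using this
  exact ⟨Sigma.desc l, Sigma.hom_ext _ _ (fun j => by simp [hl])⟩

/-- The image of a morphism is determined by any factorization. -/
theorem factors_imageι_iff {X Z Y P : V} {a : X ⟶ Y} (e : X ⟶ Z) (m : Z ⟶ Y) (he : F.E e)
    (hm : F.M m) (ha : e ≫ m = a) (y : P ⟶ Y) : Factors (F.imageι a) y ↔ Factors m y := by
  obtain ⟨d, -, hd⟩ := exists_lift (F.E_toImage a) hm
    (a := e) (b := F.imageι a) (by rw [ha, F.toImage_imageι])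
  obtain ⟨d', -, hd'⟩ := exists_lift he (F.M_imageι a)
    (a := F.toImage a) (b := m) (by rw [ha, F.toImage_imageι])
  constructor
  · rintro ⟨h, rfl⟩
    exact ⟨h ≫ d, by simp [hd]⟩
  · rintro ⟨h, rfl⟩
    exact ⟨h ≫ d', by simp [hd']⟩

theorem factors_imageι_of_M {X Y P : V} (m : X ⟶ Y) (hm : F.M m) (y : P ⟶ Y) :
    Factors (F.imageι m) y ↔ Factors m y :=
  factors_imageι_iff (𝟙 _) m (F.E_iso _ inferInstance) hm (by simp) y

theorem factors_imageι_E_comp {X X' Y P : V} (e : X' ⟶ X) (he : F.E e) (a : X ⟶ Y) (y : P ⟶ Y) :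
    Factors (F.imageι (e ≫ a)) y ↔ Factors (F.imageι a) y :=
  factors_imageι_iff (e ≫ F.toImage a) (F.imageι a) (F.E_comp _ _ he (F.E_toImage a)) (F.M_imageι a)
    (by rw [Category.assoc, F.toImage_imageι]) y

/-- An M-map composed after the image is again an M-part. This moves images taken inside Str(A, K)
into K^X, where formulas are interpreted. -/
theorem factors_imageι_comp_M (hF : F.IsProper) {X Y Z P : V} (a : X ⟶ Y) (m : Y ⟶ Z) (hm : F.M m)
    (y : P ⟶ Y) : Factors (F.imageι (a ≫ m)) (y ≫ m) ↔ Factors (F.imageι a) y := by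
  have := hF.mono m hm
  rw [factors_imageι_iff (F.toImage a) (F.imageι a ≫ m) (F.E_toImage a)
    (F.M_comp _ _ (F.M_imageι a) hm) (by rw [← Category.assoc, F.toImage_imageι]),
    factors_comp_mono_iff]

/-- E is closed under coproducts, so replacing each summand by its image does not change the total
image. This absorbs the existential quantifiers under a disjunction. -/
theorem factors_imageι_desc_imageι (hF : F.IsProper) {J : Type v} (S : J → V) {Y P : V}
    (a : ∀ j, S j ⟶ Y) [HasCoproduct S] [HasCoproduct fun j => F.image (a j)] (y : P ⟶ Y) :
    Factors (F.imageι (Sigma.desc fun j => F.imageι (a j))) y ↔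
      Factors (F.imageι (Sigma.desc a)) y := by
  rw [← factors_imageι_E_comp _ (E_sigmaMap hF S (fun j => F.image (a j)) (fun j => F.toImage (a j))
    (fun j => F.E_toImage _))]
  have : Limits.Sigma.map (fun j => F.toImage (a j)) ≫ Sigma.desc (fun j => F.imageι (a j)) =
      Sigma.desc a := Sigma.hom_ext _ _ (fun j => by simp [F.toImage_imageι])
  rw [this]

theorem imageSquareIsPullback_iff (hF : F.IsProper) {X Y X' Y' : V} {a : X ⟶ Y} {b : X' ⟶ Y'}
    {p : X ⟶ X'} {q : Y ⟶ Y'} (w : a ≫ q = p ≫ b) : F.ImageSquareIsPullback a b p q ↔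
      ∀ (P : V) (y : P ⟶ Y), Factors (F.imageι a) y ↔ Factors (F.imageι b) (y ≫ q) := by
  have := mono_imageι hF a
  have := mono_imageι hF b
  rw [← exists_isPullback_iff]
  constructor
  · rintro ⟨t, -, ht⟩
    exact ⟨t, ht⟩
  · rintro ⟨t, ht⟩
    refine ⟨t, ?_, ht⟩
    rw [← cancel_mono (F.imageι b), Category.assoc, ht.w, reassoc_of% F.toImage_imageι, w,
      Category.assoc, F.toImage_imageι]

end EnrichedFactorizationSystem

end EnrichedLogic

namespace EnrichedLogic

/-! ### Presentable objects of the base -/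

section Presentable

variable {V : Type u} [Category.{v} V]

theorem isStrongGenerator_isCardinalPresentable (κ : Cardinal.{v}) [Fact κ.IsRegular]
    [IsCardinalLocallyPresentable V κ] : (isCardinalPresentable V κ).IsStrongGenerator :=
  (isCardinalFilteredGenerator_isCardinalPresentable V κ).isStrongGenerator

/-- Filtered colimits are detected by the presentable objects. -/
theorem nonempty_isColimit_of_presentable (κ : Cardinal.{v}) [Fact κ.IsRegular]
    [IsCardinalLocallyPresentable V κ] {J : Type v} [SmallCategory J] [IsCardinalFiltered J κ]
    {D : J ⥤ V} (c : Cocone D)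
    (hs : ∀ (P : V), IsCardinalPresentable P κ → ∀ y : P ⟶ c.pt, ∃ j, Factors (c.ι.app j) y)
    (hi : ∀ (P : V), IsCardinalPresentable P κ → ∀ (j : J) (a b : P ⟶ D.obj j),
      a ≫ c.ι.app j = b ≫ c.ι.app j → ∃ (k : J) (w : j ⟶ k), a ≫ D.map w = b ≫ D.map w) :
    Nonempty (IsColimit c) := by
  have hG := isStrongGenerator_isCardinalPresentable (V := V) κ
  have := isFiltered_of_isCardinalFiltered J κ
  -- The comparison map is monic by `hi`, and by `hs` every map from the strong generator of
  -- presentable objects lifts through it; hence it is invertible.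
  have hm : Mono (colimit.desc D c) := by
    rw [hG.isSeparating.mono_iff]
    intro P (hP : IsCardinalPresentable P κ) a b hab
    obtain ⟨j₁, a, rfl⟩ := IsCardinalPresentable.exists_hom_of_isColimit κ (colimit.isColimit D) a
    obtain ⟨j₂, b, rfl⟩ := IsCardinalPresentable.exists_hom_of_isColimit κ (colimit.isColimit D) b
    obtain ⟨k, w, hk⟩ := hi P hP _ (a ≫ D.map (IsFiltered.leftToMax j₁ j₂))
      (b ≫ D.map (IsFiltered.rightToMax j₁ j₂)) (by simpa using hab)
    have := congrArg (· ≫ colimit.ι D k) hk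
    simpa using this
  have : IsIso (colimit.desc D c) := hG.isIso_of_mono _ (fun P hP y => by
    obtain ⟨j, h, hh⟩ := hs P hP y
    exact ⟨h ≫ colimit.ι D j, by simpa using hh⟩)
  exact ⟨IsColimit.ofIsoColimit (colimit.isColimit D) (Cocone.ext (asIso (colimit.desc D c)))⟩

variable [IsLocallyPresentable.{v} V]

theorem isCardinalPresentable_sigma (κ : Cardinal.{v}) [Fact κ.IsRegular] {J : Type v}
    (hJ : Cardinal.mk J < κ) (S : J → V) (hS : ∀ j, IsCardinalPresentable (S j) κ) :
    IsCardinalPresentable (∐ S) κ := by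
  have (k : Discrete J) : IsCardinalPresentable ((Discrete.functor S).obj k) κ := hS k.as
  refine isCardinalPresentable_of_isColimit _ (colimit.isColimit (Discrete.functor S)) κ ?_
  rw [hasCardinalLT_arrow_discrete_iff]
  rwa [hasCardinalLT_iff_cardinal_mk_lt]

theorem isCardinalPresentable_coprod (κ : Cardinal.{v}) [Fact κ.IsRegular] (X Y : V)
    (hX : IsCardinalPresentable X κ) (hY : IsCardinalPresentable Y κ) :
    IsCardinalPresentable (X ⨿ Y) κ := by
  have (k : Discrete WalkingPair) : IsCardinalPresentable ((pair X Y).obj k) κ := by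
    obtain ⟨⟨⟩⟩ := k
    · exact hX
    · exact hY
  refine isCardinalPresentable_of_isColimit _ (colimit.isColimit (pair X Y)) κ ?_
  rw [hasCardinalLT_arrow_discrete_iff]
  exact hasCardinalLT_of_finite _ _ (Cardinal.IsRegular.aleph0_le Fact.out)

/-- The subcoproducts of size less than `κ`. -/
def subcoproductFunctor (κ : Cardinal.{v}) {ι : Type v} (T : ι → V) :
    HasCardinalLT.Set ι κ ⥤ V where
  obj A := ∐ fun i : A.1 => T i
  map {A B} h := Sigma.desc fun i => Sigma.ι (fun i : B.1 => T i) ⟨i, leOfHom h i.2⟩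
  map_id A := Sigma.hom_ext _ _ (fun i => by simp)
  map_comp f g := Sigma.hom_ext _ _ (fun i => by simp)

/-- A coproduct as a cocone over its subcoproducts. -/
def subcoproductCocone (κ : Cardinal.{v}) {ι : Type v} (T : ι → V) :
    Cocone (subcoproductFunctor κ T) where
  pt := ∐ T
  ι :=
    { app A := Sigma.desc fun i => Sigma.ι T i
      naturality A B h := Sigma.hom_ext _ _ (fun i => by simp [subcoproductFunctor]) }

/-- The singleton subsets. -/
def singletonSet (κ : Cardinal.{v}) [Fact κ.IsRegular] {ι : Type v} (i : ι) :
    HasCardinalLT.Set ι κ :=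
  ⟨{i}, hasCardinalLT_of_finite _ _ (Cardinal.IsRegular.aleph0_le Fact.out)⟩

/-- A coproduct is the colimit of its subcoproducts. -/
def isColimitSubcoproductCocone (κ : Cardinal.{v}) [Fact κ.IsRegular] {ι : Type v} (T : ι → V) :
    IsColimit (subcoproductCocone κ T) where
  desc s := Sigma.desc fun i => Sigma.ι (fun j : (singletonSet κ i).1 => T j)
    ⟨i, Set.mem_singleton i⟩ ≫ s.ι.app (singletonSet κ i)
  fac s A := Sigma.hom_ext _ _ (fun i => by
    have h : singletonSet κ i.1 ≤ A := by
      rintro _ rfl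
      exact i.2
    have h₁ := s.w (homOfLE h)
    have h₂ : Sigma.ι (fun j : (singletonSet κ i.1).1 => T j) ⟨i.1, Set.mem_singleton i.1⟩ ≫
        (subcoproductFunctor κ T).map (homOfLE h) = Sigma.ι (fun i : A.1 => T i) i :=
      Sigma.ι_desc _ _
    refine (Sigma.ι_desc_assoc _ _ _).trans ((Sigma.ι_desc _ _).trans ?_)
    rw [← h₁]
    exact (Category.assoc _ _ _).symm.trans (congrArg (· ≫ s.ι.app A) h₂))
  uniq s m hm := Sigma.hom_ext _ _ (fun i => by
    refine Eq.trans ?_ (Sigma.ι_desc _ _).symm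
    rw [← hm (singletonSet κ i)]
    have h : Sigma.ι (fun j : (singletonSet κ i).1 => T j) ⟨i, Set.mem_singleton i⟩ ≫
        (subcoproductCocone κ T).ι.app (singletonSet κ i) = Sigma.ι T i := Sigma.ι_desc _ _
    exact Eq.trans (congrArg (· ≫ m) h.symm) (Category.assoc _ _ _))

/-- The coproduct is the κ-filtered colimit of its subcoproducts with fewer than κ summands. It is
later used to assemble fewer than κ terms into a single one. -/
theorem exists_subcoproduct (κ : Cardinal.{v}) [Fact κ.IsRegular] {ι : Type v} (T : ι → V) {P : V}
    (hP : IsCardinalPresentable P κ) (x : P ⟶ ∐ T) :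
    ∃ A : Set ι, Cardinal.mk A < κ ∧ ∃ x' : P ⟶ ∐ (fun i : A => T i),
      x' ≫ Sigma.desc (fun i : A => Sigma.ι T i) = x := by
  obtain ⟨A, x', hx'⟩ := IsCardinalPresentable.exists_hom_of_isColimit κ
    (isColimitSubcoproductCocone κ T) x
  exact ⟨A.1, by simpa [hasCardinalLT_iff_cardinal_mk_lt] using A.2, x', hx'⟩

/-- The cover consists of all maps from representatives of the presentable objects. An M-subobject
whose pullback contains all of these has an invertible pullback, by strong generation. -/
theorem exists_E_cover [MonoidalCategory V] {F : EnrichedFactorizationSystem V} (hF : F.IsProper)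
    (κ : Cardinal.{v}) [Fact κ.IsRegular] [IsCardinalLocallyPresentable V κ] (Z : V) :
    ∃ (ι : Type v) (Q : ι → V) (q : ∀ i, Q i ⟶ Z), (∀ i, IsCardinalPresentable (Q i) κ) ∧
      F.E (Sigma.desc q) := by
  have hG := isStrongGenerator_isCardinalPresentable (V := V) κ
  obtain ⟨Q₀, _, hQ₀, hQ₀'⟩ :=
    ObjectProperty.EssentiallySmall.exists_small_le.{v} (isCardinalPresentable V κ)
  let ι := Σ i : Shrink.{v} (Subtype Q₀), ((equivShrink _).symm i).1 ⟶ Z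
  refine ⟨ι, fun i => ((equivShrink _).symm i.1).1, fun i => i.2,
    fun i => hQ₀ _ ((equivShrink _).symm i.1).2,
    EnrichedFactorizationSystem.E_of_lift hF _ (fun m hm b hb => ?_)⟩
  have := hF.mono m hm
  have : IsIso (pullback.snd m b) := hG.isIso_of_mono _ (fun P hP y => by
    obtain ⟨P', hP', ⟨e⟩⟩ := hQ₀' P hP
    let i : ι := ⟨equivShrink _ ⟨P', hP'⟩, eqToHom (by simp) ≫ e.inv ≫ y⟩
    have h := hb.comp_left (Sigma.ι (fun i : ι => ((equivShrink _).symm i.1).1) i)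
    rw [Sigma.ι_desc_assoc] at h
    have h' := h.comp_left (e.hom ≫ eqToHom (by simp [i]))
    obtain ⟨l, hl⟩ := h'
    exact ⟨pullback.lift l y (by simpa [i] using hl), pullback.lift_snd _ _ _⟩)
  exact ⟨inv (pullback.snd m b) ≫ pullback.fst m b, by simp [pullback.condition]⟩

end Presentable

/-! ### Accessibility of powers. -/

section Closed

variable {V : Type u} [Category.{v} V] [MonoidalCategory V] [MonoidalClosed V]

/-- Powers by presentable objects preserve filtered colimits. -/
theorem isCardinalAccessible_ihom {κ : Cardinal.{v}} [Fact κ.IsRegular]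
    (hV : IsLocallyPresentableAsClosed V κ) (X : V) (hX : IsCardinalPresentable X κ) :
    (ihom X).IsCardinalAccessible κ where
  preservesColimitOfShape J _ _ := ⟨fun {D} => ⟨fun {c} hc => by
    have := hV.locallyPresentable
    -- Maps from P to a power by X transpose to maps from X ⊗ P, which is again presentable.
    refine nonempty_isColimit_of_presentable κ _ (fun P hP y => ?_) (fun P hP j a b hab => ?_)
    · have := hV.tensor X P hX hP
      obtain ⟨j, y', hy'⟩ := IsCardinalPresentable.exists_hom_of_isColimit κ hc
        (MonoidalClosed.uncurry y)
      exact ⟨j, MonoidalClosed.curry y', by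
        simpa [← MonoidalClosed.curry_natural_right] using congrArg MonoidalClosed.curry hy'⟩
    · have := hV.tensor X P hX hP
      obtain ⟨k, w, hw⟩ := IsCardinalPresentable.exists_eq_of_isColimit' κ hc
        (MonoidalClosed.uncurry a) (MonoidalClosed.uncurry b) (by
          rw [← MonoidalClosed.uncurry_natural_right, ← MonoidalClosed.uncurry_natural_right]
          exact congrArg _ hab)
      exact ⟨k, w, MonoidalClosed.uncurry_injective (by
        simpa [MonoidalClosed.uncurry_natural_right] using hw)⟩⟩⟩

end Closed

end EnrichedLogic

namespace EnrichedLogic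

/-! ### Spans -/

/-- A signature for families of legs `X k ⊗ B (i k) ⟶ A`. -/
structure SpanSig (V : Type u) where
  I : Type v
  K : Type v
  idx : K → I
  ar : K → V

variable {V : Type u} [Category.{v} V] [MonoidalCategory V]

/-- An object `A` with a family of objects `B i` and legs `X k ⊗ B (i k) ⟶ A`. -/
structure SpanObj (S : SpanSig.{u, v} V) where
  carrier : V
  comp : S.I → V
  leg : ∀ k, S.ar k ⊗ comp (S.idx k) ⟶ carrier

namespace SpanObj

variable {S : SpanSig.{u, v} V}

/-- Morphisms of span objects. -/
@[ext]
structure Hom (A B : SpanObj S) where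
  map : A.carrier ⟶ B.carrier
  comp : ∀ i, A.comp i ⟶ B.comp i
  leg_comm : ∀ k, A.leg k ≫ map = S.ar k ◁ comp (S.idx k) ≫ B.leg k

instance : Category (SpanObj S) where
  Hom := Hom
  id A :=
    { map := 𝟙 _
      comp := fun _ => 𝟙 _
      leg_comm := fun k => by simp }
  comp {A B C} g h :=
    { map := g.map ≫ h.map
      comp := fun i => g.comp i ≫ h.comp i
      leg_comm := fun k => by
        rw [← Category.assoc, g.leg_comm, Category.assoc, h.leg_comm,
          MonoidalCategory.whiskerLeft_comp, Category.assoc] }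
  id_comp _ := Hom.ext (Category.id_comp _) (funext fun _ => Category.id_comp _)
  comp_id _ := Hom.ext (Category.comp_id _) (funext fun _ => Category.comp_id _)
  assoc _ _ _ := Hom.ext (Category.assoc _ _ _) (funext fun _ => Category.assoc _ _ _)

theorem hom_ext {A B : SpanObj S} {f g : A ⟶ B} (h : Hom.map f = Hom.map g)
    (h' : ∀ i, Hom.comp f i = Hom.comp g i) : f = g :=
  Hom.ext h (funext h')

variable (S) in
/-- The carrier functor. -/
@[simps]
def carrierF : SpanObj S ⥤ V where
  obj A := A.carrier
  map f := Hom.map f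

variable (S) in
/-- The component functors. -/
@[simps]
def compF (i : S.I) : SpanObj S ⥤ V where
  obj A := A.comp i
  map f := Hom.comp f i

variable [MonoidalClosed V]

/-- Tensoring with X is a left adjoint, so a colimit cocone stays jointly epic after `X ◁ -`;
transposing proves this without forming the tensored colimit. -/
theorem tensor_hom_ext_of_isColimit {J : Type v} [SmallCategory J] {D : J ⥤ V} {c : Cocone D}
    (hc : IsColimit c) {X Z : V} {f g : X ⊗ c.pt ⟶ Z}
    (h : ∀ j, X ◁ c.ι.app j ≫ f = X ◁ c.ι.app j ≫ g) : f = g := by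
  apply MonoidalClosed.curry_injective
  refine hc.hom_ext (fun j => ?_)
  rw [← MonoidalClosed.curry_natural_left, h, MonoidalClosed.curry_natural_left]

/-! ### Componentwise colimits of span objects. -/

section Colimits

variable {J : Type v} [SmallCategory J] {D : J ⥤ SpanObj S}

theorem leg_comm_of_isColimit {c : Cocone D} (s : Cocone D) (k : S.K)
    (h' : IsColimit ((compF S (S.idx k)).mapCocone c)) (d : c.pt.carrier ⟶ s.pt.carrier)
    (d' : c.pt.comp (S.idx k) ⟶ s.pt.comp (S.idx k))
    (hd : ∀ j, Hom.map (c.ι.app j) ≫ d = Hom.map (s.ι.app j))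
    (hd' : ∀ j, Hom.comp (c.ι.app j) (S.idx k) ≫ d' = Hom.comp (s.ι.app j) (S.idx k)) :
    c.pt.leg k ≫ d = S.ar k ◁ d' ≫ s.pt.leg k := by
  refine tensor_hom_ext_of_isColimit h' (fun j => ?_)
  have e₁ : (D.obj j).leg k ≫ Hom.map (c.ι.app j) =
    S.ar k ◁ Hom.comp (c.ι.app j) (S.idx k) ≫ c.pt.leg k := Hom.leg_comm (c.ι.app j) k
  have e₂ : (D.obj j).leg k ≫ Hom.map (s.ι.app j) =
    S.ar k ◁ Hom.comp (s.ι.app j) (S.idx k) ≫ s.pt.leg k := Hom.leg_comm (s.ι.app j) k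
  have e₃ : S.ar k ◁ Hom.comp (c.ι.app j) (S.idx k) ≫ c.pt.leg k ≫ d =
      S.ar k ◁ Hom.comp (c.ι.app j) (S.idx k) ≫ S.ar k ◁ d' ≫ s.pt.leg k := by
    rw [← MonoidalCategory.whiskerLeft_comp_assoc, hd', ← reassoc_of% e₁]
    refine Eq.trans ?_ e₂
    exact congrArg ((D.obj j).leg k ≫ ·) (hd j)
  exact e₃

/-- Colimits of span objects are computed componentwise. -/
def isColimitOfComponents (c : Cocone D) (h : IsColimit ((carrierF S).mapCocone c))
    (h' : ∀ i, IsColimit ((compF S i).mapCocone c)) : IsColimit c where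
  desc s :=
    { map := h.desc ((carrierF S).mapCocone s)
      comp := fun i => (h' i).desc ((compF S i).mapCocone s)
      leg_comm := fun k => leg_comm_of_isColimit s k (h' _) _ _
        (fun j => h.fac ((carrierF S).mapCocone s) j)
        (fun j => (h' _).fac ((compF S _).mapCocone s) j) }
  fac s j := hom_ext (h.fac ((carrierF S).mapCocone s) j)
    (fun i => (h' i).fac ((compF S i).mapCocone s) j)
  uniq s _ hm := hom_ext
    (h.uniq ((carrierF S).mapCocone s) _ (fun j => congrArg Hom.map (hm j)))
    (fun i => (h' i).uniq ((compF S i).mapCocone s) _ (fun j => congrArg (Hom.comp · i) (hm j)))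

theorem curry_leg_natural {j j' : J} (f : j ⟶ j') (k : S.K) {Z : V} (p : (D.obj j).carrier ⟶ Z)
    (p' : (D.obj j').carrier ⟶ Z) (h : Hom.map (D.map f) ≫ p' = p) :
    Hom.comp (D.map f) (S.idx k) ≫ MonoidalClosed.curry ((D.obj j').leg k ≫ p') =
      MonoidalClosed.curry ((D.obj j).leg k ≫ p) := by
  have e : (D.obj j).leg k ≫ Hom.map (D.map f) = _ := Hom.leg_comm (D.map f) k
  rw [← MonoidalClosed.curry_natural_left, ← reassoc_of% e, h]

variable [HasColimits V]

variable (D) in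
/-- The legs of the colimit. -/
def colimitLeg (k : S.K) : S.ar k ⊗ colimit (D ⋙ compF S (S.idx k)) ⟶ colimit (D ⋙ carrierF S) :=
  MonoidalClosed.uncurry (colimit.desc _ (Cocone.mk _
    { app := fun j => MonoidalClosed.curry ((D.obj j).leg k ≫ colimit.ι (D ⋙ carrierF S) j)
      naturality := fun _ _ f => (curry_leg_natural f k _ _
        (colimit.w (D ⋙ carrierF S) f)).trans (Category.comp_id _).symm }))

theorem whiskerLeft_ι_colimitLeg (k : S.K) (j : J) :
    S.ar k ◁ colimit.ι (D ⋙ compF S (S.idx k)) j ≫ colimitLeg D k =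
      (D.obj j).leg k ≫ colimit.ι (D ⋙ carrierF S) j := by
  rw [colimitLeg, ← MonoidalClosed.uncurry_natural_left, colimit.ι_desc]
  exact MonoidalClosed.uncurry_curry _

variable (D) in
/-- The colimit of a diagram of span objects. -/
@[simps]
def colimitCocone : Cocone D where
  pt :=
    { carrier := colimit (D ⋙ carrierF S)
      comp := fun i => colimit (D ⋙ compF S i)
      leg := colimitLeg D }
  ι :=
    { app := fun j =>
        { map := colimit.ι (D ⋙ carrierF S) j
          comp := fun i => colimit.ι (D ⋙ compF S i) j
          leg_comm := fun k => (whiskerLeft_ι_colimitLeg k j).symm }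
      naturality := fun _ _ f => hom_ext
        ((colimit.w (D ⋙ carrierF S) f).trans (Category.comp_id _).symm)
        (fun i => (colimit.w (D ⋙ compF S i) f).trans (Category.comp_id _).symm) }

variable (D) in
/-- The carrier of the colimit is the colimit of the carriers. -/
def isColimitCarrierColimitCocone : IsColimit ((carrierF S).mapCocone (colimitCocone D)) :=
  IsColimit.ofIsoColimit (colimit.isColimit (D ⋙ carrierF S))
    (Cocone.ext (Iso.refl _) (fun _ => Category.comp_id _))

variable (D) in
/-- The components of the colimit are the colimits of the components. -/
def isColimitCompColimitCocone (i : S.I) : IsColimit ((compF S i).mapCocone (colimitCocone D)) :=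
  IsColimit.ofIsoColimit (colimit.isColimit (D ⋙ compF S i))
    (Cocone.ext (Iso.refl _) (fun _ => Category.comp_id _))

variable (D) in
/-- The colimit cocone is a colimit. -/
def isColimitColimitCocone : IsColimit (colimitCocone D) :=
  isColimitOfComponents _ (isColimitCarrierColimitCocone D) (isColimitCompColimitCocone D)

end Colimits

variable [HasColimits V]

instance : HasColimits (SpanObj S) where
  has_colimits_of_shape _ _ := ⟨fun D => ⟨⟨⟨_, isColimitColimitCocone D⟩⟩⟩⟩

instance : PreservesColimitsOfSize.{v, v} (carrierF S) where
  preservesColimitsOfShape := ⟨fun {D} =>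
    preservesColimit_of_preserves_colimit_cocone (isColimitColimitCocone D)
      (isColimitCarrierColimitCocone D)⟩

instance (i : S.I) : PreservesColimitsOfSize.{v, v} (compF S i) where
  preservesColimitsOfShape := ⟨fun {D} =>
    preservesColimit_of_preserves_colimit_cocone (isColimitColimitCocone D)
      (isColimitCompColimitCocone D i)⟩

/-! ### Free span objects -/

variable (S) in
/-- The free span object on an object of the base. -/
def carrierFree (Z : V) : SpanObj S where
  carrier := Z
  comp _ := ⊥_ V
  leg _ := MonoidalClosed.uncurry (initial.to _)

/-- The universal property of `carrierFree`. -/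
def carrierFreeEquiv (Z : V) (A : SpanObj S) : (carrierFree S Z ⟶ A) ≃ (Z ⟶ A.carrier) where
  toFun f := Hom.map f
  invFun z :=
    { map := z
      comp := fun _ => initial.to _
      leg_comm := fun _ => MonoidalClosed.curry_injective (initial.hom_ext _ _) }
  left_inv _ := hom_ext rfl (fun _ => initial.hom_ext _ _)
  right_inv _ := rfl

variable (S) in
/-- The free span object on a family of components. -/
def freeOn (B : S.I → V) : SpanObj S where
  carrier := ∐ fun k => S.ar k ⊗ B (S.idx k)
  comp := B
  leg k := Sigma.ι (fun k => S.ar k ⊗ B (S.idx k)) k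

/-- The universal property of `freeOn`. -/
def freeOnEquiv (B : S.I → V) (A : SpanObj S) : (freeOn S B ⟶ A) ≃ (∀ i, B i ⟶ A.comp i) where
  toFun f := Hom.comp f
  invFun b :=
    { map := Sigma.desc fun k => S.ar k ◁ b (S.idx k) ≫ A.leg k
      comp := b
      leg_comm := fun _ => Sigma.ι_desc _ _ }
  left_inv f := hom_ext (Sigma.hom_ext _ _ (fun k =>
    (Sigma.ι_desc _ _).trans (Hom.leg_comm f k).symm)) (fun _ => rfl)
  right_inv _ := rfl

/-- The family with value `P` at `i`, and initial elsewhere. -/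
def single {I : Type v} (i : I) (P : V) (i' : I) : V := ∐ fun (_ : ULift.{v} (PLift (i' = i))) => P

/-- The inclusion of `P`. -/
def singleι {I : Type v} (i : I) (P : V) : P ⟶ single i P i :=
  Sigma.ι (fun (_ : ULift.{v} (PLift (i = i))) => P) ⟨⟨rfl⟩⟩

/-- The universal property of `single`. -/
def singleEquiv {I : Type v} (i : I) (P : V) (B : I → V) :
    (∀ i', single i P i' ⟶ B i') ≃ (P ⟶ B i) where
  toFun f := singleι i P ≫ f i
  invFun p i' := Sigma.desc fun h => p ≫ eqToHom (congrArg B h.down.down.symm)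
  left_inv f := by
    funext i'
    refine Sigma.hom_ext _ _ (fun ⟨⟨h⟩⟩ => ?_)
    subst h
    refine (Sigma.ι_desc _ _).trans ?_
    rw [eqToHom_refl, Category.comp_id]
    rfl
  right_inv p := (Sigma.ι_desc _ _).trans (by rw [eqToHom_refl, Category.comp_id])

variable (S) in
/-- The free span object on an element of a component. -/
def compFree (i : S.I) (P : V) : SpanObj S := freeOn S (single i P)

/-- The universal property of `compFree`. -/
def compFreeEquiv (i : S.I) (P : V) (A : SpanObj S) : (compFree S i P ⟶ A) ≃ (P ⟶ A.comp i) :=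
  (freeOnEquiv _ A).trans (singleEquiv i P A.comp)

theorem compFreeEquiv_naturality (i : S.I) (P : V) {A B : SpanObj S} (f : compFree S i P ⟶ A)
    (g : A ⟶ B) : compFreeEquiv i P B (f ≫ g) = compFreeEquiv i P A f ≫ Hom.comp g i :=
  (Category.assoc _ _ _).symm

/-- The free object corepresents the carrier functor followed by maps out of Z, and the carrier
functor preserves small colimits. -/
theorem isCardinalPresentable_carrierFree {κ : Cardinal.{v}} [Fact κ.IsRegular] (Z : V)
    (hZ : IsCardinalPresentable Z κ) : IsCardinalPresentable (carrierFree S Z) κ :=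
  Functor.isCardinalAccessible_of_natIso (F := carrierF S ⋙ coyoneda.obj (op Z))
    (G := coyoneda.obj (op (carrierFree S Z))) (NatIso.ofComponents (fun A => (carrierFreeEquiv Z A).symm.toIso) (fun {A B} g => by
      ext f
      apply (carrierFreeEquiv Z B).injective
      refine ((carrierFreeEquiv Z B).apply_symm_apply (f ≫ Hom.map g)).trans ?_
      exact (congrArg (· ≫ Hom.map g) ((carrierFreeEquiv Z A).apply_symm_apply f)).symm)) κ

theorem isCardinalPresentable_compFree {κ : Cardinal.{v}} [Fact κ.IsRegular] (i : S.I) (P : V)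
    (hP : IsCardinalPresentable P κ) : IsCardinalPresentable (compFree S i P) κ :=
  Functor.isCardinalAccessible_of_natIso (F := compF S i ⋙ coyoneda.obj (op P))
    (G := coyoneda.obj (op (compFree S i P))) (NatIso.ofComponents (fun A => (compFreeEquiv i P A).symm.toIso) (fun {A B} g => by
      ext f
      apply (compFreeEquiv i P B).injective
      refine ((compFreeEquiv i P B).apply_symm_apply (f ≫ Hom.comp g i)).trans ?_
      refine (congrArg (· ≫ Hom.comp g i) ((compFreeEquiv i P A).apply_symm_apply f)).symm.trans ?_
      exact (compFreeEquiv_naturality i P _ g).symm)) κ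

end SpanObj

end EnrichedLogic

namespace EnrichedLogic

/-! ### Structures as span objects -/

namespace SpanObj

variable {V : Type u} [Category.{v} V] [MonoidalCategory V] {S : SpanSig.{u, v} V}

theorem isIso_of_components {A B : SpanObj S} (f : A ⟶ B) (h : IsIso (Hom.map f))
    (h' : ∀ i, IsIso (Hom.comp f i)) : IsIso f := by
  let g : B ⟶ A :=
    { map := inv (Hom.map f)
      comp := fun i => inv (Hom.comp f i)
      leg_comm := fun k => by
        have e : A.leg k ≫ Hom.map f = _ := Hom.leg_comm f k
        rw [IsIso.comp_inv_eq, Category.assoc, e, ← MonoidalCategory.whiskerLeft_comp_assoc]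
        simp }
  exact ⟨g, hom_ext (IsIso.hom_inv_id _) (fun i => IsIso.hom_inv_id _),
    hom_ext (IsIso.inv_hom_id _) (fun i => IsIso.inv_hom_id _)⟩

end SpanObj

section

variable {V : Type u} [Category.{v} V]

theorem exists_small_presentable (κ : Cardinal.{v}) [Fact κ.IsRegular]
    [IsCardinalLocallyPresentable V κ] : ∃ (ι : Type v) (Q : ι → V),
      (∀ i, IsCardinalPresentable (Q i) κ) ∧
        ∀ P : V, IsCardinalPresentable P κ → ∃ i, Nonempty (P ≅ Q i) := by
  obtain ⟨Q₀, _, hQ₀, hQ₀'⟩ :=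
    ObjectProperty.EssentiallySmall.exists_small_le.{v} (isCardinalPresentable V κ)
  refine ⟨Shrink.{v} (Subtype Q₀), fun i => ((equivShrink _).symm i).1,
    fun i => hQ₀ _ ((equivShrink _).symm i).2, fun P hP => ?_⟩
  obtain ⟨P', hP', ⟨e⟩⟩ := hQ₀' P hP
  exact ⟨equivShrink _ ⟨P', hP'⟩, ⟨e ≪≫ eqToIso (by simp)⟩⟩

variable (V) in
/-- A small set of representatives of the presentable objects. -/
structure PresentableRep (κ : Cardinal.{v}) [Fact κ.IsRegular] where
  ι : Type v
  obj : ι → V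
  presentable : ∀ i, IsCardinalPresentable (obj i) κ
  exists_iso : ∀ P : V, IsCardinalPresentable P κ → ∃ i, Nonempty (P ≅ obj i)

theorem nonempty_presentableRep (κ : Cardinal.{v}) [Fact κ.IsRegular]
    [IsCardinalLocallyPresentable V κ] : Nonempty (PresentableRep V κ) := by
  obtain ⟨ι, Q, h, h'⟩ := exists_small_presentable (V := V) κ
  exact ⟨⟨ι, Q, h, h'⟩⟩

/-- Presentable objects form a strong generator, so isomorphisms are detected on a small set of
representatives; this keeps the localizing class of maps small. -/
theorem PresentableRep.isIso {κ : Cardinal.{v}} [Fact κ.IsRegular]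
    [IsCardinalLocallyPresentable V κ] (Q : PresentableRep V κ) {X Y : V} (f : X ⟶ Y)
    (h : ∀ i, Function.Bijective (fun x : Q.obj i ⟶ X => x ≫ f)) : IsIso f := by
  have hG := isStrongGenerator_isCardinalPresentable (V := V) κ
  have : Mono f := by
    rw [hG.isSeparating.mono_iff]
    intro P hP a b hab
    obtain ⟨i, ⟨e⟩⟩ := Q.exists_iso P hP
    have := (h i).1 (a₁ := e.inv ≫ a) (a₂ := e.inv ≫ b) (by simp [hab])
    simpa using this
  refine hG.isIso_of_mono _ (fun P hP y => ?_)
  obtain ⟨i, ⟨e⟩⟩ := Q.exists_iso P hP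
  obtain ⟨x, hx⟩ := (h i).2 (e.inv ≫ y)
  exact ⟨e.hom ≫ x, by simpa using congrArg (e.hom ≫ ·) hx⟩

end

variable {V : Type u} [Category.{v} V] [MonoidalCategory V]

/-- The signature whose span objects contain the structures. -/
abbrev strSig (L : Lang.{u, v} V) : SpanSig.{u, v} V where
  I := L.Fn ⊕ L.Rel
  K := L.Fn ⊕ L.Fn ⊕ L.Rel
  idx
    | Sum.inl f => Sum.inl f
    | Sum.inr (Sum.inl f) => Sum.inl f
    | Sum.inr (Sum.inr R) => Sum.inr R
  ar
    | Sum.inl f => L.dom f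
    | Sum.inr (Sum.inl f) => L.cod f
    | Sum.inr (Sum.inr R) => L.arity R

variable {L : Lang.{u, v} V}

/-- The input leg of a function symbol. -/
def domLeg (c : SpanObj (strSig L)) (f : L.Fn) : L.dom f ⊗ c.comp (Sum.inl f) ⟶ c.carrier :=
  c.leg (Sum.inl f)

/-- The output leg of a function symbol. -/
def codLeg (c : SpanObj (strSig L)) (f : L.Fn) : L.cod f ⊗ c.comp (Sum.inl f) ⟶ c.carrier :=
  c.leg (Sum.inr (Sum.inl f))

/-- The leg of a relation symbol. -/
def relLeg (c : SpanObj (strSig L)) (R : L.Rel) : L.arity R ⊗ c.comp (Sum.inr R) ⟶ c.carrier :=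
  c.leg (Sum.inr (Sum.inr R))

section Hom

variable {c d : SpanObj (strSig L)}

/-- The component of a morphism at a function symbol. -/
def homFn (φ : c ⟶ d) (f : L.Fn) : c.comp (Sum.inl f) ⟶ d.comp (Sum.inl f) :=
  SpanObj.Hom.comp φ (Sum.inl f)

/-- The component of a morphism at a relation symbol. -/
def homRel (φ : c ⟶ d) (R : L.Rel) : c.comp (Sum.inr R) ⟶ d.comp (Sum.inr R) :=
  SpanObj.Hom.comp φ (Sum.inr R)

theorem domLeg_comm (φ : c ⟶ d) (f : L.Fn) :
    domLeg c f ≫ SpanObj.Hom.map φ = L.dom f ◁ homFn φ f ≫ domLeg d f :=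
  SpanObj.Hom.leg_comm φ (Sum.inl f)

theorem codLeg_comm (φ : c ⟶ d) (f : L.Fn) :
    codLeg c f ≫ SpanObj.Hom.map φ = L.cod f ◁ homFn φ f ≫ codLeg d f :=
  SpanObj.Hom.leg_comm φ (Sum.inr (Sum.inl f))

theorem relLeg_comm (φ : c ⟶ d) (R : L.Rel) :
    relLeg c R ≫ SpanObj.Hom.map φ = L.arity R ◁ homRel φ R ≫ relLeg d R :=
  SpanObj.Hom.leg_comm φ (Sum.inr (Sum.inr R))

/-- Constructor for morphisms. -/
def mkSpanHom (m : c.carrier ⟶ d.carrier) (a : ∀ f, c.comp (Sum.inl f) ⟶ d.comp (Sum.inl f))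
    (b : ∀ R, c.comp (Sum.inr R) ⟶ d.comp (Sum.inr R))
    (h₁ : ∀ f, domLeg c f ≫ m = L.dom f ◁ a f ≫ domLeg d f)
    (h₂ : ∀ f, codLeg c f ≫ m = L.cod f ◁ a f ≫ codLeg d f)
    (h₃ : ∀ R, relLeg c R ≫ m = L.arity R ◁ b R ≫ relLeg d R) : c ⟶ d where
  map := m
  comp
    | Sum.inl f => a f
    | Sum.inr R => b R
  leg_comm
    | Sum.inl f => h₁ f
    | Sum.inr (Sum.inl f) => h₂ f
    | Sum.inr (Sum.inr R) => h₃ R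

theorem spanHom_ext {φ ψ : c ⟶ d} (h : SpanObj.Hom.map φ = SpanObj.Hom.map ψ)
    (h₁ : ∀ f, homFn φ f = homFn ψ f) (h₂ : ∀ R, homRel φ R = homRel ψ R) : φ = ψ :=
  SpanObj.hom_ext h (by rintro (f | R); exacts [h₁ f, h₂ R])

end Hom

variable [MonoidalClosed V] {M : MorphismProperty V}

open MonoidalClosed

/-- The span object of a structure. -/
abbrev Str.toSpan (A : Str L M) : SpanObj (strSig L) where
  carrier := A.carrier
  comp
    | Sum.inl f => (ihom (L.dom f)).obj A.carrier
    | Sum.inr R => A.rel R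
  leg
    | Sum.inl f => (ihom.ev (L.dom f)).app A.carrier
    | Sum.inr (Sum.inl f) => uncurry (A.fn f)
    | Sum.inr (Sum.inr R) => uncurry (A.incl R)

theorem domLeg_toSpan (A : Str L M) (f : L.Fn) :
    domLeg A.toSpan f = (ihom.ev (L.dom f)).app A.carrier := rfl

theorem codLeg_toSpan (A : Str L M) (f : L.Fn) : codLeg A.toSpan f = uncurry (A.fn f) := rfl

theorem relLeg_toSpan (A : Str L M) (R : L.Rel) : relLeg A.toSpan R = uncurry (A.incl R) := rfl

/-! ### Span morphisms into a structure. -/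

section toSpanHom

variable {c : SpanObj (strSig L)} {B : Str L M} (φ : c ⟶ B.toSpan)

/-- The carrier of a morphism to a structure. -/
def toSpanMap : c.carrier ⟶ B.carrier := SpanObj.Hom.map φ

/-- The component at a function symbol of a morphism to a structure. -/
def toSpanFn (f : L.Fn) : c.comp (Sum.inl f) ⟶ (ihom (L.dom f)).obj B.carrier := homFn φ f

/-- The component at a relation symbol of a morphism to a structure. -/
def toSpanRel (R : L.Rel) : c.comp (Sum.inr R) ⟶ B.rel R := homRel φ R

theorem toSpanFn_eq (f : L.Fn) :
    toSpanFn φ f = curry (domLeg c f) ≫ (ihom (L.dom f)).map (toSpanMap φ) := by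
  have h := domLeg_comm φ f
  rw [← curry_natural_right]
  apply uncurry_injective
  rw [uncurry_curry]
  refine Eq.trans ?_ h.symm
  rw [uncurry_eq]
  rfl

theorem toSpanFn_fn (f : L.Fn) :
    toSpanFn φ f ≫ B.fn f = curry (codLeg c f) ≫ (ihom (L.cod f)).map (toSpanMap φ) := by
  have h := codLeg_comm φ f
  rw [← curry_natural_right]
  apply uncurry_injective
  rw [uncurry_curry, uncurry_natural_left]
  exact h.symm

theorem toSpanRel_incl (R : L.Rel) :
    toSpanRel φ R ≫ B.incl R = curry (relLeg c R) ≫ (ihom (L.arity R)).map (toSpanMap φ) := by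
  have h := relLeg_comm φ R
  rw [← curry_natural_right]
  apply uncurry_injective
  rw [uncurry_curry, uncurry_natural_left]
  exact h.symm

/-- The evaluation legs force the function components and the monic inclusions force the relation
components, so only the carrier map matters. Full faithfulness of the embedding into spans rests on
this. -/
theorem toSpanHom_ext {φ ψ : c ⟶ B.toSpan} (h : toSpanMap φ = toSpanMap ψ) : φ = ψ := by
  refine spanHom_ext h (fun f => ?_) (fun R => ?_)
  · have := toSpanFn_eq φ f
    rw [h, ← toSpanFn_eq] at this
    exact this
  · have := toSpanRel_incl φ R
    rw [h, ← toSpanRel_incl] at this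
    have hm := B.incl_mono R
    exact (cancel_mono (B.incl R)).1 this

/-- Constructor for morphisms to a structure. -/
def mkToSpan (m : c.carrier ⟶ B.carrier)
    (h : ∀ f, (curry (domLeg c f) ≫ (ihom (L.dom f)).map m) ≫ B.fn f =
      curry (codLeg c f) ≫ (ihom (L.cod f)).map m)
    (b : ∀ R, c.comp (Sum.inr R) ⟶ B.rel R)
    (h' : ∀ R, b R ≫ B.incl R = curry (relLeg c R) ≫ (ihom (L.arity R)).map m) : c ⟶ B.toSpan :=
  mkSpanHom (d := B.toSpan) m (fun f => curry (domLeg c f) ≫ (ihom (L.dom f)).map m) b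
    (fun f => by
      rw [← curry_natural_right]
      refine Eq.trans ?_ (uncurry_eq _)
      exact (uncurry_curry _).symm)
    (fun f => by
      refine Eq.trans ?_ (uncurry_natural_left _ _)
      rw [h, ← curry_natural_right]
      exact (uncurry_curry _).symm)
    (fun R => by
      refine Eq.trans ?_ (uncurry_natural_left _ _)
      rw [h', ← curry_natural_right]
      exact (uncurry_curry _).symm)

end toSpanHom

theorem curry_domLeg_toSpan (A : Str L M) (f : L.Fn) : curry (domLeg A.toSpan f) = 𝟙 _ := by
  apply uncurry_injective
  rw [uncurry_curry, uncurry_id_eq_ev, domLeg_toSpan]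

/-- The span morphism of a morphism of structures. -/
def Str.Hom.toSpan {A B : Str L M} (h : A ⟶ B) : A.toSpan ⟶ B.toSpan :=
  mkToSpan (c := A.toSpan) (B := B) (Str.Hom.map h)
    (fun f => by
      rw [curry_domLeg_toSpan, codLeg_toSpan, curry_uncurry]
      refine Eq.trans ?_ (Str.Hom.fn_comm h f)
      exact congrArg (· ≫ B.fn f) (Category.id_comp _))
    (fun R => (Str.Hom.rel_lift h R).choose)
    (fun R => by
      rw [relLeg_toSpan, curry_uncurry]
      exact (Str.Hom.rel_lift h R).choose_spec)

/-- The morphism of structures of a span morphism. -/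
def Str.Hom.ofSpan {A B : Str L M} (φ : A.toSpan ⟶ B.toSpan) : A ⟶ B where
  map := toSpanMap φ
  fn_comm f := by
    have h := toSpanFn_fn φ f
    rw [toSpanFn_eq, curry_domLeg_toSpan, codLeg_toSpan, curry_uncurry] at h
    exact (congrArg (· ≫ B.fn f) (Category.id_comp _)).symm.trans h
  rel_lift R := ⟨toSpanRel φ R, by
    have h := toSpanRel_incl φ R
    rwa [relLeg_toSpan, curry_uncurry] at h⟩

variable (L M) in
/-- The functor from structures to span objects. -/
def spanFunctor : Str L M ⥤ SpanObj (strSig L) where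
  obj A := A.toSpan
  map h := Str.Hom.toSpan h
  map_id _ := toSpanHom_ext rfl
  map_comp _ _ := toSpanHom_ext rfl

/-- Span morphisms between structures are morphisms of structures. -/
def fullyFaithfulSpanFunctor : (spanFunctor L M).FullyFaithful where
  preimage φ := Str.Hom.ofSpan φ
  map_preimage _ := toSpanHom_ext rfl
  preimage_map _ := Str.Hom.ext rfl

instance : (spanFunctor L M).Full := fullyFaithfulSpanFunctor.full
instance : (spanFunctor L M).Faithful := fullyFaithfulSpanFunctor.faithful

/-! ### The reflection of span objects onto structures. -/

section Reflection

variable {F : EnrichedFactorizationSystem V}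

/-- The structure of a span object whose function components are powers. -/
abbrev ofLocal (hF : F.IsProper) (c : SpanObj (strSig L)) (h : ∀ f, IsIso (curry (domLeg c f))) :
    Str L F.M where
  carrier := c.carrier
  fn f := inv (curry (domLeg c f)) ≫ curry (codLeg c f)
  rel R := F.image (curry (relLeg c R))
  incl R := F.imageι (curry (relLeg c R))
  incl_mem _ := F.M_imageι _
  incl_mono _ := hF.mono _ (F.M_imageι _)

/-- The reflection of a span object whose function components are powers. -/
def toOfLocal (hF : F.IsProper) (c : SpanObj (strSig L)) (h : ∀ f, IsIso (curry (domLeg c f))) :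
    c ⟶ (ofLocal hF c h).toSpan :=
  mkToSpan (B := ofLocal hF c h) (𝟙 c.carrier)
    (fun f => by
      have e₁ : curry (domLeg c f) ≫ (ihom (L.dom f)).map (𝟙 c.carrier) = curry (domLeg c f) := by
        rw [CategoryTheory.Functor.map_id, Category.comp_id]
      have e₂ : curry (codLeg c f) ≫ (ihom (L.cod f)).map (𝟙 c.carrier) = curry (codLeg c f) := by
        rw [CategoryTheory.Functor.map_id, Category.comp_id]
      refine (congrArg (· ≫ (ofLocal hF c h).fn f) e₁).trans (Eq.trans ?_ e₂.symm)
      exact IsIso.hom_inv_id_assoc _ _)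
    (fun R => F.toImage (curry (relLeg c R)))
    (fun R => by
      have e₁ : curry (relLeg c R) ≫ (ihom (L.arity R)).map (𝟙 c.carrier) =
        curry (relLeg c R) := by rw [CategoryTheory.Functor.map_id, Category.comp_id]
      exact (F.toImage_imageι _).trans e₁.symm)

theorem existsUnique_toOfLocal (hF : F.IsProper) (c : SpanObj (strSig L))
    (h : ∀ f, IsIso (curry (domLeg c f))) (B : Str L F.M) (φ : c ⟶ B.toSpan) :
    ∃! ψ : ofLocal hF c h ⟶ B, toOfLocal hF c h ≫ Str.Hom.toSpan ψ = φ := by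
  refine ⟨{ map := toSpanMap φ, fn_comm := fun f => ?_, rel_lift := fun R => ?_ },
    toSpanHom_ext (Category.id_comp _), fun ψ hψ => Str.Hom.ext ?_⟩
  · have := h f
    rw [← cancel_epi (curry (domLeg c f))]
    have e := toSpanFn_fn φ f
    rw [toSpanFn_eq, Category.assoc] at e
    refine e.trans ?_
    refine Eq.trans ?_ (Category.assoc _ _ _)
    refine congrArg (· ≫ (ihom (L.cod f)).map (toSpanMap φ)) ?_
    exact (IsIso.hom_inv_id_assoc _ _).symm
  -- The relation component is given only on the original object; orthogonality extends it to the
  -- image.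
  · obtain ⟨d, -, hd⟩ := EnrichedFactorizationSystem.exists_lift
      (F.E_toImage (curry (relLeg c R))) (B.incl_mem R) (a := toSpanRel φ R)
      (b := F.imageι (curry (relLeg c R)) ≫ (ihom (L.arity R)).map (toSpanMap φ))
      (by rw [toSpanRel_incl, reassoc_of% F.toImage_imageι])
    exact ⟨d, hd⟩
  · have := congrArg toSpanMap hψ
    exact (Category.id_comp _).symm.trans this

variable [IsLocallyPresentable.{v} V] {κ : Cardinal.{v}} [Fact κ.IsRegular]

/-- The morphism inverting the comparison of a function component with a power. -/
def localMap (L : Lang.{u, v} V) (f : L.Fn) (P : V) :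
    SpanObj.carrierFree (strSig L) (L.dom f ⊗ P) ⟶ SpanObj.compFree (strSig L) (Sum.inl f) P :=
  (SpanObj.carrierFreeEquiv _ _).symm (L.dom f ◁ SpanObj.compFreeEquiv (S := strSig L)
    (Sum.inl f) P _ (𝟙 _) ≫ domLeg (SpanObj.compFree (strSig L) (Sum.inl f) P) f)

/-- The morphisms whose local objects have powers as function components. -/
def localMaps (L : Lang.{u, v} V) (Q : PresentableRep V κ) :
    MorphismProperty (SpanObj (strSig L)) :=
  MorphismProperty.ofHoms (fun i : L.Fn × Q.ι => localMap L i.1 (Q.obj i.2))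

theorem localMap_comp {c : SpanObj (strSig L)} (f : L.Fn) (P : V)
    (g : SpanObj.compFree (strSig L) (Sum.inl f) P ⟶ c) :
    SpanObj.carrierFreeEquiv _ _ (localMap L f P ≫ g) =
      L.dom f ◁ SpanObj.compFreeEquiv (S := strSig L) (Sum.inl f) P _ g ≫ domLeg c f := by
  have h : SpanObj.compFreeEquiv (S := strSig L) (Sum.inl f) P _ g =
      SpanObj.compFreeEquiv (S := strSig L) (Sum.inl f) P _ (𝟙 _) ≫ homFn g f := by
    refine Eq.trans ?_ (SpanObj.compFreeEquiv_naturality (S := strSig L) (Sum.inl f) P (𝟙 _) g)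
    rw [Category.id_comp]
  rw [h, MonoidalCategory.whiskerLeft_comp, Category.assoc, ← domLeg_comm, ← Category.assoc]
  rfl

/-- After the free-object bijections and one transposition, precomposing with a localizing map
becomes composing elements P ⟶ c.comp with the transposed input leg. Locality thus says that this
leg is bijective on presentable elements. -/
theorem isLocal_localMaps_iff [IsCardinalLocallyPresentable V κ] (Q : PresentableRep V κ)
    (c : SpanObj (strSig L)) :
    (localMaps L Q).isLocal c ↔ ∀ f, IsIso (curry (domLeg c f)) := by
  have key : ∀ (f : L.Fn) (P : V), Function.Bijective (fun g => localMap L f P ≫ (g : _ ⟶ c)) ↔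
      Function.Bijective (fun x : P ⟶ c.comp (Sum.inl f) => x ≫ curry (domLeg c f)) := by
    intro f P
    let e₁ := SpanObj.compFreeEquiv (S := strSig L) (Sum.inl f) P c
    let e₂ := (SpanObj.carrierFreeEquiv (S := strSig L) (L.dom f ⊗ P) c).trans
      ((ihom.adjunction (L.dom f)).homEquiv P c.carrier)
    have : (fun g => localMap L f P ≫ (g : _ ⟶ c)) =
        e₂.symm ∘ (fun x : P ⟶ c.comp (Sum.inl f) => x ≫ curry (domLeg c f)) ∘ e₁ := by
      funext g
      rw [Function.comp_apply, Equiv.eq_symm_apply]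
      refine (congrArg curry (localMap_comp f P g)).trans ?_
      rw [curry_natural_left]
      rfl
    rw [this, Function.Bijective.of_comp_iff' e₂.symm.bijective,
      Function.Bijective.of_comp_iff _ e₁.bijective]
  constructor
  · intro h f
    exact Q.isIso _ (fun i => (key f _).1 (h _ (MorphismProperty.ofHoms.mk (i := (f, i)))))
  · rintro h _ _ _ ⟨f, i⟩
    refine (key f _).2 ?_
    have := h f
    exact ⟨fun a b hab => (cancel_mono _).1 hab,
      fun y => ⟨y ≫ inv (curry (domLeg c f)), by simp⟩⟩

theorem isCardinalPresentable_localMaps (hV : IsLocallyPresentableAsClosed V κ) (hL : L.IsAry κ)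
    (Q : PresentableRep V κ) ⦃X Y : SpanObj (strSig L)⦄ (f : X ⟶ Y) (hf : localMaps L Q f) :
    IsCardinalPresentable X κ ∧ IsCardinalPresentable Y κ := by
  obtain ⟨⟨f, i⟩⟩ := hf
  exact ⟨SpanObj.isCardinalPresentable_carrierFree _ (hV.tensor _ _ (hL.1 f) (Q.presentable i)),
    SpanObj.isCardinalPresentable_compFree _ _ (Q.presentable i)⟩

instance (Q : PresentableRep V κ) : MorphismProperty.IsSmall.{v} (localMaps L Q) := by
  unfold localMaps
  infer_instance

/-- The reflection has two stages: orthogonal reflection makes the function components into powers,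
and then the M-image replaces each relation component. The second stage leaves the carrier alone, so
it does not disturb the first. -/
theorem exists_reflection (hV : IsLocallyPresentableAsClosed V κ) (hF : F.IsProper)
    (hL : L.IsAry κ) (c : SpanObj (strSig L)) : ∃ (A : Str L F.M) (η : c ⟶ A.toSpan),
      ∀ (B : Str L F.M) (φ : c ⟶ B.toSpan), ∃! ψ : A ⟶ B, η ≫ Str.Hom.toSpan ψ = φ := by
  have := hV.locallyPresentable
  obtain ⟨Q⟩ := nonempty_presentableRep (V := V) κ
  have hW := isCardinalPresentable_localMaps hV hL Q
  have := MorphismProperty.isRightAdjoint_ι_isLocal (localMaps L Q) κ hW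
  let adj := Adjunction.ofIsRightAdjoint (localMaps L Q).isLocal.ι
  let c' := (localMaps L Q).isLocal.ι.leftAdjoint.obj c
  have hc' := (isLocal_localMaps_iff Q c'.obj).1 c'.property
  let η : c ⟶ c'.obj := adj.unit.app c
  refine ⟨ofLocal hF c'.obj hc', η ≫ toOfLocal hF _ hc', fun B φ => ?_⟩
  let B' : (localMaps L Q).isLocal.FullSubcategory := ⟨B.toSpan, (isLocal_localMaps_iff Q _).2
    (fun f => by rw [curry_domLeg_toSpan]; infer_instance)⟩
  obtain ⟨φ', hφ'⟩ : ∃ φ' : c'.obj ⟶ B.toSpan, η ≫ φ' = φ :=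
    ⟨((adj.homEquiv c B').symm φ).hom, (adj.homEquiv c B').apply_symm_apply φ⟩
  have hη : ∀ φ₁ φ₂ : c'.obj ⟶ B.toSpan, η ≫ φ₁ = η ≫ φ₂ → φ₁ = φ₂ := by
    intro φ₁ φ₂ h
    have := (adj.homEquiv c B').injective (a₁ := ObjectProperty.homMk φ₁)
      (a₂ := ObjectProperty.homMk φ₂) h
    exact congrArg (fun x => x.hom) this
  obtain ⟨ψ, hψ, hu⟩ := existsUnique_toOfLocal hF c'.obj hc' B φ'
  refine ⟨ψ, ?_, fun ψ' h' => hu _ (hη _ _ ?_)⟩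
  · change (η ≫ toOfLocal hF _ hc') ≫ Str.Hom.toSpan ψ = φ
    rw [Category.assoc, hψ, hφ']
  · rw [hφ', ← Category.assoc]
    exact h'

theorem isRightAdjoint_spanFunctor (hV : IsLocallyPresentableAsClosed V κ) (hF : F.IsProper)
    (hL : L.IsAry κ) : (spanFunctor L F.M).IsRightAdjoint := by
  rw [Functor.isRightAdjoint_iff_leftAdjointObjIsDefined_eq_top]
  ext c
  obtain ⟨A, η, h⟩ := exists_reflection hV hF hL c
  have r : (spanFunctor L F.M ⋙ coyoneda.obj (op c)).CorepresentableBy A :=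
    { homEquiv := fun {B} => Equiv.ofBijective (fun ψ => η ≫ Str.Hom.toSpan ψ)
        ⟨fun ψ₁ ψ₂ h₁₂ => (h B _).unique h₁₂ rfl, fun φ => (h B φ).exists⟩
      homEquiv_comp := fun {B B'} g f => by
        have := (spanFunctor L F.M).map_comp f g
        refine (congrArg (η ≫ ·) this).trans ?_
        exact (Category.assoc _ _ _).symm }
  simpa using! r.isCorepresentable

theorem hasColimits_str (hV : IsLocallyPresentableAsClosed V κ) (hF : F.IsProper)
    (hL : L.IsAry κ) : HasColimits (Str L F.M) := by
  have := isRightAdjoint_spanFunctor hV hF hL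
  let _ : Reflective (spanFunctor L F.M) := ⟨_, Adjunction.ofIsRightAdjoint _⟩
  exact hasColimits_of_reflective (spanFunctor L F.M)

/-- A κ-filtered colimit of structures taken among spans is already a structure. Local objects are
closed under it because the localizing maps have presentable ends, and relations stay in M because M
is closed under such colimits. -/
theorem preservesColimitsOfShape_spanFunctor (hV : IsLocallyPresentableAsClosed V κ)
    (hF : F.IsProper) (hFκ : F.MClosedUnderFilteredColimits κ) (hL : L.IsAry κ)
    (J : Type v) [SmallCategory J] [IsCardinalFiltered J κ] :
    PreservesColimitsOfShape J (spanFunctor L F.M) where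
  preservesColimit {D} := by
    have := hV.locallyPresentable
    obtain ⟨Q⟩ := nonempty_presentableRep (V := V) κ
    let c := colimit.cocone (D ⋙ spanFunctor L F.M)
    let hc : IsColimit c := colimit.isColimit _
    have hloc : (localMaps L Q).isLocal c.pt := by
      have := MorphismProperty.isClosedUnderColimitsOfShape_isLocal (localMaps L Q) J κ
        (isCardinalPresentable_localMaps hV hL Q)
      refine ObjectProperty.prop_of_isColimit (localMaps L Q).isLocal hc (fun j => ?_)
      refine (isLocal_localMaps_iff Q _).2 (fun f => ?_)
      have := curry_domLeg_toSpan (D.obj j) f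
      exact this ▸ inferInstanceAs (IsIso (𝟙 _))
    have h := (isLocal_localMaps_iff Q _).1 hloc
    have hM : ∀ R, F.M (curry (relLeg c.pt R)) := by
      intro R
      have := isCardinalAccessible_ihom hV _ (hL.2.2 R)
      have := (ihom (L.arity R)).preservesColimitsOfShape_of_isCardinalAccessible κ J
      have := hFκ J
      -- Powers by the presentable arity commute with the colimit, so the transposed relation leg is
      -- the filtered colimit of the inclusions of the relations.
      exact MorphismProperty.IsStableUnderColimitsOfShape.condition (W := F.M)
        ((D ⋙ spanFunctor L F.M) ⋙ SpanObj.compF (strSig L) (Sum.inr R))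
        ((D ⋙ spanFunctor L F.M) ⋙ SpanObj.carrierF (strSig L) ⋙ ihom (L.arity R))
        ((SpanObj.compF (strSig L) (Sum.inr R)).mapCocone c)
        ((SpanObj.carrierF (strSig L) ⋙ ihom (L.arity R)).mapCocone c)
        (isColimitOfPreserves _ hc) (isColimitOfPreserves _ hc)
        { app := fun j => (D.obj j).incl R
          naturality := fun j j' w => (Str.Hom.rel_lift (D.map w) R).choose_spec }
        (fun j => (D.obj j).incl_mem R) _ (fun j => by
          have := relLeg_comm (c.ι.app j) R
          refine (curry_natural_left _ _).symm.trans ((congrArg curry this.symm).trans ?_)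
          refine (curry_natural_right _ _).trans ?_
          exact congrArg (· ≫ (ihom (L.arity R)).map (SpanObj.Hom.map (c.ι.app j)))
            (curry_uncurry _))
    have hiso : IsIso (toOfLocal hF c.pt h) := by
      refine SpanObj.isIso_of_components _ (inferInstanceAs (IsIso (𝟙 _))) ?_
      rintro (f | R)
      · have e := toSpanFn_eq (toOfLocal hF c.pt h) f
        have e' : toSpanFn (toOfLocal hF c.pt h) f = curry (domLeg c.pt f) := by
          refine e.trans ?_
          exact (congrArg (curry (domLeg c.pt f) ≫ ·)
            (CategoryTheory.Functor.map_id _ _)).trans (Category.comp_id _)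
        have hh : IsIso (toSpanFn (toOfLocal hF c.pt h) f) := by
          rw [e']
          exact h f
        exact hh
      · have hι := hF.mono _ (F.M_imageι (curry (relLeg c.pt R)))
        have hm := hF.mono _ (hM R)
        obtain ⟨d, hd₁, hd₂⟩ := EnrichedFactorizationSystem.exists_lift
          (F.E_toImage (curry (relLeg c.pt R))) (hM R) (a := 𝟙 _)
          (b := F.imageι (curry (relLeg c.pt R))) (by rw [F.toImage_imageι, Category.id_comp])
        exact ⟨d, hd₁, by
          rw [← cancel_mono (F.imageι (curry (relLeg c.pt R)))]
          refine (Category.assoc _ _ _).trans ?_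
          refine (congrArg (d ≫ ·) (F.toImage_imageι _)).trans ?_
          exact hd₂.trans (Category.id_comp _).symm⟩
    -- The colimit of spans is now isomorphic to the span of a structure; full faithfulness lifts
    -- its cocone to structures and reflects the colimit property.
    let e : c.pt ≅ (ofLocal hF c.pt h).toSpan := asIso (toOfLocal hF c.pt h)
    let s : Cocone D :=
      { pt := ofLocal hF c.pt h
        ι :=
          { app := fun j => (fullyFaithfulSpanFunctor).preimage (c.ι.app j ≫ e.hom)
            naturality := fun j j' w => by
              apply (spanFunctor L F.M).map_injective
              have := c.w w
              simp only [Functor.map_comp, Functor.FullyFaithful.map_preimage,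
                Functor.const_obj_obj, Functor.const_obj_map,
                Category.comp_id]
              rw [← this]
              exact (Category.assoc _ _ _).symm } }
    have hs : IsColimit ((spanFunctor L F.M).mapCocone s) :=
      IsColimit.ofIsoColimit hc (Cocone.ext e (fun j =>
        ((fullyFaithfulSpanFunctor).map_preimage (c.ι.app j ≫ e.hom)).symm))
    exact preservesColimit_of_preserves_colimit_cocone (isColimitOfReflects _ hs) hs

end Reflection

end EnrichedLogic

namespace EnrichedLogic

/-! ### Generalized elements of structures -/

open MonoidalClosed

section

variable {V : Type u} [Category.{v} V] [MonoidalCategory V] [MonoidalClosed V]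

/-- The action of a map `A^X ⟶ A^Y` on generalized elements. -/
def act {X Y A B P : V} (g : (ihom X).obj A ⟶ (ihom Y).obj B) (a : X ⊗ P ⟶ A) : Y ⊗ P ⟶ B :=
  uncurry (curry a ≫ g)

theorem act_natural {X Y A B P P' : V} (g : (ihom X).obj A ⟶ (ihom Y).obj B) (p : P' ⟶ P)
    (a : X ⊗ P ⟶ A) : act g (X ◁ p ≫ a) = Y ◁ p ≫ act g a := by
  rw [act, act, curry_natural_left, Category.assoc, uncurry_natural_left]

theorem curry_act {X Y A B P : V} (g : (ihom X).obj A ⟶ (ihom Y).obj B) (a : X ⊗ P ⟶ A) :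
    curry (act g a) = curry a ≫ g := curry_uncurry _

theorem whiskerLeft_curry_ev {X A P : V} (a : X ⊗ P ⟶ A) :
    X ◁ curry a ≫ (ihom.ev X).app A = a := by
  rw [← uncurry_eq, uncurry_curry]

/-- Evaluation is the generic element: a map between powers is recovered from its action on it. -/
theorem act_ev {X Y A B : V} (g : (ihom X).obj A ⟶ (ihom Y).obj B) :
    act g ((ihom.ev X).app A) = uncurry g := by
  rw [act, ← uncurry_id_eq_ev, curry_uncurry, Category.id_comp]

theorem act_comp_ihom_map {X A B P : V} (m : A ⟶ B) (a : X ⊗ P ⟶ A) :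
    act ((ihom X).map m) a = a ≫ m := by
  rw [act, ← curry_natural_right, uncurry_curry]

theorem act_comp {X Y Z A B C P : V} (g : (ihom X).obj A ⟶ (ihom Y).obj B)
    (h : (ihom Y).obj B ⟶ (ihom Z).obj C) (a : X ⊗ P ⟶ A) : act (g ≫ h) a = act h (act g a) := by
  rw [act, act, curry_act, Category.assoc]

theorem act_pre {X Y A P : V} (g : Y ⟶ X) (a : X ⊗ P ⟶ A) :
    act ((pre g).app A) a = g ▷ P ≫ a := by
  rw [act, uncurry_pre_app, uncurry_curry]

/-- Two maps between powers agree if they act in the same way on elements. -/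
theorem ext_act {X Y A B : V} {g h : (ihom X).obj A ⟶ (ihom Y).obj B}
    (H : ∀ (P : V) (a : X ⊗ P ⟶ A), act g a = act h a) : g = h :=
  uncurry_injective (by rw [← act_ev, ← act_ev, H])

theorem curry_powTensor_hom {X Z A P : V} (x : (X ⊗ Z) ⊗ P ⟶ A) :
    curry x ≫ (powTensor X Z A).hom = curry (curry ((α_ X Z P).inv ≫ x)) := by
  dsimp only [powTensor]
  rw [← curry_natural_left, ← curry_natural_left, associator_inv_naturality_right_assoc,
    ← uncurry_eq, uncurry_curry]

theorem curry_curry_powTensor_inv {X Z A P : V} (y : X ⊗ (Z ⊗ P) ⟶ A) :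
    curry (curry y) ≫ (powTensor X Z A).inv = curry ((α_ X Z P).hom ≫ y) := by
  rw [Iso.comp_inv_eq, curry_powTensor_hom, Iso.inv_hom_id_assoc]

theorem factors_ihom_map_iff {S X W P : V} (m : S ⟶ X) (y : W ⊗ P ⟶ X) :
    Factors ((ihom W).map m) (curry y) ↔ Factors m y := by
  constructor
  · rintro ⟨l, hl⟩
    exact ⟨uncurry l, by rw [← uncurry_natural_right, hl, uncurry_curry]⟩
  · rintro ⟨l, rfl⟩
    exact ⟨curry l, by rw [curry_natural_right]⟩

variable {L : Lang.{u, v} V} {M : MorphismProperty V}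

namespace Str

/-- The action of a function symbol on generalized elements. -/
def op (K : Str L M) (f : L.Fn) {P : V} (a : L.dom f ⊗ P ⟶ K.carrier) :
    L.cod f ⊗ P ⟶ K.carrier := act (K.fn f) a

theorem op_natural (K : Str L M) (f : L.Fn) {P P' : V} (p : P' ⟶ P)
    (a : L.dom f ⊗ P ⟶ K.carrier) : K.op f (L.dom f ◁ p ≫ a) = L.cod f ◁ p ≫ K.op f a :=
  act_natural _ _ _

/-- A generalized element belongs to the interpretation of a relation symbol. -/
def RelEl (K : Str L M) (R : L.Rel) {P : V} (a : L.arity R ⊗ P ⟶ K.carrier) : Prop :=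
  Factors (K.incl R) (curry a)

theorem RelEl.natural {K : Str L M} {R : L.Rel} {P P' : V} {a : L.arity R ⊗ P ⟶ K.carrier}
    (h : K.RelEl R a) (p : P' ⟶ P) : K.RelEl R (L.arity R ◁ p ≫ a) := by
  unfold RelEl
  rw [curry_natural_left]
  exact h.comp_left p

theorem relEl_uncurry_incl (K : Str L M) (R : L.Rel) : K.RelEl R (uncurry (K.incl R)) := by
  unfold RelEl
  rw [curry_uncurry]
  exact factors_self _

theorem Hom.op_comp {A B : Str L M} (h : Hom A B) (f : L.Fn) {P : V}
    (a : L.dom f ⊗ P ⟶ A.carrier) : B.op f (a ≫ h.map) = A.op f a ≫ h.map := by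
  rw [op, ← act_comp_ihom_map, ← act_comp, h.fn_comm, act_comp, act_comp_ihom_map]
  rfl

theorem Hom.relEl {A B : Str L M} (h : Hom A B) {R : L.Rel} {P : V}
    {a : L.arity R ⊗ P ⟶ A.carrier} (ha : A.RelEl R a) : B.RelEl R (a ≫ h.map) := by
  obtain ⟨l, hl⟩ := ha
  obtain ⟨r, hr⟩ := h.rel_lift R
  exact ⟨l ≫ r, by rw [Category.assoc, hr, reassoc_of% hl, curry_natural_right]⟩

/-- Morphisms of structures are the maps compatible with generalized elements. -/
def homOfEl {A B : Str L M} (m : A.carrier ⟶ B.carrier)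
    (h : ∀ (f : L.Fn) (P : V) (a : L.dom f ⊗ P ⟶ A.carrier), B.op f (a ≫ m) = A.op f a ≫ m)
    (h' : ∀ (R : L.Rel) (P : V) (a : L.arity R ⊗ P ⟶ A.carrier), A.RelEl R a →
      B.RelEl R (a ≫ m)) : A ⟶ B where
  map := m
  fn_comm f := ext_act (fun P a => by
    rw [act_comp, act_comp, act_comp_ihom_map, act_comp_ihom_map]
    exact h f P a)
  rel_lift R := by
    obtain ⟨l, hl⟩ := h' R _ _ (A.relEl_uncurry_incl R)
    exact ⟨l, by rw [hl, curry_natural_right, curry_uncurry]⟩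

theorem IsHomElement.comp_left {A B : Str L M} {Z Z' : V}
    {z : Z ⟶ (ihom A.carrier).obj B.carrier} (hz : IsHomElement z) (p : Z' ⟶ Z) :
    IsHomElement (p ≫ z) where
  fn f := by rw [Category.assoc, Category.assoc, hz.fn]
  rel R := by
    obtain ⟨w, hw⟩ := hz.rel R
    exact ⟨p ≫ w, by rw [Category.assoc, Category.assoc, hw]⟩

theorem uncurry_comp_powAct {A B W : V} (X : V) (z : W ⟶ (ihom A).obj B) :
    uncurry (z ≫ powAct X A B) =
      curry ((α_ X _ W).inv ≫ (ihom.ev X).app A ▷ W ≫ uncurry z) := by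
  apply uncurry_injective
  rw [uncurry_natural_left, uncurry_natural_left, uncurry_uncurry_powAct, uncurry_curry,
    associator_inv_naturality_right_assoc, whisker_exchange_assoc]
  exact congrArg (fun k => (α_ X ((ihom X).obj A) W).inv ≫ (ihom.ev X).app A ▷ W ≫ k)
    (uncurry_eq z).symm

theorem uncurry_comp_powAct_pre {A B W S : V} (X : V) (z : W ⟶ (ihom A).obj B)
    (g : S ⟶ (ihom X).obj A) :
    uncurry (z ≫ powAct X A B ≫ (pre g).app ((ihom X).obj B)) =
      curry ((α_ X S W).inv ≫ uncurry g ▷ W ≫ uncurry z) := by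
  rw [← Category.assoc, uncurry_pre_app, uncurry_comp_powAct, ← curry_natural_left,
    associator_inv_naturality_middle_assoc, ← comp_whiskerRight_assoc, uncurry_eq g]

/-- A Yoneda argument: the conditions on `z` are those for the generic elements, evaluation for
function symbols and the inclusion for relation symbols, and naturality spreads them to all
elements. This form can be compared with powers of structures. -/
theorem isHomElement_iff {A B : Str L M} {W : V} (z : W ⟶ (ihom A.carrier).obj B.carrier) :
    IsHomElement z ↔ (∀ (f : L.Fn) (P : V) (a : L.dom f ⊗ P ⟶ A.carrier),
      B.op f ((α_ _ _ _).inv ≫ a ▷ W ≫ uncurry z) = (α_ _ _ _).inv ≫ A.op f a ▷ W ≫ uncurry z) ∧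
      ∀ (R : L.Rel) (P : V) (a : L.arity R ⊗ P ⟶ A.carrier), A.RelEl R a →
        B.RelEl R ((α_ _ _ _).inv ≫ a ▷ W ≫ uncurry z) := by
  have hfn : ∀ f : L.Fn, (z ≫ powAct (L.dom f) A.carrier B.carrier ≫
        (ihom ((ihom (L.dom f)).obj A.carrier)).map (B.fn f) =
      z ≫ powAct (L.cod f) A.carrier B.carrier ≫
        (pre (A.fn f)).app ((ihom (L.cod f)).obj B.carrier)) ↔
      B.op f ((α_ _ _ _).inv ≫ (ihom.ev (L.dom f)).app A.carrier ▷ W ≫ uncurry z) =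
        (α_ _ _ _).inv ≫ uncurry (A.fn f) ▷ W ≫ uncurry z := by
    intro f
    have e : uncurry (z ≫ powAct (L.dom f) A.carrier B.carrier ≫
        (ihom ((ihom (L.dom f)).obj A.carrier)).map (B.fn f)) = curry (B.op f
          ((α_ _ _ _).inv ≫ (ihom.ev (L.dom f)).app A.carrier ▷ W ≫ uncurry z)) := by
      rw [← Category.assoc, uncurry_natural_right, uncurry_comp_powAct, op, curry_act]
    rw [← uncurry_injective.eq_iff, e, uncurry_comp_powAct_pre, curry_injective.eq_iff]
  have hrel : ∀ R : L.Rel, (∃ w : W ⟶ (ihom (A.rel R)).obj (B.rel R),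
      z ≫ powAct (L.arity R) A.carrier B.carrier ≫
        (pre (A.incl R)).app ((ihom (L.arity R)).obj B.carrier) =
      w ≫ (ihom (A.rel R)).map (B.incl R)) ↔
      B.RelEl R ((α_ _ _ _).inv ≫ uncurry (A.incl R) ▷ W ≫ uncurry z) := by
    intro R
    have e : uncurry (z ≫ powAct (L.arity R) A.carrier B.carrier ≫
        (pre (A.incl R)).app ((ihom (L.arity R)).obj B.carrier)) =
        curry ((α_ _ _ _).inv ≫ uncurry (A.incl R) ▷ W ≫ uncurry z) := by
      exact uncurry_comp_powAct_pre _ _ _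
    constructor
    · rintro ⟨w, hw⟩
      exact ⟨uncurry w, by rw [← e, hw, uncurry_natural_right]⟩
    · rintro ⟨l, hl⟩
      exact ⟨curry l, by
        apply uncurry_injective
        rw [e, ← hl, uncurry_natural_right, uncurry_curry]⟩
  constructor
  · rintro ⟨h₁, h₂⟩
    refine ⟨fun f P a => ?_, fun R P a ha => ?_⟩
    · have h := (hfn f).1 (h₁ f)
      have h' := congrArg (fun k => L.cod f ◁ (curry a ▷ W) ≫ k) h
      rw [← op_natural, associator_inv_naturality_middle_assoc,
        ← comp_whiskerRight_assoc, whiskerLeft_curry_ev, associator_inv_naturality_middle_assoc,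
        ← comp_whiskerRight_assoc] at h'
      rw [h', op, act, uncurry_natural_left]
    · obtain ⟨l, hl⟩ := ha
      have h := ((hrel R).1 (h₂ R)).natural (l ▷ W)
      rwa [associator_inv_naturality_middle_assoc, ← comp_whiskerRight_assoc,
        ← uncurry_natural_left, hl, uncurry_curry] at h
  · rintro ⟨h₁, h₂⟩
    refine ⟨fun f => (hfn f).2 ?_, fun R => (hrel R).2 (h₂ R _ _ (A.relEl_uncurry_incl R))⟩
    rw [h₁, op, act_ev]

end Str

end

/-! ### Transposition and powers of structures -/

variable {V : Type u} [Category.{v} V] [MonoidalCategory V] [MonoidalClosed V]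
  [SymmetricCategory V]

/-- Transposition across a power. -/
def tr {A W B : V} : (A ⟶ (ihom W).obj B) ≃ (A ⊗ W ⟶ B) where
  toFun h := (β_ A W).hom ≫ uncurry h
  invFun k := curry ((β_ W A).hom ≫ k)
  left_inv h := by simp
  right_inv k := by simp

theorem tr_comp {A A' W B : V} (p : A' ⟶ A) (h : A ⟶ (ihom W).obj B) :
    tr (p ≫ h) = p ▷ W ≫ tr h := by
  simp only [tr, Equiv.coe_fn_mk, uncurry_natural_left,
    BraidedCategory.braiding_naturality_left_assoc]

theorem tr_symm_comp {A A' W B : V} (p : A' ⟶ A) (h : A ⊗ W ⟶ B) :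
    tr.symm (p ▷ W ≫ h) = p ≫ tr.symm h := by
  rw [Equiv.symm_apply_eq, tr_comp, Equiv.apply_symm_apply]

/-- Transposition of a generalized element of a power. -/
def tr₂ {X P W B : V} : (X ⊗ P ⟶ (ihom W).obj B) ≃ (X ⊗ (P ⊗ W) ⟶ B) where
  toFun a := (α_ X P W).inv ≫ tr a
  invFun b := tr.symm ((α_ X P W).hom ≫ b)
  left_inv a := by simp
  right_inv b := by simp

theorem tr₂_natural_param {X P P' W B : V} (p : P' ⟶ P) (a : X ⊗ P ⟶ (ihom W).obj B) :
    tr₂ (X ◁ p ≫ a) = X ◁ (p ▷ W) ≫ tr₂ a := by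
  simp only [tr₂, Equiv.coe_fn_mk, tr_comp, associator_inv_naturality_middle_assoc]

theorem tr₂_natural_left {X X' P W B : V} (g : X' ⟶ X) (a : X ⊗ P ⟶ (ihom W).obj B) :
    tr₂ (g ▷ P ≫ a) = g ▷ (P ⊗ W) ≫ tr₂ a := by
  simp only [tr₂, Equiv.coe_fn_mk, tr_comp, associator_inv_naturality_left_assoc]

theorem tr₂_comp {X P A W B : V} (a : X ⊗ P ⟶ A) (h : A ⟶ (ihom W).obj B) :
    tr₂ (a ≫ h) = (α_ X P W).inv ≫ a ▷ W ≫ tr h := by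
  simp only [tr₂, Equiv.coe_fn_mk, tr_comp]

theorem tr₂_assoc {X Z P W B : V} (a : (X ⊗ Z) ⊗ P ⟶ (ihom W).obj B) :
    tr₂ ((α_ X Z P).inv ≫ a) = X ◁ (α_ Z P W).hom ≫ (α_ X Z (P ⊗ W)).inv ≫ tr₂ a := by
  simp only [tr₂, Equiv.coe_fn_mk, tr_comp]
  monoidal

/-- The isomorphism `(B^X)^W ≅ (B^W)^X`. -/
def powSwap (X W B : V) : (ihom W).obj ((ihom X).obj B) ≅ (ihom X).obj ((ihom W).obj B) :=
  (powTensor X W B).symm ≪≫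
    { hom := (pre (β_ W X).hom).app B
      inv := (pre (β_ X W).hom).app B
      hom_inv_id := by
        rw [← NatTrans.comp_app, ← pre_map, SymmetricCategory.symmetry, pre_id]
        rfl
      inv_hom_id := by
        rw [← NatTrans.comp_app, ← pre_map, SymmetricCategory.symmetry, pre_id]
        rfl } ≪≫ powTensor W X B

/-- On elements the swap only exchanges the order of the parameters P and W; the verification is the
hexagon identity with symmetric braidings cancelled. -/
theorem curry_powSwap_inv {X W B P : V} (a : X ⊗ P ⟶ (ihom W).obj B) :
    curry a ≫ (powSwap X W B).inv = curry (curry (X ◁ (β_ W P).hom ≫ tr₂ a)) := by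
  rw [Iso.comp_inv_eq]
  dsimp only [powSwap, Iso.trans_hom, Iso.symm_hom]
  rw [← Category.assoc, curry_curry_powTensor_inv, ← Category.assoc, curry_pre_app,
    curry_powTensor_hom]
  congr 1
  rw [eq_curry_iff]
  have h := BraidedCategory.hexagon_reverse X P W
  simp only [tr₂, tr, Equiv.coe_fn_mk]
  have h' : (α_ X P W).inv ≫ (β_ (X ⊗ P) W).hom = X ◁ (β_ P W).hom ≫ (α_ X W P).inv ≫
      (β_ X W).hom ▷ P ≫ (α_ W X P).hom := by
    rw [← cancel_mono (α_ W X P).inv, Category.assoc, h]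
    simp
  rw [reassoc_of% h', ← MonoidalCategory.whiskerLeft_comp_assoc, SymmetricCategory.symmetry,
    MonoidalCategory.whiskerLeft_id, Category.id_comp, Iso.hom_inv_id_assoc,
    ← comp_whiskerRight_assoc, SymmetricCategory.symmetry, id_whiskerRight, Category.id_comp,
    Iso.inv_hom_id_assoc]

theorem factors_comp_iso_iff {C : Type u} [Category.{v} C] {S X Y P : C} (m : S ⟶ X) (e : X ≅ Y)
    (y : P ⟶ Y) : Factors (m ≫ e.hom) y ↔ Factors m (y ≫ e.inv) := by
  constructor
  · rintro ⟨l, rfl⟩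
    exact ⟨l, by simp⟩
  · rintro ⟨l, hl⟩
    exact ⟨l, by rw [reassoc_of% hl]; simp⟩

theorem factors_iso_comp_iff {C : Type u} [Category.{v} C] {S Y P P' : C} (m : S ⟶ Y) (e : P' ≅ P)
    (y : P ⟶ Y) : Factors m (e.hom ≫ y) ↔ Factors m y :=
  ⟨fun h => by simpa using h.comp_left e.inv, fun h => h.comp_left e.hom⟩

/-! ### Powers of structures. -/

namespace Str

variable {L : Lang.{u, v} V} {F : EnrichedFactorizationSystem V}

/-- The power `K^W` of a structure. -/
abbrev power (hF : F.IsProper) (K : Str L F.M) (W : V) : Str L F.M where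
  carrier := (ihom W).obj K.carrier
  fn f := curry (tr₂.symm (K.op f (tr₂ ((ihom.ev (L.dom f)).app ((ihom W).obj K.carrier)))))
  rel R := (ihom W).obj (K.rel R)
  incl R := (ihom W).map (K.incl R) ≫ (powSwap (L.arity R) W K.carrier).hom
  incl_mem R := F.M_comp _ _ (EnrichedFactorizationSystem.M_ihom hF W _ (K.incl_mem R))
    (F.M_iso _ inferInstance)
  incl_mono R := hF.mono _ (F.M_comp _ _
    (EnrichedFactorizationSystem.M_ihom hF W _ (K.incl_mem R)) (F.M_iso _ inferInstance))

/-- The operation is defined by its value on the generic element; naturality in the parameter shows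
that it is pointwise on every element. -/
theorem op_power (hF : F.IsProper) (K : Str L F.M) (W : V) (f : L.Fn) {P : V}
    (a : L.dom f ⊗ P ⟶ (ihom W).obj K.carrier) :
    (K.power hF W).op f a = tr₂.symm (K.op f (tr₂ a)) := by
  have key : (K.power hF W).op f a = L.cod f ◁ curry a ≫
      tr₂.symm (K.op f (tr₂ ((ihom.ev (L.dom f)).app ((ihom W).obj K.carrier)))) := by
    rw [op, act, uncurry_natural_left]
    exact congrArg (L.cod f ◁ curry a ≫ ·) (uncurry_curry _)
  rw [key, Equiv.eq_symm_apply, tr₂_natural_param, Equiv.apply_symm_apply, ← op_natural,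
    ← tr₂_natural_param, whiskerLeft_curry_ev]

theorem relEl_power_iff (hF : F.IsProper) (K : Str L F.M) (W : V) (R : L.Rel) {P : V}
    (a : L.arity R ⊗ P ⟶ (ihom W).obj K.carrier) :
    (K.power hF W).RelEl R a ↔ K.RelEl R (tr₂ a) := by
  have h : (K.power hF W).RelEl R a ↔
      Factors ((ihom W).map (K.incl R) ≫ (powSwap (L.arity R) W K.carrier).hom) (curry a) := Iff.rfl
  rw [h, factors_comp_iso_iff, curry_powSwap_inv, factors_ihom_map_iff, curry_natural_left]
  exact factors_iso_comp_iff _ (β_ W P) _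

/-- Elements of the hom-object are morphisms to the power. -/
theorem isHomElement_iff_power (hF : F.IsProper) {A K : Str L F.M} {W : V}
    (z : W ⟶ (ihom A.carrier).obj K.carrier) :
    IsHomElement z ↔ ∃ h : A ⟶ K.power hF W, tr h.map = uncurry z := by
  rw [isHomElement_iff]
  constructor
  · rintro ⟨h₁, h₂⟩
    refine ⟨homOfEl (B := K.power hF W) (tr.symm (uncurry z)) (fun f P a => ?_)
      (fun R P a ha => ?_), Equiv.apply_symm_apply _ _⟩
    · rw [op_power, Equiv.symm_apply_eq, tr₂_comp, tr₂_comp, Equiv.apply_symm_apply, h₁]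
    · rw [relEl_power_iff, tr₂_comp, Equiv.apply_symm_apply]
      exact h₂ R P a ha
  · rintro ⟨h, hh⟩
    rw [← hh]
    refine ⟨fun f P a => ?_, fun R P a ha => ?_⟩
    · have := h.op_comp f a
      rw [op_power, Equiv.symm_apply_eq] at this
      refine Eq.trans ?_ (this.trans (tr₂_comp _ _))
      exact congrArg (K.op f) (tr₂_comp _ _).symm
    · have := h.relEl ha
      rw [relEl_power_iff] at this
      have e := tr₂_comp a h.map
      exact e ▸ this

end Str

end EnrichedLogic

namespace EnrichedLogic

open MonoidalClosed

variable {V : Type u} [Category.{v} V] [MonoidalCategory V] [MonoidalClosed V]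
  [SymmetricCategory V] [IsLocallyPresentable.{v} V]

/-! ### Values of terms on generalized elements -/

section Terms

variable {L : Lang.{u, v} V} {M : MorphismProperty V}

/-- The value of a term on a generalized element. -/
def Term.val (K : Str L M) {X Y P : V} (t : Term L X Y) (x : X ⊗ P ⟶ K.carrier) :
    Y ⊗ P ⟶ K.carrier := act (t.interp K) x

namespace Term

variable (K : Str L M)

theorem curry_val {X Y P : V} (t : Term L X Y) (x : X ⊗ P ⟶ K.carrier) :
    curry (t.val K x) = curry x ≫ t.interp K := curry_act _ _

theorem val_natural {X Y P P' : V} (t : Term L X Y) (p : P' ⟶ P) (x : X ⊗ P ⟶ K.carrier) :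
    t.val K (X ◁ p ≫ x) = Y ◁ p ≫ t.val K x := act_natural _ _ _

theorem val_ofHom {X Y P : V} (g : Y ⟶ X) (x : X ⊗ P ⟶ K.carrier) :
    (Term.ofHom (L := L) g).val K x = g ▷ P ≫ x := act_pre _ _

theorem val_symb (f : L.Fn) {P : V} (x : L.dom f ⊗ P ⟶ K.carrier) :
    (Term.symb f).val K x = K.op f x := rfl

theorem val_comp {X Y Z P : V} (t : Term L X Y) (s : Term L Y Z) (x : X ⊗ P ⟶ K.carrier) :
    (Term.comp t s).val K x = s.val K (t.val K x) := act_comp _ _ _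

theorem val_pow {X Y P : V} (Z : V) (t : Term L X Y) (x : (X ⊗ Z) ⊗ P ⟶ K.carrier) :
    (Term.pow Z t).val K x = (α_ Y Z P).hom ≫ t.val K ((α_ X Z P).inv ≫ x) := by
  apply curry_injective
  rw [curry_val, ← curry_curry_powTensor_inv, curry_val]
  refine Eq.trans (Category.assoc _ _ _).symm ?_
  rw [curry_powTensor_hom]
  refine Eq.trans (Category.assoc _ _ _).symm ?_
  exact congrArg (· ≫ (powTensor Y Z K.carrier).inv) (curry_natural_right _ _).symm

theorem ι_val_tuple {X P : V} {J : Type v} (Y : J → V) (t : ∀ j, Term L X (Y j))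
    (x : X ⊗ P ⟶ K.carrier) (j : J) :
    Sigma.ι Y j ▷ P ≫ (Term.tuple Y t).val K x = (t j).val K x := by
  rw [← act_pre]
  refine (act_comp _ _ _).symm.trans ?_
  exact congrArg (fun g => act g x) (tupleMap_pre_ι Y K.carrier _ (fun j => (t j).interp K) j)

end Term

/-- Closedness makes `- ⊗ P` preserve coproducts, so maps out of the tensored coproduct are tested
on summands. -/
theorem sigma_tensor_hom_ext {J : Type v} {Y : J → V} {P A : V} {f g : (∐ Y) ⊗ P ⟶ A}
    (h : ∀ j, Sigma.ι Y j ▷ P ≫ f = Sigma.ι Y j ▷ P ≫ g) : f = g := by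
  apply tr.symm.injective
  refine Sigma.hom_ext _ _ (fun j => ?_)
  rw [← tr_symm_comp, ← tr_symm_comp, h]

theorem Str.Hom.val_comp {A B : Str L M} (h : A ⟶ B) {X Y P : V} (t : Term L X Y)
    (a : X ⊗ P ⟶ A.carrier) : t.val B (a ≫ Str.Hom.map h) = t.val A a ≫ Str.Hom.map h := by
  induction t generalizing P with
  | ofHom g => rw [Term.val_ofHom, Term.val_ofHom, Category.assoc]
  | symb f => exact Str.Hom.op_comp h f a
  | pow Z t ih =>
    rw [Term.val_pow, Term.val_pow, Category.assoc, ← ih, Category.assoc]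
  | tuple Y t ih =>
    refine sigma_tensor_hom_ext (fun j => ?_)
    rw [Term.ι_val_tuple, ← Category.assoc, Term.ι_val_tuple, ih]
  | comp t s ih₁ ih₂ => rw [Term.val_comp, Term.val_comp, ih₁, ih₂]

/-! ### Pointwise evaluation of terms in powers. -/

section Power

variable {F : EnrichedFactorizationSystem V} (hF : F.IsProper) (K : Str L F.M) (W : V)

/-- Transposition of the generalized elements of a power. -/
def Str.trEl {X P : V} : (X ⊗ P ⟶ (K.power hF W).carrier) ≃ (X ⊗ (P ⊗ W) ⟶ K.carrier) :=
  tr₂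

theorem Str.trEl_natural_left {X X' P : V} (g : X' ⟶ X) (a : X ⊗ P ⟶ (K.power hF W).carrier) :
    K.trEl hF W (g ▷ P ≫ a) = g ▷ (P ⊗ W) ≫ K.trEl hF W a := tr₂_natural_left _ _

theorem Str.trEl_assoc {X Z P : V} (a : (X ⊗ Z) ⊗ P ⟶ (K.power hF W).carrier) :
    K.trEl hF W ((α_ X Z P).inv ≫ a) =
      X ◁ (α_ Z P W).hom ≫ (α_ X Z (P ⊗ W)).inv ≫ K.trEl hF W a := tr₂_assoc _

theorem Str.trEl_assoc_hom {X Z P : V} (a : X ⊗ (Z ⊗ P) ⟶ (K.power hF W).carrier) :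
    K.trEl hF W ((α_ X Z P).hom ≫ a) =
      (α_ X Z (P ⊗ W)).hom ≫ X ◁ (α_ Z P W).inv ≫ K.trEl hF W a := by
  have h := K.trEl_assoc hF W ((α_ X Z P).hom ≫ a)
  rw [Iso.inv_hom_id_assoc] at h
  rw [h, ← MonoidalCategory.whiskerLeft_comp_assoc, Iso.inv_hom_id,
    MonoidalCategory.whiskerLeft_id, Category.id_comp, Iso.hom_inv_id_assoc]

theorem Term.val_power {X Y P : V} (t : Term L X Y) (a : X ⊗ P ⟶ (K.power hF W).carrier) :
    K.trEl hF W (t.val (K.power hF W) a) = t.val K (K.trEl hF W a) := by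
  induction t generalizing P with
  | ofHom g => rw [Term.val_ofHom, Term.val_ofHom, Str.trEl_natural_left]
  | symb f =>
    rw [Term.val_symb, Term.val_symb]
    exact (Equiv.eq_symm_apply _).1 (Str.op_power hF K W f a)
  | pow Z t ih =>
    rw [Term.val_pow, Term.val_pow, Str.trEl_assoc_hom, ih, Str.trEl_assoc, Term.val_natural,
      ← MonoidalCategory.whiskerLeft_comp_assoc, Iso.inv_hom_id,
      MonoidalCategory.whiskerLeft_id, Category.id_comp]
  | tuple Y t ih =>
    refine sigma_tensor_hom_ext (fun j => ?_)
    rw [Term.ι_val_tuple, ← Str.trEl_natural_left, ← ih, Term.ι_val_tuple]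
  | comp t s ih₁ ih₂ => rw [Term.val_comp, Term.val_comp, ih₂, ih₁]

end Power

end Terms

/-! ### Satisfaction of formulas by generalized elements -/

section Sat

variable {F : EnrichedFactorizationSystem V} {L : Lang.{u, v} V}

/-- A generalized element satisfies a formula. -/
def Sat (K : Str L F.M) {X P : V} (φ : Formula L X) (x : X ⊗ P ⟶ K.carrier) : Prop :=
  Factors (φ.interp F K).hom (curry x)

variable (K : Str L F.M)

/-- Each clause is an image, an intersection or a pullback of an M-map. Consequently membership in
any interpretation is E-local. -/
theorem M_interp (hF : F.IsProper) {X : V} (φ : Formula L X) : F.M (φ.interp F K).hom := by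
  induction φ with
  | eq s t => exact F.M_imageι _
  | rel R Y t =>
    exact EnrichedFactorizationSystem.M_of_isPullback hF (IsPullback.of_hasPullback _ _).flip
      (F.M_comp _ _ (EnrichedFactorizationSystem.M_ihom hF Y _ (K.incl_mem R))
        (F.M_iso _ inferInstance))
  | conj φ ih => exact EnrichedFactorizationSystem.M_widePullback hF _ _ ih
  | ex Y ψ ih => exact F.M_imageι _
  | disj φ ih => exact F.M_imageι _

variable {K}

theorem sat_whiskerLeft_iso_iff {X P P' : V} {φ : Formula L X} {x : X ⊗ P ⟶ K.carrier}
    (p : P' ≅ P) : Sat K φ (X ◁ p.hom ≫ x) ↔ Sat K φ x := by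
  unfold Sat
  rw [curry_natural_left]
  exact factors_iso_comp_iff _ _ _

/-- Equalizers already lie in M by properness, so the image in the interpretation adds nothing and
an equation means equality of values. -/
theorem sat_eq_iff (hF : F.IsProper) {X Y P : V} (s t : Term L X Y) (x : X ⊗ P ⟶ K.carrier) :
    Sat K (.eq s t) x ↔ s.val K x = t.val K x := by
  have h : ∀ {P : V} (y : P ⟶ (ihom X).obj K.carrier),
      Factors (equalizer.ι (s.interp K) (t.interp K)) y ↔ y ≫ s.interp K = y ≫ t.interp K := by
    intro P y
    constructor
    · rintro ⟨l, rfl⟩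
      rw [Category.assoc, Category.assoc, equalizer.condition]
    · intro hy
      exact ⟨equalizer.lift y hy, equalizer.lift_ι _ _⟩
  refine Iff.trans (EnrichedFactorizationSystem.factors_imageι_of_M _
    (EnrichedFactorizationSystem.M_of_regularMono hF _ _ _ h) _) ?_
  rw [h, ← Term.curry_val, ← Term.curry_val, curry_injective.eq_iff]

theorem sat_rel_iff {Z P : V} (R : L.Rel) (Y : V) (t : Term L Z (L.arity R ⊗ Y))
    (x : Z ⊗ P ⟶ K.carrier) :
    Sat K (.rel R Y t) x ↔ K.RelEl R ((α_ (L.arity R) Y P).inv ≫ t.val K x) := by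
  have h : Sat K (.rel R Y t) x ↔ Factors ((ihom Y).map (K.incl R) ≫
      (powTensor (L.arity R) Y K.carrier).symm.hom) (curry x ≫ t.interp K) :=
    factors_iff_of_isPullback (IsPullback.of_hasPullback _ _).flip _
  rw [h, ← Term.curry_val, factors_comp_iso_iff, Iso.symm_inv, curry_powTensor_hom,
    factors_ihom_map_iff]
  rfl

theorem sat_conj_iff {X P : V} {J : Type v} (φ : J → Formula L X) (x : X ⊗ P ⟶ K.carrier) :
    Sat K (.conj φ) x ↔ ∀ j, Sat K (φ j) x :=
  EnrichedFactorizationSystem.factors_widePullback_base_iff _ _ _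

theorem Formula.IsAtomic.induction {p : ∀ {X : V}, Formula L X → Prop}
    (h₁ : ∀ {X Y : V} (s t : Term L X Y), p (.eq s t))
    (h₂ : ∀ {Z : V} (R : L.Rel) (Y : V) (t : Term L Z (L.arity R ⊗ Y)), p (.rel R Y t))
    {X : V} {φ : Formula L X} (h : φ.IsAtomic) : p φ := by
  cases φ with
  | eq s t => exact h₁ s t
  | rel R Y t => exact h₂ R Y t
  | conj φ => exact h.elim
  | ex Y ψ => exact h.elim
  | disj φ => exact h.elim

/-- Morphisms preserve atomic formulas. -/
theorem Sat.hom_comp (hF : F.IsProper) {A B : Str L F.M} (h : A ⟶ B) {X P : V} {φ : Formula L X}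
    (hφ : φ.IsAtomic) {a : X ⊗ P ⟶ A.carrier} (ha : Sat A φ a) :
    Sat B φ (a ≫ Str.Hom.map h) := by
  revert a
  refine hφ.induction (p := fun {X} φ => ∀ {a : X ⊗ P ⟶ A.carrier}, Sat A φ a →
    Sat B φ (a ≫ Str.Hom.map h)) (fun s t a ha => ?_) (fun R Y t a ha => ?_)
  · rw [sat_eq_iff hF] at ha ⊢
    rw [Str.Hom.val_comp, Str.Hom.val_comp, ha]
  · rw [sat_rel_iff] at ha ⊢
    rw [Str.Hom.val_comp, ← Category.assoc]
    exact Str.Hom.relEl h ha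

/-- Atomic formulas in a power. -/
theorem sat_power_iff (hF : F.IsProper) (K : Str L F.M) (W : V) {X P : V} {φ : Formula L X}
    (hφ : φ.IsAtomic) (a : X ⊗ P ⟶ (K.power hF W).carrier) :
    Sat (K.power hF W) φ a ↔ Sat K φ (K.trEl hF W a) := by
  revert a
  refine hφ.induction (p := fun {X} φ => ∀ a : X ⊗ P ⟶ (K.power hF W).carrier,
    Sat (K.power hF W) φ a ↔ Sat K φ (K.trEl hF W a)) (fun s t a => ?_) (fun R Y t a => ?_)
  · rw [sat_eq_iff hF, sat_eq_iff hF, ← Term.val_power hF, ← Term.val_power hF,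
      Equiv.apply_eq_iff_eq]
  · rw [sat_rel_iff, sat_rel_iff]
    refine (Str.relEl_power_iff hF K W R _).trans ?_
    rw [← Term.val_power hF]
    have h := K.trEl_assoc hF W (t.val (K.power hF W) a)
    refine Iff.trans (iff_of_eq (congrArg (K.RelEl R) h)) ?_
    unfold Str.RelEl
    rw [curry_natural_left]
    exact factors_iso_comp_iff _ _ _

end Sat

end EnrichedLogic

namespace EnrichedLogic

open MonoidalClosed

variable {V : Type u} [Category.{v} V] [MonoidalCategory V] [MonoidalClosed V]
  [SymmetricCategory V] [IsLocallyPresentable.{v} V]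

/-! ### Filtered colimits of structures -/

section Ary

variable {L : Lang.{u, v} V} {κ : Cardinal.{v}} [Fact κ.IsRegular]

theorem Term.IsAry.cod (hV : IsLocallyPresentableAsClosed V κ) {X Y : V} {t : Term L X Y}
    (ht : t.IsAry κ) : IsCardinalPresentable Y κ := by
  induction t with
  | ofHom g => exact ht.2
  | symb f => exact ht.2
  | pow Z t ih => exact hV.tensor _ _ (ih ht.2) ht.1
  | tuple Y t ih => exact isCardinalPresentable_sigma κ ht.2.1 _ (fun j => ih j (ht.2.2 j))
  | comp t s ih₁ ih₂ => exact ih₂ ht.2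

end Ary

section FilteredColimits

variable {L : Lang.{u, v} V} {κ : Cardinal.{v}} [Fact κ.IsRegular]
  {F : EnrichedFactorizationSystem V} (hV : IsLocallyPresentableAsClosed V κ) (hF : F.IsProper)
  (hFκ : F.MClosedUnderFilteredColimits κ) (hL : L.IsAry κ)
  {J : Type v} [SmallCategory J] [IsCardinalFiltered J κ] {D : J ⥤ Str L F.M} {c : Cocone D}
  (hc : IsColimit c)

include hV hF hFκ hL hc

/-- κ-filtered colimits of structures are computed on carriers, so presentable elements of the
colimit come from a stage. -/
theorem exists_carrier_lift {P : V} (hP : IsCardinalPresentable P κ) (y : P ⟶ c.pt.carrier) :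
    ∃ (j : J) (y' : P ⟶ (D.obj j).carrier), y' ≫ Str.Hom.map (c.ι.app j) = y := by
  have := preservesColimitsOfShape_spanFunctor hV hF hFκ hL J
  exact IsCardinalPresentable.exists_hom_of_isColimit κ
    (isColimitOfPreserves (spanFunctor L F.M ⋙ SpanObj.carrierF (strSig L)) hc) y

theorem exists_carrier_eq {P : V} (hP : IsCardinalPresentable P κ) {j : J}
    (a b : P ⟶ (D.obj j).carrier)
    (h : a ≫ Str.Hom.map (c.ι.app j) = b ≫ Str.Hom.map (c.ι.app j)) :
    ∃ (k : J) (w : j ⟶ k), a ≫ Str.Hom.map (D.map w) = b ≫ Str.Hom.map (D.map w) := by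
  have := preservesColimitsOfShape_spanFunctor hV hF hFκ hL J
  exact IsCardinalPresentable.exists_eq_of_isColimit' κ
    (isColimitOfPreserves (spanFunctor L F.M ⋙ SpanObj.carrierF (strSig L)) hc) a b h

/-- The witness of the relation lifts to some stage, but it describes an element there that need
only agree with `a` in the colimit. Since arity ⊗ P is presentable, the two elements become equal at
a later stage. -/
theorem exists_relEl {R : L.Rel} {P : V} (hP : IsCardinalPresentable P κ) {j : J}
    (a : L.arity R ⊗ P ⟶ (D.obj j).carrier)
    (h : c.pt.RelEl R (a ≫ Str.Hom.map (c.ι.app j))) :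
    ∃ (k : J) (w : j ⟶ k), (D.obj k).RelEl R (a ≫ Str.Hom.map (D.map w)) := by
  have := preservesColimitsOfShape_spanFunctor hV hF hFκ hL J
  have := isFiltered_of_isCardinalFiltered J κ
  obtain ⟨l, hl⟩ := h
  obtain ⟨j', l', hl'⟩ : ∃ (j' : J) (l' : P ⟶ (D.obj j').rel R),
      l' ≫ homRel (Str.Hom.toSpan (c.ι.app j')) R = l :=
    IsCardinalPresentable.exists_hom_of_isColimit κ
      (isColimitOfPreserves (spanFunctor L F.M ⋙ SpanObj.compF (strSig L) (Sum.inr R)) hc) l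
  have hrel : homRel (Str.Hom.toSpan (c.ι.app j')) R ≫ c.pt.incl R =
      (D.obj j').incl R ≫ (ihom (L.arity R)).map (Str.Hom.map (c.ι.app j')) :=
    (Str.Hom.rel_lift (c.ι.app j') R).choose_spec
  let a' : L.arity R ⊗ P ⟶ (D.obj j').carrier := uncurry (l' ≫ (D.obj j').incl R)
  have ha' : (D.obj j').RelEl R a' := ⟨l', (curry_uncurry _).symm⟩
  have haa' : a' ≫ Str.Hom.map (c.ι.app j') = a ≫ Str.Hom.map (c.ι.app j) := by
    rw [← uncurry_natural_right, Category.assoc, ← hrel, reassoc_of% hl', hl, uncurry_curry]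
  let u := IsFiltered.leftToMax j j'
  let u' := IsFiltered.rightToMax j j'
  have e : ∀ {j₁ j₂ : J} (w : j₁ ⟶ j₂), Str.Hom.map (D.map w) ≫ Str.Hom.map (c.ι.app j₂) =
      Str.Hom.map (c.ι.app j₁) := fun w => congrArg Str.Hom.map (c.w w)
  obtain ⟨k, w, hw⟩ := exists_carrier_eq hV hF hFκ hL hc
    (hV.tensor _ _ (hL.2.2 R) hP) (a' ≫ Str.Hom.map (D.map u')) (a ≫ Str.Hom.map (D.map u))
    (by rw [Category.assoc, Category.assoc, e, e, haa'])
  refine ⟨k, u ≫ w, ?_⟩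
  have h₁ : a ≫ Str.Hom.map (D.map (u ≫ w)) = a' ≫ Str.Hom.map (D.map (u' ≫ w)) := by
    rw [D.map_comp, D.map_comp]
    simpa using hw.symm
  rw [h₁]
  exact Str.Hom.relEl (D.map (u' ≫ w)) ha'

/-- Atomic formulas satisfied in a filtered colimit are satisfied at some stage. -/
theorem exists_sat {X P : V} {φ : Formula L X} (hφ : φ.IsAtomic) (hφκ : φ.IsAry κ)
    (hP : IsCardinalPresentable P κ) {j : J} (a : X ⊗ P ⟶ (D.obj j).carrier)
    (h : Sat c.pt φ (a ≫ Str.Hom.map (c.ι.app j))) :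
    ∃ (k : J) (w : j ⟶ k), Sat (D.obj k) φ (a ≫ Str.Hom.map (D.map w)) := by
  revert a
  refine hφ.induction (p := fun {X} φ => φ.IsAry κ → ∀ a : X ⊗ P ⟶ (D.obj j).carrier,
    Sat c.pt φ (a ≫ Str.Hom.map (c.ι.app j)) →
      ∃ (k : J) (w : j ⟶ k), Sat (D.obj k) φ (a ≫ Str.Hom.map (D.map w)))
    (fun s t hst a h => ?_) (fun R Y t ht a h => ?_) hφκ
  · rw [sat_eq_iff hF, Str.Hom.val_comp, Str.Hom.val_comp] at h
    obtain ⟨k, w, hw⟩ := exists_carrier_eq hV hF hFκ hL hc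
      (hV.tensor _ _ (hst.1.cod hV) hP) _ _ h
    exact ⟨k, w, by rw [sat_eq_iff hF, Str.Hom.val_comp, Str.Hom.val_comp, hw]⟩
  · rw [sat_rel_iff, Str.Hom.val_comp, ← Category.assoc] at h
    obtain ⟨k, w, hw⟩ := exists_relEl hV hF hFκ hL hc (hV.tensor _ _ ht.2.1 hP) _ h
    exact ⟨k, w, by rwa [sat_rel_iff, Str.Hom.val_comp, ← Category.assoc]⟩

theorem exists_forall_sat {X P : V} {I : Type v} (hI : Cardinal.mk I < κ) {φ : I → Formula L X}
    (hφ : ∀ i, (φ i).IsAtomic) (hφκ : ∀ i, (φ i).IsAry κ)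
    (hP : IsCardinalPresentable P κ) {j : J} (a : X ⊗ P ⟶ (D.obj j).carrier)
    (h : ∀ i, Sat c.pt (φ i) (a ≫ Str.Hom.map (c.ι.app j))) :
    ∃ (k : J) (w : j ⟶ k), ∀ i, Sat (D.obj k) (φ i) (a ≫ Str.Hom.map (D.map w)) := by
  choose k w hw using fun i => exists_sat hV hF hFκ hL hc (hφ i) (hφκ i) hP a (h i)
  -- Each formula holds at its own stage; κ-filteredness gives a common later stage whose maps from
  -- j agree.
  obtain ⟨m, p, q, hpq⟩ := IsCardinalFiltered.wideSpan (κ := κ) w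
    ((hasCardinalLT_iff_cardinal_mk_lt _ _).2 hI)
  refine ⟨m, q, fun i => ?_⟩
  have := (hw i).hom_comp hF (D.map (p i)) (hφ i)
  rw [← hpq i, D.map_comp]
  simpa using this

end FilteredColimits

/-! ### Structures representing conjunctions of atomic formulas -/

section Rep

variable {L : Lang.{u, v} V} {F : EnrichedFactorizationSystem V}

/-- The structure `A` represents the conjunction of a family of formulas, with generic
element `x₀`. -/
structure IsRep (A : Str L F.M) {X : V} {I : Type v} (φ : I → Formula L X)
    (x₀ : X ⟶ A.carrier) : Prop where
  sat : ∀ i, Sat A (φ i) ((ρ_ X).hom ≫ x₀)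
  existsUnique : ∀ (K : Str L F.M) (x : X ⟶ K.carrier),
    (∀ i, Sat K (φ i) ((ρ_ X).hom ≫ x)) → ∃! h : A ⟶ K, x₀ ≫ Str.Hom.map h = x

/-- Evaluation of the hom-object at an element of the source. -/
def homEval {A : Str L F.M} {X : V} (x₀ : X ⟶ A.carrier) (K : Str L F.M) :
    Str.homObj A K ⟶ (ihom X).obj K.carrier :=
  Str.homι A K ≫ (pre x₀).app K.carrier

theorem homPost_homEval {A K N : Str L F.M} {X : V} (x₀ : X ⟶ A.carrier) (f : K ⟶ N) :
    Str.homPost A f ≫ homEval x₀ N = homEval x₀ K ≫ (ihom X).map (Str.Hom.map f) := by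
  rw [homEval, homEval, Str.homPost, ← Category.assoc, Str.homLift_homι, Category.assoc,
    Category.assoc, pre_comm_ihom_map]

theorem homPre_homEval {A B : Str L F.M} {X : V} (x₀ : X ⟶ A.carrier) (g : A ⟶ B)
    (K : Str L F.M) : Str.homPre g K ≫ homEval x₀ K = homEval (x₀ ≫ Str.Hom.map g) K := by
  rw [homEval, homEval, Str.homPre, ← Category.assoc, Str.homLift_homι, Category.assoc,
    ← NatTrans.comp_app, ← pre_map]

theorem uncurry_homEval {A K : Str L F.M} {W X : V} (x₀ : X ⟶ A.carrier)
    (z : W ⟶ (ihom A.carrier).obj K.carrier) :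
    uncurry (z ≫ (pre x₀).app K.carrier) = x₀ ▷ W ≫ uncurry z :=
  uncurry_pre_app _ _ _

variable {A : Str L F.M} {X : V} {I : Type v} {φ : I → Formula L X} {x₀ : X ⟶ A.carrier}

theorem trEl_rightUnitor_tr_symm (hF : F.IsProper) (K : Str L F.M) {W : V}
    (x : X ⊗ W ⟶ K.carrier) :
    K.trEl hF W ((ρ_ X).hom ≫ tr.symm x) = X ◁ (λ_ W).hom ≫ x := by
  refine (tr₂_comp _ _).trans ?_
  rw [Equiv.apply_symm_apply]
  simp

theorem exists_hom_power (hF : F.IsProper) {K : Str L F.M} {W : V} (x₀ : X ⟶ A.carrier)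
    (z : W ⟶ Str.homObj A K) : ∃ g : A ⟶ K.power hF W,
      tr (Str.Hom.map g) = uncurry (z ≫ Str.homι A K) ∧
      x₀ ≫ Str.Hom.map g = tr.symm (uncurry (z ≫ homEval x₀ K)) := by
  obtain ⟨g, hg⟩ := (Str.isHomElement_iff_power hF (z ≫ Str.homι A K)).1
    ((Str.isHomElement_homι A K).comp_left z)
  refine ⟨g, hg, ?_⟩
  rw [Equiv.eq_symm_apply, tr_comp, hg, ← uncurry_homEval, Category.assoc]
  rfl

theorem IsRep.hom_ext (hF : F.IsProper) (h : IsRep A φ x₀) (hφ : ∀ i, (φ i).IsAtomic)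
    {K : Str L F.M} {g g' : A ⟶ K} (hg : x₀ ≫ Str.Hom.map g = x₀ ≫ Str.Hom.map g') : g = g' :=
  (h.existsUnique K (x₀ ≫ Str.Hom.map g') (fun i => by
    have := (h.sat i).hom_comp hF g' (hφ i)
    rwa [Category.assoc] at this)).unique hg rfl

/-- Elements of the hom-object out of a representing structure. -/
theorem IsRep.factors_homEval_iff (hF : F.IsProper) (h : IsRep A φ x₀)
    (hφ : ∀ i, (φ i).IsAtomic) (K : Str L F.M) {W : V} (x : X ⊗ W ⟶ K.carrier) :
    Factors (homEval x₀ K) (curry x) ↔ ∀ i, Sat K (φ i) x := by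
  -- An element of K with parameter W becomes an ordinary element of the power K^W satisfying the
  -- same atomic formulas. The ordinary universal property of A, applied to the power, thus yields
  -- the enriched one.
  have h₁ : (∀ i, Sat K (φ i) x) ↔
      ∀ i, Sat (K.power hF W) (φ i) ((ρ_ X).hom ≫ tr.symm x) := by
    refine forall_congr' (fun i => ?_)
    rw [sat_power_iff hF K W (hφ i)]
    refine Iff.trans (sat_whiskerLeft_iso_iff (λ_ W)).symm ?_
    exact iff_of_eq (congrArg (Sat K (φ i)) (trEl_rightUnitor_tr_symm hF K x).symm)
  rw [h₁]
  constructor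
  · rintro ⟨z, hz⟩ i
    obtain ⟨g, -, hg⟩ := exists_hom_power hF x₀ z
    rw [hz, uncurry_curry] at hg
    rw [← hg]
    have := (h.sat i).hom_comp hF g (hφ i)
    rwa [Category.assoc] at this
  · intro hx
    obtain ⟨g, hg, -⟩ := h.existsUnique (K.power hF W) (tr.symm x) hx
    let z : W ⟶ (ihom A.carrier).obj K.carrier := curry (tr (Str.Hom.map g))
    have hz : Str.IsHomElement z :=
      (Str.isHomElement_iff_power hF z).2 ⟨g, (uncurry_curry _).symm⟩
    refine ⟨Str.homLift z hz, ?_⟩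
    rw [homEval, ← Category.assoc, Str.homLift_homι]
    apply uncurry_injective
    rw [uncurry_homEval, uncurry_curry, uncurry_curry, ← tr_comp, hg, Equiv.apply_symm_apply]

/-- Elements of the hom-object with the same evaluation give morphisms to K^W that agree on the
generic element, so the ordinary uniqueness clause identifies them. -/
theorem IsRep.mono_homEval (hF : F.IsProper) (h : IsRep A φ x₀)
    (hφ : ∀ i, (φ i).IsAtomic) (K : Str L F.M) : Mono (homEval x₀ K) := by
  refine ⟨fun {W} z z' hz => ?_⟩
  obtain ⟨g, hg, hg'⟩ := exists_hom_power hF x₀ z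
  obtain ⟨k, hk, hk'⟩ := exists_hom_power hF x₀ z'
  rw [hz, ← hk'] at hg'
  obtain rfl := h.hom_ext hF hφ hg'
  rw [← cancel_mono (Str.homι A K)]
  exact uncurry_injective (hg.symm.trans hk)

/-- Membership in this subobject is satisfaction of all the formulas, and each of these is E-local.
This permits comparing images in Str(A, K) with images in K^X. -/
theorem IsRep.M_homEval (hF : F.IsProper) (h : IsRep A φ x₀)
    (hφ : ∀ i, (φ i).IsAtomic) (K : Str L F.M) : F.M (homEval x₀ K) := by
  have := h.mono_homEval hF hφ K
  refine EnrichedFactorizationSystem.M_of_mono_of_factors hF _ (fun {P Q} e he b hb => ?_)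
  obtain ⟨x, rfl⟩ : ∃ x, b = curry x := ⟨uncurry b, (curry_uncurry b).symm⟩
  rw [← curry_natural_left] at hb
  rw [h.factors_homEval_iff hF hφ] at hb ⊢
  intro i
  have := hb i
  unfold Sat at this ⊢
  rw [curry_natural_left] at this
  exact EnrichedFactorizationSystem.factors_of_E he (M_interp K hF (φ i)) this

theorem uncurry_homEval_comp {K N : Str L F.M} {P : V} (x₀ : X ⟶ A.carrier) (f : K ⟶ N)
    (a : P ⟶ Str.homObj A K) : uncurry (a ≫ homEval x₀ K) ≫ Str.Hom.map f =
      uncurry ((a ≫ Str.homPost A f) ≫ homEval x₀ N) := by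
  rw [← uncurry_natural_right, Category.assoc, Category.assoc, homPost_homEval]

/-! ### Presentability of representing structures. -/

section Presentable

variable {κ : Cardinal.{v}} [Fact κ.IsRegular]
  (hV : IsLocallyPresentableAsClosed V κ) (hF : F.IsProper)
  (hFκ : F.MClosedUnderFilteredColimits κ) (hL : L.IsAry κ) (h : IsRep A φ x₀)
  (hX : IsCardinalPresentable X κ) (hφ : ∀ i, (φ i).IsAtomic)

include hV hF hFκ hL h hX hφ

/-- The values on the generic variables form an element X ⊗ P of the colimit, which lifts to a
stage; the fewer than κ formulas then hold at a later stage, and they characterize elements of the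
hom-object. -/
theorem IsRep.exists_homObj_lift (hI : Cardinal.mk I < κ) (hφκ : ∀ i, (φ i).IsAry κ)
    {J : Type v} [SmallCategory J] [IsCardinalFiltered J κ] {D : J ⥤ Str L F.M} {c : Cocone D}
    (hc : IsColimit c) {P : V} (hP : IsCardinalPresentable P κ) (y : P ⟶ Str.homObj A c.pt) :
    ∃ (k : J) (y' : P ⟶ Str.homObj A (D.obj k)), y' ≫ Str.homPost A (c.ι.app k) = y := by
  have := h.mono_homEval hF hφ c.pt
  have hx : ∀ i, Sat c.pt (φ i) (uncurry (y ≫ homEval x₀ c.pt)) :=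
    (h.factors_homEval_iff hF hφ _ _).1 ⟨y, (curry_uncurry _).symm⟩
  obtain ⟨j, x', hx'⟩ := exists_carrier_lift hV hF hFκ hL hc (hV.tensor _ _ hX hP)
    (uncurry (y ≫ homEval x₀ c.pt))
  rw [← hx'] at hx
  obtain ⟨k, w, hk⟩ := exists_forall_sat hV hF hFκ hL hc hI hφ hφκ hP x' hx
  obtain ⟨y', hy'⟩ := (h.factors_homEval_iff hF hφ _ _).2 hk
  refine ⟨k, y', ?_⟩
  rw [← cancel_mono (homEval x₀ c.pt)]
  apply uncurry_injective
  refine (uncurry_homEval_comp x₀ (c.ι.app k) y').symm.trans ?_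
  rw [← hx', hy', uncurry_curry, Category.assoc]
  exact congrArg (fun f : D.obj j ⟶ c.pt => x' ≫ Str.Hom.map f) (c.w w)

/-- Evaluation is monic, so equality of elements of hom-objects is a matter of carriers and descends
to a stage there. -/
theorem IsRep.exists_homObj_eq {J : Type v} [SmallCategory J] [IsCardinalFiltered J κ]
    {D : J ⥤ Str L F.M} {c : Cocone D} (hc : IsColimit c) {P : V}
    (hP : IsCardinalPresentable P κ) {j : J} (a b : P ⟶ Str.homObj A (D.obj j))
    (hab : a ≫ Str.homPost A (c.ι.app j) = b ≫ Str.homPost A (c.ι.app j)) :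
    ∃ (k : J) (w : j ⟶ k), a ≫ Str.homPost A (D.map w) = b ≫ Str.homPost A (D.map w) := by
  obtain ⟨k, w, hw⟩ := exists_carrier_eq hV hF hFκ hL hc (hV.tensor _ _ hX hP)
    (j := j) (uncurry (a ≫ homEval x₀ (D.obj j))) (uncurry (b ≫ homEval x₀ (D.obj j)))
    ((uncurry_homEval_comp x₀ (c.ι.app j) a).trans
      ((congrArg (fun k => uncurry (k ≫ homEval x₀ c.pt)) hab).trans
        (uncurry_homEval_comp x₀ (c.ι.app j) b).symm))
  have := h.mono_homEval hF hφ (D.obj k)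
  refine ⟨k, w, ?_⟩
  rw [uncurry_homEval_comp, uncurry_homEval_comp] at hw
  exact (cancel_mono (homEval x₀ (D.obj k))).1 (uncurry_injective hw)

/-- A structure representing a small conjunction is presentable. -/
theorem IsRep.isPresentable (hI : Cardinal.mk I < κ) (hφκ : ∀ i, (φ i).IsAry κ) :
    A.IsPresentable κ where
  preservesColimitOfShape J _ _ := ⟨fun {D} => ⟨fun {c} hc => by
    have := hV.locallyPresentable
    refine nonempty_isColimit_of_presentable κ _ (fun P hP y => ?_) (fun P hP j a b hab => ?_)
    · exact h.exists_homObj_lift hV hF hFκ hL hX hφ hI hφκ hc hP y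
    · exact h.exists_homObj_eq hV hF hFκ hL hX hφ hc hP a b hab⟩⟩

end Presentable

end Rep

end EnrichedLogic

namespace EnrichedLogic

open MonoidalClosed

variable {V : Type u} [Category.{v} V] [MonoidalCategory V] [MonoidalClosed V]
  [SymmetricCategory V] [IsLocallyPresentable.{v} V]

/-! ### Ordinary elements -/

section Eval

variable {L : Lang.{u, v} V} {M : MorphismProperty V}

/-- The value of a term on an ordinary element. -/
def Term.eval (K : Str L M) {X Y : V} (t : Term L X Y) (x : X ⟶ K.carrier) : Y ⟶ K.carrier :=
  (ρ_ Y).inv ≫ t.val K ((ρ_ X).hom ≫ x)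

namespace Term

variable (K : Str L M)

theorem val_rightUnitor {X Y : V} (t : Term L X Y) (x : X ⟶ K.carrier) :
    t.val K ((ρ_ X).hom ≫ x) = (ρ_ Y).hom ≫ t.eval K x := by
  rw [eval, Iso.hom_inv_id_assoc]

theorem eval_ofHom {X Y : V} (g : Y ⟶ X) (x : X ⟶ K.carrier) :
    (Term.ofHom (L := L) g).eval K x = g ≫ x := by
  rw [eval, val_ofHom, rightUnitor_naturality_assoc, Iso.inv_hom_id_assoc]

theorem eval_comp {X Y Z : V} (t : Term L X Y) (s : Term L Y Z) (x : X ⟶ K.carrier) :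
    (Term.comp t s).eval K x = s.eval K (t.eval K x) := by
  rw [eval, val_comp, val_rightUnitor, val_rightUnitor, Iso.inv_hom_id_assoc]

theorem ι_eval_tuple {X : V} {J : Type v} (Y : J → V) (t : ∀ j, Term L X (Y j))
    (x : X ⟶ K.carrier) (j : J) :
    Sigma.ι Y j ≫ (Term.tuple Y t).eval K x = (t j).eval K x := by
  rw [eval, rightUnitor_inv_naturality_assoc, ι_val_tuple]
  rfl

theorem eval_pow_symb (f : L.Fn) (P : V) (x : L.dom f ⊗ P ⟶ K.carrier) :
    (Term.pow P (Term.symb f)).eval K x = K.op f x := by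
  have h : (α_ (L.dom f) P (𝟙_ V)).inv ≫ (ρ_ (L.dom f ⊗ P)).hom ≫ x =
      L.dom f ◁ (ρ_ P).hom ≫ x := by simp
  rw [eval, val_pow, val_symb, h, Str.op_natural]
  simp

end Term

theorem Str.Hom.eval_comp {A B : Str L M} (h : A ⟶ B) {X Y : V} (t : Term L X Y)
    (a : X ⟶ A.carrier) : t.eval B (a ≫ Str.Hom.map h) = t.eval A a ≫ Str.Hom.map h := by
  rw [Term.eval, Term.eval, ← Category.assoc, Str.Hom.val_comp, Category.assoc]

end Eval

/-! ### Satisfaction by ordinary elements, and substitution. -/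

section SatUnit

variable {F : EnrichedFactorizationSystem V} {L : Lang.{u, v} V} {K : Str L F.M}

theorem sat_eq_rightUnitor_iff (hF : F.IsProper) {X Y : V} (s t : Term L X Y)
    (x : X ⟶ K.carrier) :
    Sat K (.eq s t) ((ρ_ X).hom ≫ x) ↔ s.eval K x = t.eval K x := by
  rw [sat_eq_iff hF, Term.val_rightUnitor, Term.val_rightUnitor, cancel_epi]

theorem sat_rel_rightUnitor_iff {Z : V} (R : L.Rel) (Y : V) (t : Term L Z (L.arity R ⊗ Y))
    (x : Z ⟶ K.carrier) :
    Sat K (.rel R Y t) ((ρ_ Z).hom ≫ x) ↔ K.RelEl R (t.eval K x) := by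
  rw [sat_rel_iff, Term.val_rightUnitor]
  have : (α_ (L.arity R) Y (𝟙_ V)).inv ≫ (ρ_ (L.arity R ⊗ Y)).hom ≫ t.eval K x =
      L.arity R ◁ (ρ_ Y).hom ≫ t.eval K x := by simp
  rw [this]
  unfold Str.RelEl
  rw [curry_natural_left]
  exact factors_iso_comp_iff _ _ _

/-- Substitution of variables in an atomic formula. -/
def Formula.subst {X Z : V} (g : X ⟶ Z) : Formula L X → Formula L Z
  | .eq s t => .eq (.comp (.ofHom g) s) (.comp (.ofHom g) t)
  | .rel R Y t => .rel R Y (.comp (.ofHom g) t)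
  -- Substitution is meaningful for atomic formulas only; the remaining clauses return the empty
  -- conjunction as a default value.
  | .conj _ => .conj PEmpty.elim
  | .ex _ _ => .conj PEmpty.elim
  | .disj _ => .conj PEmpty.elim

theorem Formula.IsAtomic.subst {X Z : V} {φ : Formula L X} (hφ : φ.IsAtomic) (g : X ⟶ Z) :
    (φ.subst g).IsAtomic :=
  hφ.induction (p := fun {X} φ => ∀ g : X ⟶ Z, (φ.subst g).IsAtomic)
    (by intros; simp only [Formula.subst, Formula.IsAtomic])
    (by intros; simp only [Formula.subst, Formula.IsAtomic]) g

theorem Formula.IsAry.subst {κ : Cardinal.{v}} [Fact κ.IsRegular] {X Z : V} {φ : Formula L X}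
    (hφ : φ.IsAtomic) (hκ : φ.IsAry κ) (g : X ⟶ Z) (hX : IsCardinalPresentable X κ)
    (hZ : IsCardinalPresentable Z κ) : (φ.subst g).IsAry κ :=
  hφ.induction (p := fun {X} φ => ∀ g : X ⟶ Z, IsCardinalPresentable X κ → φ.IsAry κ →
      (φ.subst g).IsAry κ)
    (by
      intro X Y s t g hX h
      simp only [Formula.subst, Formula.IsAry, Term.IsAry] at h ⊢
      exact ⟨⟨⟨hZ, hX⟩, h.1⟩, ⟨⟨hZ, hX⟩, h.2⟩⟩)
    (by
      intro X R Y t g hX h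
      simp only [Formula.subst, Formula.IsAry, Term.IsAry] at h ⊢
      exact ⟨h.1, h.2.1, ⟨hZ, hX⟩, h.2.2⟩) g hX hκ

theorem sat_subst_iff (hF : F.IsProper) {X Z P : V} {φ : Formula L X} (hφ : φ.IsAtomic)
    (g : X ⟶ Z) (x : Z ⊗ P ⟶ K.carrier) : Sat K (φ.subst g) x ↔ Sat K φ (g ▷ P ≫ x) :=
  hφ.induction (p := fun {X} φ => ∀ g : X ⟶ Z, Sat K (φ.subst g) x ↔ Sat K φ (g ▷ P ≫ x))
    (fun s t g => by
      refine (sat_eq_iff hF _ _ _).trans (Iff.trans ?_ (sat_eq_iff hF s t _).symm)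
      rw [Term.val_comp, Term.val_comp, Term.val_ofHom])
    (fun R Y t g => by
      refine (sat_rel_iff _ _ _ _).trans (Iff.trans ?_ (sat_rel_iff R Y t _).symm)
      rw [Term.val_comp, Term.val_ofHom]) g

theorem sat_subst_rightUnitor_iff (hF : F.IsProper) {X Z : V} {φ : Formula L X} (hφ : φ.IsAtomic)
    (g : X ⟶ Z) (x : Z ⟶ K.carrier) :
    Sat K (φ.subst g) ((ρ_ Z).hom ≫ x) ↔ Sat K φ ((ρ_ X).hom ≫ g ≫ x) := by
  rw [sat_subst_iff hF hφ, rightUnitor_naturality_assoc]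

end SatUnit

/-! ### Existence of representing structures -/

section Existence

variable {L : Lang.{u, v} V} {F : EnrichedFactorizationSystem V} {κ : Cardinal.{v}}
  [Fact κ.IsRegular] (hV : IsLocallyPresentableAsClosed V κ) (hF : F.IsProper) (hL : L.IsAry κ)

include hV hF hL

/-- Free structures. -/
theorem exists_free (X : V) : ∃ (A : Str L F.M) (x₀ : X ⟶ A.carrier),
    IsRep A (PEmpty.elim : PEmpty → Formula L X) x₀ := by
  obtain ⟨A, η, h⟩ := exists_reflection hV hF hL (SpanObj.carrierFree (strSig L) X)
  refine ⟨A, SpanObj.carrierFreeEquiv X _ η, fun i => i.elim, fun K x _ => ?_⟩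
  obtain ⟨ψ, hψ, hu⟩ := h K ((SpanObj.carrierFreeEquiv X _).symm x)
  have e : ∀ g : A ⟶ K, SpanObj.carrierFreeEquiv X _ η ≫ Str.Hom.map g =
      SpanObj.carrierFreeEquiv X _ (η ≫ Str.Hom.toSpan g) := fun g => rfl
  refine ⟨ψ, ?_, fun g hg => hu g ?_⟩
  · exact (e ψ).trans (by rw [hψ, Equiv.apply_symm_apply])
  · beta_reduce at hg ⊢
    rw [Equiv.eq_symm_apply, ← e, hg]

/-- The structures generated by an element of a power of a relation symbol. -/
theorem exists_freeRel (R : L.Rel) (Y : V) : ∃ (A : Str L F.M) (x₀ : L.arity R ⊗ Y ⟶ A.carrier),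
    IsRep A (fun _ : PUnit.{v + 1} => Formula.rel R Y (.ofHom (𝟙 (L.arity R ⊗ Y)))) x₀ := by
  obtain ⟨A, η, h⟩ := exists_reflection hV hF hL (SpanObj.compFree (strSig L) (Sum.inr R) Y)
  let b : ∀ (K : Str L F.M), (SpanObj.compFree (strSig L) (Sum.inr R) Y ⟶ K.toSpan) ≃
    (Y ⟶ K.rel R) := fun K => SpanObj.compFreeEquiv (S := strSig L) (Sum.inr R) Y K.toSpan
  have hb : ∀ {K N : Str L F.M} (φ : SpanObj.compFree (strSig L) (Sum.inr R) Y ⟶ K.toSpan)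
      (g : K ⟶ N), b N (φ ≫ Str.Hom.toSpan g) ≫ N.incl R =
        b K φ ≫ K.incl R ≫ (ihom (L.arity R)).map (Str.Hom.map g) := by
    intro K N φ g
    have e₁ : b N (φ ≫ Str.Hom.toSpan g) = b K φ ≫ homRel (Str.Hom.toSpan g) R :=
      SpanObj.compFreeEquiv_naturality (S := strSig L) _ _ _ _
    have e₂ : homRel (Str.Hom.toSpan g) R ≫ N.incl R =
      K.incl R ≫ (ihom (L.arity R)).map (Str.Hom.map g) := (Str.Hom.rel_lift g R).choose_spec
    rw [e₁, Category.assoc, e₂]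
  have hu : ∀ {K : Str L F.M} (g : A ⟶ K), uncurry (b A η ≫ A.incl R) ≫ Str.Hom.map g =
      uncurry (b K (η ≫ Str.Hom.toSpan g) ≫ K.incl R) := by
    intro K g
    rw [hb, ← uncurry_natural_right, Category.assoc]
  have hsat : ∀ {K : Str L F.M} (x : L.arity R ⊗ Y ⟶ K.carrier),
      Sat K (Formula.rel R Y (.ofHom (𝟙 (L.arity R ⊗ Y)))) ((ρ_ _).hom ≫ x) ↔
        K.RelEl R x := by
    intro K x
    rw [sat_rel_rightUnitor_iff, Term.eval_ofHom, Category.id_comp]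
  refine ⟨A, uncurry (b A η ≫ A.incl R), fun _ => ?_, fun K x hx => ?_⟩
  · rw [hsat]
    exact ⟨b A η, (curry_uncurry _).symm⟩
  · obtain ⟨l, hl⟩ := (hsat x).1 (hx ⟨⟩)
    obtain ⟨ψ, hψ, hu'⟩ := h K ((b K).symm l)
    refine ⟨ψ, ?_, fun g hg => hu' g ?_⟩
    · beta_reduce
      rw [hu, hψ, Equiv.apply_symm_apply, hl, uncurry_curry]
    · have := K.incl_mono R
      beta_reduce at hg ⊢
      rw [Equiv.eq_symm_apply, ← cancel_mono (K.incl R), hl]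
      apply uncurry_injective
      rw [← hu, hg, uncurry_curry]

/-- The two terms name two morphisms from the free structure on Y to the free structure on X, and
imposing the equation means coequalizing them. -/
theorem exists_rep_eq {X Y : V} (s t : Term L X Y) : ∃ (A : Str L F.M) (x₀ : X ⟶ A.carrier),
    IsRep A (fun _ : PUnit.{v + 1} => Formula.eq s t) x₀ := by
  have := hasColimits_str hV hF hL
  obtain ⟨A, a, ha⟩ := exists_free hV hF hL X
  obtain ⟨B, b, hb⟩ := exists_free hV hF hL Y
  obtain ⟨s', hs', -⟩ := hb.existsUnique A (s.eval A a) (fun i => i.elim)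
  obtain ⟨t', ht', -⟩ := hb.existsUnique A (t.eval A a) (fun i => i.elim)
  have key : ∀ {K : Str L F.M} (g : A ⟶ K),
      s.eval K (a ≫ Str.Hom.map g) = t.eval K (a ≫ Str.Hom.map g) ↔ s' ≫ g = t' ≫ g := by
    intro K g
    rw [Str.Hom.eval_comp, Str.Hom.eval_comp, ← hs', ← ht']
    constructor
    · intro e
      exact hb.hom_ext hF (fun i => i.elim) (by simpa using e)
    · intro e
      simpa using congrArg (fun k => b ≫ Str.Hom.map k) e
  refine ⟨coequalizer s' t', a ≫ Str.Hom.map (coequalizer.π s' t'), fun _ => ?_,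
    fun K x hx => ?_⟩
  · rw [sat_eq_rightUnitor_iff hF, key]
    exact coequalizer.condition _ _
  · obtain ⟨g, rfl, hg⟩ := ha.existsUnique K x (fun i => i.elim)
    have e := (key g).1 ((sat_eq_rightUnitor_iff hF s t _).1 (hx ⟨⟩))
    refine ⟨coequalizer.desc g e, ?_, fun g' hg' => ?_⟩
    · beta_reduce
      rw [Category.assoc, ← Str.comp_map, coequalizer.π_desc]
    · apply coequalizer.hom_ext
      rw [coequalizer.π_desc]
      exact ha.hom_ext hF (fun i => i.elim) (by simpa using hg')

/-- The term names a morphism from the free structure on arity ⊗ Y to the one on X. Imposing the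
relation is pushing out along the morphism to the structure generated by an element of the relation.
-/
theorem exists_rep_rel {X : V} (R : L.Rel) (Y : V) (t : Term L X (L.arity R ⊗ Y)) :
    ∃ (A : Str L F.M) (x₀ : X ⟶ A.carrier),
      IsRep A (fun _ : PUnit.{v + 1} => Formula.rel R Y t) x₀ := by
  have := hasColimits_str hV hF hL
  obtain ⟨A, a, ha⟩ := exists_free hV hF hL X
  obtain ⟨B, b, hb⟩ := exists_free hV hF hL (L.arity R ⊗ Y)
  obtain ⟨C, c, hc⟩ := exists_freeRel hV hF hL R Y
  obtain ⟨t', ht', -⟩ := hb.existsUnique A (t.eval A a) (fun i => i.elim)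
  obtain ⟨i, hi, -⟩ := hb.existsUnique C c (fun i => i.elim)
  have hsat : ∀ {K : Str L F.M} (x : L.arity R ⊗ Y ⟶ K.carrier),
      Sat K (Formula.rel R Y (.ofHom (𝟙 (L.arity R ⊗ Y)))) ((ρ_ _).hom ≫ x) ↔
        K.RelEl R x := by
    intro K x
    rw [sat_rel_rightUnitor_iff, Term.eval_ofHom, Category.id_comp]
  have hc' : C.RelEl R c := (hsat c).1 (hc.sat ⟨⟩)
  have key : ∀ {K : Str L F.M} (g : A ⟶ K),
      t.eval K (a ≫ Str.Hom.map g) = b ≫ Str.Hom.map (t' ≫ g) := by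
    intro K g
    rw [Str.Hom.eval_comp, ← ht']
    simp
  refine ⟨pushout t' i, a ≫ Str.Hom.map (pushout.inl t' i), fun _ => ?_, fun K x hx => ?_⟩
  · rw [sat_rel_rightUnitor_iff, key, pushout.condition, Str.comp_map, ← Category.assoc, hi]
    exact Str.Hom.relEl _ hc'
  · obtain ⟨g, rfl, hg⟩ := ha.existsUnique K x (fun i => i.elim)
    have e := (sat_rel_rightUnitor_iff R Y t _).1 (hx ⟨⟩)
    obtain ⟨g₂, hg₂, hu₂⟩ := hc.existsUnique K _ (fun _ => (hsat _).2 e)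
    have w : t' ≫ g = i ≫ g₂ := hb.hom_ext hF (fun i => i.elim) (by
      rw [← key, Str.comp_map, ← Category.assoc, hi, hg₂])
    refine ⟨pushout.desc g g₂ w, ?_, fun g' hg' => ?_⟩
    · beta_reduce
      rw [Category.assoc, ← Str.comp_map, pushout.inl_desc]
    · have e₁ : pushout.inl t' i ≫ g' = g := ha.hom_ext hF (fun i => i.elim) (by simpa using hg')
      apply pushout.hom_ext
      · rw [pushout.inl_desc, e₁]
      · rw [pushout.inr_desc]
        refine hu₂ _ ?_
        rw [key, ← e₁, pushout.condition_assoc, Str.comp_map, ← hi]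
        simp

theorem exists_rep_atomic {X : V} {φ : Formula L X} (hφ : φ.IsAtomic) :
    ∃ (A : Str L F.M) (x₀ : X ⟶ A.carrier), IsRep A (fun _ : PUnit.{v + 1} => φ) x₀ :=
  hφ.induction (p := fun {X} φ => ∃ (A : Str L F.M) (x₀ : X ⟶ A.carrier),
    IsRep A (fun _ : PUnit.{v + 1} => φ) x₀) (fun s t => exists_rep_eq hV hF hL s t)
    (fun R Y t => exists_rep_rel hV hF hL R Y t)

/-- Conjunctions of atomic formulas are representable. -/
theorem exists_rep {X : V} {I : Type v} {φ : I → Formula L X} (hφ : ∀ i, (φ i).IsAtomic) :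
    ∃ (A : Str L F.M) (x₀ : X ⟶ A.carrier), IsRep A φ x₀ := by
  have := hasColimits_str hV hF hL
  obtain ⟨A, a, ha⟩ := exists_free hV hF hL X
  choose B b hb using fun i => exists_rep_atomic hV hF hL (hφ i)
  choose g hg _ using fun i => ha.existsUnique (B i) (b i) (fun i => i.elim)
  -- The conjuncts share their variables, so their representing structures are glued under the free
  -- structure on X.
  refine ⟨widePushout A B g, a ≫ Str.Hom.map (WidePushout.head g), fun i => ?_,
    fun K x hx => ?_⟩
  · have e : a ≫ Str.Hom.map (WidePushout.head g) = b i ≫ Str.Hom.map (WidePushout.ι g i) := by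
      rw [← WidePushout.arrow_ι g i, Str.comp_map, ← Category.assoc, hg]
    rw [e, ← Category.assoc]
    exact ((hb i).sat ⟨⟩).hom_comp hF _ (hφ i)
  · obtain ⟨h, hh, hu⟩ := ha.existsUnique K x (fun i => i.elim)
    choose k hk hku using fun i => (hb i).existsUnique K x (fun _ => hx i)
    have w : ∀ i, g i ≫ k i = h := fun i => hu _ (by
      simp only [Str.comp_map]
      rw [← Category.assoc, hg, hk])
    refine ⟨WidePushout.desc h k w, ?_, fun h' hh' => ?_⟩
    · simp only
      rw [Category.assoc, ← Str.comp_map, WidePushout.head_desc, hh]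
    · have e₁ : WidePushout.head g ≫ h' = h := hu _ (by simpa using hh')
      refine WidePushout.hom_ext _ _ _ (fun i => ?_) ?_
      · rw [WidePushout.ι_desc]
        refine hku i _ ?_
        simp only
        rw [Str.comp_map, ← hg, Category.assoc, ← Str.comp_map, ← Str.comp_map,
          WidePushout.arrow_ι_assoc, e₁, hh]
      · rw [WidePushout.head_desc, e₁]

end Existence

end EnrichedLogic

namespace EnrichedLogic

open MonoidalClosed

variable {V : Type u} [Category.{v} V] [MonoidalCategory V] [MonoidalClosed V]
  [SymmetricCategory V] [IsLocallyPresentable.{v} V]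

/-! ### Presentable structures in the ordinary sense -/

section

variable {L : Lang.{u, v} V} {M : MorphismProperty V}

theorem isHomElement_unit_iff {A K : Str L M} (m : A.carrier ⟶ K.carrier) :
    Str.IsHomElement (curry ((ρ_ A.carrier).hom ≫ m)) ↔ ∃ h : A ⟶ K, Str.Hom.map h = m := by
  have e : ∀ {X P : V} (a : X ⊗ P ⟶ A.carrier),
      (α_ X P (𝟙_ V)).inv ≫ a ▷ 𝟙_ V ≫ uncurry (curry ((ρ_ A.carrier).hom ≫ m)) =
        X ◁ (ρ_ P).hom ≫ a ≫ m := by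
    intro X P a
    rw [uncurry_curry, rightUnitor_naturality_assoc]
    simp
  have hrel : ∀ {R : L.Rel} {P : V} (x : L.arity R ⊗ P ⟶ K.carrier),
      K.RelEl R (L.arity R ◁ (ρ_ P).hom ≫ x) ↔ K.RelEl R x := by
    intro R P x
    unfold Str.RelEl
    rw [curry_natural_left]
    exact factors_iso_comp_iff _ _ _
  rw [Str.isHomElement_iff]
  constructor
  · rintro ⟨h₁, h₂⟩
    refine ⟨Str.homOfEl m (fun f P a => ?_) (fun R P a ha => ?_), rfl⟩
    · have := h₁ f P a
      rw [e, e, Str.op_natural, cancel_epi] at this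
      exact this
    · have := h₂ R P a ha
      rwa [e, hrel] at this
  · rintro ⟨h, rfl⟩
    refine ⟨fun f P a => ?_, fun R P a ha => ?_⟩
    · rw [e, e, Str.op_natural, Str.Hom.op_comp]
    · rw [e, hrel]
      exact Str.Hom.relEl h ha

/-- The global element of the hom-object given by a morphism of structures. -/
def homElement {A K : Str L M} (h : A ⟶ K) : 𝟙_ V ⟶ Str.homObj A K :=
  Str.homLift _ ((isHomElement_unit_iff (Str.Hom.map h)).2 ⟨h, rfl⟩)

theorem homElement_homι {A K : Str L M} (h : A ⟶ K) :
    homElement h ≫ Str.homι A K = curry ((ρ_ A.carrier).hom ≫ Str.Hom.map h) :=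
  Str.homLift_homι _ _

theorem bijective_homElement (A K : Str L M) :
    Function.Bijective (homElement : (A ⟶ K) → (𝟙_ V ⟶ Str.homObj A K)) := by
  refine ⟨fun h k e => Str.Hom.ext ?_, fun z => ?_⟩
  · have e' := congrArg (· ≫ Str.homι A K) e
    simp only [homElement_homι] at e'
    exact (cancel_epi (ρ_ A.carrier).hom).1 (curry_injective e')
  · have h := (Str.isHomElement_homι A K).comp_left z
    have e : curry ((ρ_ A.carrier).hom ≫ (ρ_ A.carrier).inv ≫ uncurry (z ≫ Str.homι A K)) =
        z ≫ Str.homι A K := by rw [Iso.hom_inv_id_assoc, curry_uncurry]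
    rw [← e, isHomElement_unit_iff] at h
    obtain ⟨h, hh⟩ := h
    exact ⟨h, by rw [← cancel_mono (Str.homι A K), homElement_homι, hh, e]⟩

/-- Morphisms of structures are the global elements of the hom-object. -/
def homEquiv (A K : Str L M) : (A ⟶ K) ≃ (𝟙_ V ⟶ Str.homObj A K) :=
  Equiv.ofBijective homElement (bijective_homElement A K)

theorem homElement_comp {A K N : Str L M} (h : A ⟶ K) (f : K ⟶ N) :
    homElement (h ≫ f) = homElement h ≫ Str.homPost A f := by
  rw [← cancel_mono (Str.homι A N), homElement_homι, Category.assoc, Str.homPost,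
    Str.homLift_homι, ← Category.assoc, homElement_homι, ← curry_natural_right, Category.assoc,
    Str.comp_map]

theorem homEquiv_symm_naturality {A K N : Str L M} (z : 𝟙_ V ⟶ Str.homObj A K) (f : K ⟶ N) :
    (homEquiv A N).symm (z ≫ Str.homPost A f) = (homEquiv A K).symm z ≫ f := by
  rw [Equiv.symm_apply_eq]
  exact (congrArg (· ≫ Str.homPost A f) ((homEquiv A K).apply_symm_apply z)).symm.trans
    (homElement_comp _ f).symm

/-- Morphisms of structures are the global elements of the hom-object, and the unit is presentable,
so enriched presentability implies the ordinary one. -/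
theorem Str.IsPresentable.isCardinalPresentable {κ : Cardinal.{v}} [Fact κ.IsRegular]
    (hV : IsLocallyPresentableAsClosed V κ) {A : Str L M} (hA : A.IsPresentable κ) :
    IsCardinalPresentable A κ := by
  have : (Str.homFunctor A).IsCardinalAccessible κ := hA
  have : IsCardinalPresentable (𝟙_ V) κ := hV.unit
  exact Functor.isCardinalAccessible_of_natIso
    (F := Str.homFunctor A ⋙ coyoneda.obj (Opposite.op (𝟙_ V)))
    (G := coyoneda.obj (Opposite.op A))
    (NatIso.ofComponents (fun K => (homEquiv A K).symm.toIso) (fun {K N} f => by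
      ext z
      exact homEquiv_symm_naturality z f)) κ

/-- A morphism of structures is an isomorphism if it is on carriers and relations. -/
theorem Str.isIso_of_components {A B : Str L M} (f : A ⟶ B) (h : IsIso (Str.Hom.map f))
    (h' : ∀ R, ∃ r : B.rel R ⟶ A.rel R,
      r ≫ A.incl R ≫ (ihom (L.arity R)).map (Str.Hom.map f) = B.incl R) : IsIso f := by
  let g : B ⟶ A :=
    { map := inv (Str.Hom.map f)
      fn_comm s := by
        rw [Functor.map_inv, Functor.map_inv, IsIso.inv_comp_eq, ← Category.assoc,
          IsIso.eq_comp_inv]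
        exact (Str.Hom.fn_comm f s).symm
      rel_lift R := by
        obtain ⟨r, hr⟩ := h' R
        refine ⟨r, ?_⟩
        rw [Functor.map_inv, IsIso.eq_comp_inv, Category.assoc, hr] }
  exact ⟨g, Str.Hom.ext (IsIso.hom_inv_id _), Str.Hom.ext (IsIso.inv_hom_id _)⟩

end

/-! ### Generators for the presentable structures. -/

section Generator

variable {L : Lang.{u, v} V} {F : EnrichedFactorizationSystem V} {κ : Cardinal.{v}}
  [Fact κ.IsRegular]

theorem sat_rel_ofHom_id_iff {K : Str L F.M} {R : L.Rel} {Y : V}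
    (x : L.arity R ⊗ Y ⟶ K.carrier) :
    Sat K (Formula.rel R Y (.ofHom (𝟙 (L.arity R ⊗ Y)))) ((ρ_ _).hom ≫ x) ↔ K.RelEl R x := by
  rw [sat_rel_rightUnitor_iff, Term.eval_ofHom, Category.id_comp]

/-- Free structures detect elements of carriers, which gives invertibility there; structures
generated by an element of a relation then detect the relations, which the carrier alone does not
see. -/
theorem isStrongGenerator_of_rep (hV : IsLocallyPresentableAsClosed V κ) (hF : F.IsProper)
    (P : ObjectProperty (Str L F.M))
    (h₁ : ∀ X : V, IsCardinalPresentable X κ → ∃ (A : Str L F.M) (x₀ : X ⟶ A.carrier),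
      IsRep A (PEmpty.elim : PEmpty → Formula L X) x₀ ∧ P A)
    (h₂ : ∀ (R : L.Rel) (Y : V), IsCardinalPresentable Y κ →
      ∃ (A : Str L F.M) (x₀ : L.arity R ⊗ Y ⟶ A.carrier),
        IsRep A (fun _ : PUnit.{v + 1} => Formula.rel R Y (.ofHom (𝟙 (L.arity R ⊗ Y)))) x₀ ∧
          P A) : P.IsStrongGenerator := by
  have := hV.locallyPresentable
  have hG := isStrongGenerator_isCardinalPresentable (V := V) κ
  obtain ⟨Q⟩ := nonempty_presentableRep (V := V) κ
  rw [ObjectProperty.isStrongGenerator_iff]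
  constructor
  · intro A B f g hfg
    refine Str.Hom.ext (hG.isSeparating _ _ (fun X hX x => ?_))
    obtain ⟨C, c, hC, hPC⟩ := h₁ X hX
    obtain ⟨h, rfl, -⟩ := hC.existsUnique A x (fun i => i.elim)
    have := congrArg (fun k => c ≫ Str.Hom.map k) (hfg C hPC h)
    simpa using this
  · intro A B f hf hs
    have hmap : IsIso (Str.Hom.map f) := by
      refine Q.isIso _ (fun i => ⟨fun a b hab => ?_, fun y => ?_⟩)
      · obtain ⟨C, c, hC, hPC⟩ := h₁ _ (Q.presentable i)
        obtain ⟨h, rfl, -⟩ := hC.existsUnique A a (fun i => i.elim)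
        obtain ⟨k, rfl, -⟩ := hC.existsUnique A b (fun i => i.elim)
        have e : h ≫ f = k ≫ f := hC.hom_ext hF (fun i => i.elim) (by simpa using hab)
        rw [cancel_mono] at e
        rw [e]
      · obtain ⟨C, c, hC, hPC⟩ := h₁ _ (Q.presentable i)
        obtain ⟨h, rfl, -⟩ := hC.existsUnique B y (fun i => i.elim)
        obtain ⟨k, rfl⟩ := hs C hPC h
        exact ⟨c ≫ Str.Hom.map k, by simp⟩
    refine Str.isIso_of_components f hmap (fun R => ?_)
    obtain ⟨r, hr⟩ := Str.Hom.rel_lift f R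
    have hA := A.incl_mono R
    have hB := B.incl_mono R
    have : IsIso r := by
      refine Q.isIso _ (fun i => ⟨fun a b hab => ?_, fun y => ?_⟩)
      · have := congrArg (· ≫ B.incl R) hab
        simp only [Category.assoc, hr] at this
        rw [← Category.assoc, ← Category.assoc, cancel_mono, cancel_mono] at this
        exact this
      · obtain ⟨C, c, hC, hPC⟩ := h₂ R _ (Q.presentable i)
        have hy : B.RelEl R (uncurry (y ≫ B.incl R)) := ⟨y, (curry_uncurry _).symm⟩
        obtain ⟨h, hh, -⟩ := hC.existsUnique B _ (fun _ => (sat_rel_ofHom_id_iff _).2 hy)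
        obtain ⟨k, rfl⟩ := hs C hPC h
        have hc : C.RelEl R c := (sat_rel_ofHom_id_iff c).1 (hC.sat ⟨⟩)
        obtain ⟨l, hl⟩ := Str.Hom.relEl k hc
        refine ⟨l, ?_⟩
        rw [← cancel_mono (B.incl R)]
        beta_reduce
        rw [Category.assoc, hr, reassoc_of% hl, ← curry_natural_right, Category.assoc,
          ← Str.comp_map, hh, curry_uncurry]
    exact ⟨inv r, by rw [← hr, IsIso.inv_hom_id_assoc]⟩

theorem isAry_rel_ofHom_id (hV : IsLocallyPresentableAsClosed V κ) (hL : L.IsAry κ) (R : L.Rel)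
    {Y : V} (hY : IsCardinalPresentable Y κ) :
    (Formula.rel R Y (.ofHom (𝟙 (L.arity R ⊗ Y))) : Formula L _).IsAry κ := by
  have := hL.2.2 R
  have := hV.tensor _ _ this hY
  simp only [Formula.IsAry, Term.IsAry]
  exact ⟨hL.2.2 R, hY, this, this⟩

/-- The presentable structures are contained in every class which contains the structures
generated by elements and by elements of relations, and is closed under small colimits. -/
theorem isPresentable_induction (hV : IsLocallyPresentableAsClosed V κ) (hF : F.IsProper)
    (hFκ : F.MClosedUnderFilteredColimits κ) (hL : L.IsAry κ)
    (T : ObjectProperty (Str L F.M)) [T.IsClosedUnderIsomorphisms]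
    (h₁ : ∀ (X : V) (A : Str L F.M) (x₀ : X ⟶ A.carrier), IsCardinalPresentable X κ →
      IsRep A (PEmpty.elim : PEmpty → Formula L X) x₀ → T A)
    (h₂ : ∀ (R : L.Rel) (Y : V) (A : Str L F.M) (x₀ : L.arity R ⊗ Y ⟶ A.carrier),
      IsCardinalPresentable Y κ →
        IsRep A (fun _ : PUnit.{v + 1} => Formula.rel R Y (.ofHom (𝟙 (L.arity R ⊗ Y)))) x₀ →
          T A)
    (h₃ : ∀ (J : Type v) [SmallCategory J], HasCardinalLT (Arrow J) κ →
      T.IsClosedUnderColimitsOfShape J) {A : Str L F.M} (hA : A.IsPresentable κ) : T A := by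
  have := hV.locallyPresentable
  have := hasColimits_str hV hF hL
  obtain ⟨Q⟩ := nonempty_presentableRep (V := V) κ
  choose G g hG using fun i => exists_free (F := F) hV hF hL (Q.obj i)
  choose H h hH using fun i : L.Rel × Q.ι => exists_freeRel (F := F) hV hF hL i.1 (Q.obj i.2)
  -- Only representatives of the presentable arities are used; a generic element on another arity is
  -- transported along an isomorphism.
  let P : ObjectProperty (Str L F.M) := ObjectProperty.ofObj (Sum.elim G H)
  have hP : P.IsStrongGenerator := by
    refine isStrongGenerator_of_rep (κ := κ) hV hF P (fun X hX => ?_) (fun R Y hY => ?_)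
    · obtain ⟨i, ⟨e⟩⟩ := Q.exists_iso X hX
      refine ⟨G i, e.hom ≫ g i, ⟨fun i => i.elim, fun K x _ => ?_⟩,
        ObjectProperty.ofObj_apply _ (Sum.inl i)⟩
      obtain ⟨k, hk, hu⟩ := (hG i).existsUnique K (e.inv ≫ x) (fun i => i.elim)
      exact ⟨k, by simp [hk], fun k' hk' => hu k' (by simp [← hk'])⟩
    · obtain ⟨i, ⟨e⟩⟩ := Q.exists_iso Y hY
      have he : ∀ {K : Str L F.M} (x : L.arity R ⊗ Q.obj i ⟶ K.carrier),
          K.RelEl R (L.arity R ◁ e.hom ≫ x) ↔ K.RelEl R x := by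
        intro K x
        unfold Str.RelEl
        rw [curry_natural_left]
        exact factors_iso_comp_iff _ _ _
      refine ⟨H (R, i), L.arity R ◁ e.hom ≫ h (R, i), ⟨fun _ => ?_, fun K x hx => ?_⟩,
        ObjectProperty.ofObj_apply _ (Sum.inr (R, i))⟩
      · rw [sat_rel_ofHom_id_iff, he, ← sat_rel_ofHom_id_iff]
        exact (hH (R, i)).sat ⟨⟩
      · have hx' := hx ⟨⟩
        rw [sat_rel_ofHom_id_iff] at hx'
        have e₁ : x = L.arity R ◁ e.hom ≫ L.arity R ◁ e.inv ≫ x := by simp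
        rw [e₁, he, ← sat_rel_ofHom_id_iff] at hx'
        obtain ⟨k, hk, hu⟩ := (hH (R, i)).existsUnique K (L.arity R ◁ e.inv ≫ x) (fun _ => hx')
        exact ⟨k, by simp [hk], fun k' hk' => hu k' (by simp [← hk'])⟩
  have hP' : P ≤ isCardinalPresentable (Str L F.M) κ := by
    rintro _ ⟨i⟩
    refine Str.IsPresentable.isCardinalPresentable hV ?_
    have hlt : ∀ n : ℕ, (n : Cardinal.{v}) < κ := fun n =>
      (Cardinal.natCast_lt_aleph0).trans_le (Cardinal.IsRegular.aleph0_le Fact.out)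
    rcases i with i | ⟨R, i⟩
    · exact (hG i).isPresentable hV hF hFκ hL (Q.presentable i)
        (fun i => i.elim) (by simpa using hlt 0) (fun i => i.elim)
    · exact (hH (R, i)).isPresentable hV hF hFκ hL
        (hV.tensor _ _ (hL.2.2 R) (Q.presentable i))
        (fun _ => by simp only [Formula.IsAtomic]) (by simpa using hlt 1)
        (fun _ => isAry_rel_ofHom_id hV hL R (Q.presentable i))
  have hPT : P ≤ T := by
    rintro _ ⟨i⟩
    rcases i with i | ⟨R, i⟩
    · exact h₁ _ _ _ (Q.presentable i) (hG i)
    · exact h₂ _ _ _ _ (Q.presentable i) (hH (R, i))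
  have hA' : isCardinalPresentable (Str L F.M) κ A :=
    Str.IsPresentable.isCardinalPresentable hV hA
  -- The presentable objects are exactly the closure under κ-small colimits of a strong generator of
  -- presentable objects.
  rw [IsStrongGenerator.colimitsCardinalClosure_eq_isCardinalPresentable hP hP'] at hA'
  exact P.colimitsCardinalClosure_le κ h₃ hPT _ hA'

end Generator

end EnrichedLogic

namespace EnrichedLogic

open MonoidalClosed

variable {V : Type u} [Category.{v} V] [MonoidalCategory V] [MonoidalClosed V]
  [SymmetricCategory V] [IsLocallyPresentable.{v} V]

/-! ### Substructures generated by terms -/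

section TermGiven

variable {L : Lang.{u, v} V} {M : MorphismProperty V} (κ : Cardinal.{v}) [Fact κ.IsRegular]

/-- The element `y` is the value at `x₀` of a term of `L_{κκ}`. -/
def TermGiven {A : Str L M} {X P : V} (x₀ : X ⟶ A.carrier) (y : P ⟶ A.carrier) : Prop :=
  ∃ t : Term L X P, t.IsAry κ ∧ t.eval A x₀ = y

/-- Every small element is locally the value of a term at `x₀`. -/
def Lifts {A : Str L M} {X : V} (x₀ : X ⟶ A.carrier) : Prop :=
  ∀ (Y : V) (y : Y ⟶ A.carrier), IsCardinalPresentable Y κ →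
    ∃ (P : V) (e : P ⟶ Y), Epi e ∧ TermGiven κ x₀ (e ≫ y)

variable {κ} {A : Str L M} {X : V} {x₀ : X ⟶ A.carrier}

theorem TermGiven.comp_left {P P' : V} {y : P ⟶ A.carrier} (h : TermGiven κ x₀ y) (p : P' ⟶ P)
    (hP : IsCardinalPresentable P κ) (hP' : IsCardinalPresentable P' κ) :
    TermGiven κ x₀ (p ≫ y) := by
  obtain ⟨t, ht, rfl⟩ := h
  refine ⟨.comp t (.ofHom p), ?_, by rw [Term.eval_comp, Term.eval_ofHom]⟩
  simp only [Term.IsAry]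
  exact ⟨ht, hP, hP'⟩

theorem termGiven_self (hX : IsCardinalPresentable X κ) : TermGiven κ x₀ x₀ := by
  refine ⟨.ofHom (𝟙 X), ?_, by rw [Term.eval_ofHom, Category.id_comp]⟩
  simp only [Term.IsAry]
  exact ⟨hX, hX⟩

theorem TermGiven.op {P : V} (hL : L.IsAry κ) (hP : IsCardinalPresentable P κ) (f : L.Fn)
    {y : L.dom f ⊗ P ⟶ A.carrier} (h : TermGiven κ x₀ y) : TermGiven κ x₀ (A.op f y) := by
  obtain ⟨t, ht, rfl⟩ := h
  refine ⟨.comp t (.pow P (.symb f)), ?_, by rw [Term.eval_comp, Term.eval_pow_symb]⟩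
  simp only [Term.IsAry]
  exact ⟨ht, hP, hL.1 f, hL.2.1 f⟩

theorem TermGiven.desc (hX : IsCardinalPresentable X κ) {J : Type v} (hJ : Cardinal.mk J < κ)
    {Y : J → V} {y : ∀ j, Y j ⟶ A.carrier} (h : ∀ j, TermGiven κ x₀ (y j)) :
    TermGiven κ x₀ (Sigma.desc y) := by
  choose t ht hty using h
  refine ⟨.tuple Y t, ?_, Sigma.hom_ext _ _ (fun j => by
    rw [Term.ι_eval_tuple, hty, Sigma.ι_desc])⟩
  simp only [Term.IsAry]
  exact ⟨hX, hJ, ht⟩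

end TermGiven

section Substructure

variable {L : Lang.{u, v} V} {F F₀ : EnrichedFactorizationSystem V} {κ : Cardinal.{v}}
  [Fact κ.IsRegular] (hV : IsLocallyPresentableAsClosed V κ)
  (hF₀ : F₀.IsProper) {G : Set V} (hG : F₀.IsGenerator κ G) (hG' : ∀ Y ∈ G, F₀.IsProjective Y)

/-- Maps out of X ⊗ P are maps from P to the power by X, and stability keeps the powered map in E₀.
-/
theorem isProjective_tensor {X P : V} (hX : F₀.IsStable X) (hP : F₀.IsProjective P) :
    F₀.IsProjective (X ⊗ P) := by
  intro A B e he b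
  obtain ⟨a, ha⟩ := hP _ (hX e he) (curry b)
  refine ⟨uncurry a, ?_⟩
  beta_reduce at ha ⊢
  rw [← uncurry_natural_right, ha, uncurry_curry]

theorem sat_of_mono (hF : F.IsProper) {A B : Str L F.M} (i : B ⟶ A) [Mono (Str.Hom.map i)]
    (hi : ∀ (R : L.Rel) (P : V) (a : L.arity R ⊗ P ⟶ B.carrier),
      A.RelEl R (a ≫ Str.Hom.map i) → B.RelEl R a) {X P : V} {φ : Formula L X}
    (hφ : φ.IsAtomic) {a : X ⊗ P ⟶ B.carrier} (h : Sat A φ (a ≫ Str.Hom.map i)) :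
    Sat B φ a := by
  revert a
  refine hφ.induction (p := fun {X} φ => ∀ {a : X ⊗ P ⟶ B.carrier},
    Sat A φ (a ≫ Str.Hom.map i) → Sat B φ a) (fun s t a h => ?_) (fun R Y t a h => ?_)
  · rw [sat_eq_iff hF, Str.Hom.val_comp, Str.Hom.val_comp, cancel_mono] at h
    rwa [sat_eq_iff hF]
  · rw [sat_rel_iff, Str.Hom.val_comp, ← Category.assoc] at h
    rw [sat_rel_iff]
    exact hi _ _ _ h

include hV hF₀

/-- S is the E₀-image of the coproduct of all term-given presentable elements. Projectivity lifts an
element of S to the coproduct, and presentability then places it in a subcoproduct of fewer than κ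
summands. -/
theorem exists_termGenerated {A : Str L F.M} {X : V} (x₀ : X ⟶ A.carrier)
    (hX : IsCardinalPresentable X κ) : ∃ (S : V) (m : S ⟶ A.carrier), F₀.M m ∧
      (∀ (P : V) (y : P ⟶ A.carrier), IsCardinalPresentable P κ → TermGiven κ x₀ y →
        Factors m y) ∧
      ∀ (P : V) (y : P ⟶ S), IsCardinalPresentable P κ → F₀.IsProjective P →
        TermGiven κ x₀ (y ≫ m) := by
  have := hV.locallyPresentable
  obtain ⟨Q⟩ := nonempty_presentableRep (V := V) κ
  let ι := Σ i : Q.ι, { p : Q.obj i ⟶ A.carrier // TermGiven κ x₀ p }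
  let q : (∐ fun i : ι => Q.obj i.1) ⟶ A.carrier := Sigma.desc (fun i => i.2.1)
  refine ⟨F₀.image q, F₀.imageι q, F₀.M_imageι q, fun P y hP hy => ?_, fun P y hP hP' => ?_⟩
  · obtain ⟨i, ⟨e⟩⟩ := Q.exists_iso P hP
    let k : ι := ⟨i, e.inv ≫ y, hy.comp_left e.inv hP (Q.presentable i)⟩
    refine ⟨e.hom ≫ Sigma.ι (fun i : ι => Q.obj i.1) k ≫ F₀.toImage q, ?_⟩
    rw [Category.assoc, Category.assoc, F₀.toImage_imageι, Sigma.ι_desc]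
    simp [k]
  · obtain ⟨z, rfl⟩ := hP' _ (F₀.E_toImage q) y
    obtain ⟨T, hT, z', rfl⟩ := exists_subcoproduct κ (fun i : ι => Q.obj i.1) hP z
    beta_reduce
    rw [Category.assoc, Category.assoc, F₀.toImage_imageι]
    -- On the small subcoproduct the chosen terms combine into one tuple, so the element is the
    -- value of a single term of the language.
    have e : Sigma.desc (fun i : T => Sigma.ι (fun i : ι => Q.obj i.1) i) ≫ q =
        Sigma.desc (fun i : T => i.1.2.1) := Sigma.hom_ext _ _ (fun i => by
      rw [Sigma.ι_desc_assoc, Sigma.ι_desc, Sigma.ι_desc])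
    rw [e]
    exact (TermGiven.desc hX hT (fun i : T => i.1.2.2)).comp_left z'
      (isCardinalPresentable_sigma κ hT _ (fun i => Q.presentable _)) hP

include hG hG'

theorem exists_projective_cover (Z : V) :
    ∃ (ι : Type v) (Q : ι → V) (q : ∀ i, Q i ⟶ Z), (∀ i, IsCardinalPresentable (Q i) κ) ∧
      (∀ i, F₀.IsProjective (Q i)) ∧ F₀.E (Sigma.desc q) := by
  have := hV.locallyPresentable
  obtain ⟨ι, Q, q, hQ, hq⟩ := exists_E_cover hF₀ κ Z
  choose P hP e he using fun i => hG.2 (Q i) (hQ i)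
  refine ⟨ι, P, fun i => e i ≫ q i, fun i => hG.1 _ (hP i), fun i => hG' _ (hP i), ?_⟩
  have h := F₀.E_comp _ _ (EnrichedFactorizationSystem.E_sigmaMap hF₀ P Q e he) hq
  have e' : Limits.Sigma.map e ≫ Sigma.desc q = Sigma.desc (fun i => e i ≫ q i) :=
    Sigma.hom_ext _ _ (fun i => by simp)
  rwa [e'] at h

/-- Closure under a function symbol is a factorization through a right-class map of F₀, hence can be
tested on a cover of the power of S by presentable projectives. Relations are restricted so that the
inclusion reflects them. -/
theorem exists_substructure (hF : F.IsProper) (A : Str L F.M) {S : V} (m : S ⟶ A.carrier)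
    (hm : F₀.M m) (hop : ∀ (f : L.Fn) (P : V) (a : L.dom f ⊗ P ⟶ S),
      IsCardinalPresentable P κ → F₀.IsProjective P → Factors m (A.op f (a ≫ m))) :
    ∃ (B : Str L F.M) (i : B ⟶ A), Mono (Str.Hom.map i) ∧
      (∀ (P : V) (y : P ⟶ A.carrier), Factors (Str.Hom.map i) y ↔ Factors m y) ∧
      ∀ (R : L.Rel) (P : V) (a : L.arity R ⊗ P ⟶ B.carrier),
        A.RelEl R (a ≫ Str.Hom.map i) → B.RelEl R a := by
  have hmono := hF₀.mono _ hm
  have hfn : ∀ f : L.Fn, Factors ((ihom (L.cod f)).map m)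
      ((ihom (L.dom f)).map m ≫ A.fn f) := by
    intro f
    obtain ⟨ι, Q, q, hQ, hQ', hq⟩ :=
      exists_projective_cover hV hF₀ hG hG' ((ihom (L.dom f)).obj S)
    refine EnrichedFactorizationSystem.factors_of_E hq
      (EnrichedFactorizationSystem.M_ihom hF₀ _ _ hm) ?_
    have : ∀ i, Factors ((ihom (L.cod f)).map m)
        (q i ≫ (ihom (L.dom f)).map m ≫ A.fn f) := by
      intro i
      have h := hop f (Q i) (uncurry (q i)) (hQ i) (hQ' i)
      rw [← factors_ihom_map_iff (W := L.cod f), Str.op, curry_act, curry_natural_right,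
        curry_uncurry, Category.assoc] at h
      exact h
    choose l hl using this
    exact ⟨Sigma.desc l, Sigma.hom_ext _ _ (fun i => by simp [hl])⟩
  choose fn hfn using hfn
  -- Pullback keeps the relations in the right class of F, although `m` is only known to lie in that
  -- of F₀.
  have hR : ∀ R, F.M (pullback.snd (A.incl R) ((ihom (L.arity R)).map m)) := fun R =>
    EnrichedFactorizationSystem.M_of_isPullback hF (IsPullback.of_hasPullback _ _) (A.incl_mem R)
  refine ⟨{ carrier := S
            fn := fn
            rel := fun R => pullback (A.incl R) ((ihom (L.arity R)).map m)
            incl := fun R => pullback.snd _ _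
            incl_mem := hR
            incl_mono := fun R => hF.mono _ (hR R) },
    { map := m
      fn_comm := fun f => (hfn f).symm
      rel_lift := fun R => ⟨pullback.fst _ _, pullback.condition⟩ }, hmono, fun P y => Iff.rfl, ?_⟩
  rintro R P a ⟨l, hl⟩
  rw [curry_natural_right] at hl
  exact ⟨pullback.lift l (curry a) hl, pullback.lift_snd _ _ _⟩

/-- Small elements of a structure represented by a conjunction are locally given by terms. -/
theorem IsRep.lifts (hF : F.IsProper) (hL : L.IsAry κ) (hdom : ∀ f, F₀.IsStable (L.dom f))
    {A : Str L F.M} {X : V} {I : Type v} {φ : I → Formula L X} {x₀ : X ⟶ A.carrier}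
    (h : IsRep A φ x₀) (hφ : ∀ i, (φ i).IsAtomic) (hX : IsCardinalPresentable X κ) :
    Lifts κ x₀ := by
  obtain ⟨S, m, hm, h₁, h₂⟩ := exists_termGenerated (F₀ := F₀) hV hF₀ x₀ hX
  -- Input arities are stable, so arity ⊗ P is projective and elements of S on it are term-given;
  -- applying the function symbol gives another term.
  obtain ⟨B, i, hi, hi₁, hi₂⟩ := exists_substructure hV hF₀ hG hG' hF A m hm
    (fun f P a hP hP' => h₁ _ _ (hV.tensor _ _ (hL.2.1 f) hP)
      ((h₂ _ a (hV.tensor _ _ (hL.1 f) hP) (isProjective_tensor (hdom f) hP')).op hL hP f))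
  obtain ⟨b, hb⟩ := (hi₁ _ x₀).2 (h₁ _ _ hX (termGiven_self hX))
  obtain ⟨r, hr, -⟩ := h.existsUnique B b (fun j => by
    refine sat_of_mono hF i hi₂ (hφ j) ?_
    rw [Category.assoc, hb]
    exact h.sat j)
  -- B contains the generic element and reflects atomic formulas, so A maps to it; uniqueness makes
  -- the inclusion of B a split epimorphism, so every element of A lies in S.
  have hri : r ≫ i = 𝟙 A := h.hom_ext hF hφ (by
    rw [Str.comp_map, ← Category.assoc, hr, hb]
    exact (Category.comp_id _).symm)
  intro Y y hY
  obtain ⟨P, hP, e, he⟩ := hG.2 Y hY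
  have hP' := hG.1 P hP
  obtain ⟨l, hl⟩ := (hi₁ _ (e ≫ y)).1 ⟨e ≫ y ≫ Str.Hom.map r, by
    have := congrArg Str.Hom.map hri
    rw [Str.comp_map, Str.id_map] at this
    rw [Category.assoc, Category.assoc, this]
    exact congrArg (e ≫ ·) (Category.comp_id y)⟩
  refine ⟨P, e, hF₀.epi _ he, ?_⟩
  rw [← hl]
  exact h₂ P l hP' (hG' P hP)

end Substructure

end EnrichedLogic

namespace EnrichedLogic

open MonoidalClosed

variable {V : Type u} [Category.{v} V] [MonoidalCategory V] [MonoidalClosed V]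
  [SymmetricCategory V] [IsLocallyPresentable.{v} V]

/-! ### Presentations of presentable structures -/

section Presentation

variable {L : Lang.{u, v} V} {F : EnrichedFactorizationSystem V} (κ : Cardinal.{v})
  [Fact κ.IsRegular]

/-- A structure represented by a small conjunction of atomic formulas, whose generic element
satisfies a condition. -/
def HasPresentation (C : ∀ (A : Str L F.M) (X : V), (X ⟶ A.carrier) → Prop) (A : Str L F.M) :
    Prop :=
  ∃ (X : V) (I : Type v) (φ : I → Formula L X) (x₀ : X ⟶ A.carrier),
    IsCardinalPresentable X κ ∧ Cardinal.mk I < κ ∧ (∀ i, (φ i).IsAtomic) ∧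
      (∀ i, (φ i).IsAry κ) ∧ IsRep A φ x₀ ∧ C A X x₀

variable {κ}

theorem IsRep.of_iso {A B : Str L F.M} {X : V} {I : Type v} {φ : I → Formula L X}
    {x₀ : X ⟶ A.carrier} (hF : F.IsProper) (h : IsRep A φ x₀) (hφ : ∀ i, (φ i).IsAtomic)
    (e : A ≅ B) : IsRep B φ (x₀ ≫ Str.Hom.map e.hom) := by
  refine ⟨fun i => ?_, fun K x hx => ?_⟩
  · rw [← Category.assoc]
    exact (h.sat i).hom_comp hF e.hom (hφ i)
  · obtain ⟨g, hg, hu⟩ := h.existsUnique K x hx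
    refine ⟨e.inv ≫ g, ?_, fun g' hg' => ?_⟩
    · beta_reduce
      rw [Category.assoc, ← Str.comp_map, Iso.hom_inv_id_assoc, hg]
    · rw [Iso.eq_inv_comp]
      refine hu _ ?_
      beta_reduce
      rw [Str.comp_map, ← Category.assoc, hg']

theorem hasCardinalLT_of_arrow {J : Type v} [SmallCategory J] (hJ : HasCardinalLT (Arrow J) κ) :
    HasCardinalLT J κ :=
  hJ.of_injective (fun j : J => Arrow.mk (𝟙 j)) (fun _ _ h => congrArg Comma.left h)

theorem isAtomic_eq {X Y : V} (s t : Term L X Y) : (Formula.eq s t).IsAtomic := by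
  simp only [Formula.IsAtomic]

/-! ### Presentations of colimits in the presence of terms. -/

section Functional

variable (hV : IsLocallyPresentableAsClosed V κ) (hF : F.IsProper)

include hV hF

/-- A small colimit of structures with presentations whose generic elements generate by terms
has a presentation. -/
theorem exists_presentation_of_isColimit {J : Type v} [SmallCategory J]
    (hJ : HasCardinalLT (Arrow J) κ) {D : J ⥤ Str L F.M} {c : Cocone D} (hc : IsColimit c)
    (hD : ∀ j, HasPresentation κ (fun A _ x₀ => Lifts κ (A := A) x₀) (D.obj j)) :
    HasPresentation κ (fun _ _ _ => True) c.pt := by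
  choose X I φ x hX hI hφ hφκ hx hl using hD
  -- Each transition morphism is encoded by an equation: the image of the source's generic element,
  -- precomposed with an epimorphism, is a term in the target's generic element.
  have key : ∀ u : Arrow J, ∃ (P : V) (e : P ⟶ X u.left) (t : Term L (X u.right) P), Epi e ∧
      t.IsAry κ ∧ t.eval (D.obj u.right) (x u.right) =
        e ≫ x u.left ≫ Str.Hom.map (D.map u.hom) := by
    intro u
    obtain ⟨P, e, he, t, ht, hte⟩ := hl u.right (X u.left) (x u.left ≫ Str.Hom.map (D.map u.hom))
      (hX u.left)
    exact ⟨P, e, t, he, ht, hte⟩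
  choose P e t he ht hte using key
  have hJ' : Cardinal.mk J < κ :=
    (hasCardinalLT_iff_cardinal_mk_lt _ _).1 (hasCardinalLT_of_arrow hJ)
  have hXX : IsCardinalPresentable (∐ X) κ := isCardinalPresentable_sigma κ hJ' X hX
  -- The variables of all stages are put side by side; the axioms are those of every stage together
  -- with one equation per arrow.
  let ψ : (Σ j, I j) ⊕ Arrow J → Formula L (∐ X) := Sum.elim
    (fun i => (φ i.1 i.2).subst (Sigma.ι X i.1))
    (fun u => .eq (.ofHom (e u ≫ Sigma.ι X u.left))
      (.comp (.ofHom (Sigma.ι X u.right)) (t u)))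
  have hψ : ∀ (K : Str L F.M) (y : ∐ X ⟶ K.carrier), (∀ i, Sat K (ψ i) ((ρ_ _).hom ≫ y)) ↔
      (∀ j i, Sat K (φ j i) ((ρ_ _).hom ≫ Sigma.ι X j ≫ y)) ∧
        ∀ u, e u ≫ Sigma.ι X u.left ≫ y = (t u).eval K (Sigma.ι X u.right ≫ y) := by
    intro K y
    have h₂ : ∀ u, Sat K (ψ (Sum.inr u)) ((ρ_ _).hom ≫ y) ↔
        e u ≫ Sigma.ι X u.left ≫ y = (t u).eval K (Sigma.ι X u.right ≫ y) := by
      intro u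
      refine (sat_eq_rightUnitor_iff hF _ _ _).trans ?_
      rw [Term.eval_comp, Term.eval_ofHom, Term.eval_ofHom, Category.assoc]
    rw [Sum.forall]
    refine and_congr ⟨fun h j i => ?_, fun h i => ?_⟩ (forall_congr' h₂)
    · exact (sat_subst_rightUnitor_iff hF (hφ j i) _ _).1 (h ⟨j, i⟩)
    · exact (sat_subst_rightUnitor_iff hF (hφ i.1 i.2) _ _).2 (h i.1 i.2)
  have hw : ∀ {j k : J} (u : j ⟶ k),
      Str.Hom.map (D.map u) ≫ Str.Hom.map (c.ι.app k) = Str.Hom.map (c.ι.app j) :=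
    fun u => congrArg Str.Hom.map (c.w u)
  refine ⟨∐ X, _, ψ, Sigma.desc (fun j => x j ≫ Str.Hom.map (c.ι.app j)), hXX, ?_, ?_, ?_,
    ⟨?_, fun K y hy => ?_⟩, trivial⟩
  · rw [← hasCardinalLT_iff_cardinal_mk_lt,
      hasCardinalLT_sum_iff _ _ _ (Cardinal.IsRegular.aleph0_le Fact.out)]
    exact ⟨hasCardinalLT_sigma _ _ (hasCardinalLT_of_arrow hJ)
      (fun j => (hasCardinalLT_iff_cardinal_mk_lt _ _).2 (hI j)), hJ⟩
  · rintro (⟨j, i⟩ | u)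
    · exact (hφ j i).subst _
    · exact isAtomic_eq _ _
  · rintro (⟨j, i⟩ | u)
    · exact (hφκ j i).subst (hφ j i) _ (hX j) hXX
    · simp only [ψ, Sum.elim_inr, Formula.IsAry, Term.IsAry]
      exact ⟨⟨hXX, (ht u).cod hV⟩, ⟨hXX, hX _⟩, ht u⟩
  · rw [hψ]
    constructor
    · intro j i
      rw [Sigma.ι_desc, ← Category.assoc]
      exact (hx j).sat i |>.hom_comp hF _ (hφ j i)
    · intro u
      rw [Sigma.ι_desc, Sigma.ι_desc]
      refine Eq.trans ?_ (Str.Hom.eval_comp (c.ι.app u.right) (t u) (x u.right)).symm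
      refine Eq.trans ?_ (congrArg (· ≫ Str.Hom.map (c.ι.app u.right)) (hte u)).symm
      refine (congrArg (fun k => e u ≫ x u.left ≫ k) (hw u.hom).symm).trans ?_
      simp only [Category.assoc]
  · obtain ⟨hy₁, hy₂⟩ := (hψ K y).1 hy
    choose h hh _ using fun j => (hx j).existsUnique K (Sigma.ι X j ≫ y) (hy₁ j)
    -- The equation for u gives compatibility only after precomposition with its epimorphism, which
    -- is cancelled.
    have hcomp : ∀ {j k : J} (u : j ⟶ k), D.map u ≫ h k = h j := by
      intro j k u
      refine (hx j).hom_ext hF (hφ j) ?_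
      have := he (Arrow.mk u)
      rw [← cancel_epi (e (Arrow.mk u)), hh]
      have h₁ := hy₂ (Arrow.mk u)
      have h₂ := hte (Arrow.mk u)
      have h₃ := Str.Hom.eval_comp (h k) (t (Arrow.mk u)) (x k)
      rw [hh] at h₃
      refine Eq.trans ?_ (h₃.symm.trans h₁.symm)
      refine Eq.trans ?_ (congrArg (· ≫ Str.Hom.map (h k)) h₂.symm)
      simp
    let s : Cocone D := ⟨K, { app := h, naturality := fun _ _ u => (hcomp u).trans (Category.comp_id _).symm }⟩
    have hs : ∀ j, c.ι.app j ≫ hc.desc s = h j := fun j => hc.fac s j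
    refine ⟨hc.desc s, Sigma.hom_ext _ _ (fun j => ?_), fun g hg => hc.hom_ext (fun j => ?_)⟩
    · rw [Sigma.ι_desc_assoc, Category.assoc, ← hh, ← hs j]
      rfl
    · rw [hs]
      refine (hx j).hom_ext hF (hφ j) ?_
      rw [hh, ← hg, Sigma.ι_desc_assoc, Category.assoc]
      rfl

end Functional

end Presentation

/-! ### Relational structures -/

section Relational

variable {L : Lang.{u, v} V} {F : EnrichedFactorizationSystem V} (hL : L.IsRelational)

/-- The structure in which all relations hold. -/
abbrev fullStr (X : V) : Str L F.M where
  carrier := X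
  fn f := (hL.false f).elim
  rel R := (ihom (L.arity R)).obj X
  incl _ := 𝟙 _
  incl_mem _ := F.M_iso _ inferInstance
  incl_mono _ := inferInstance

/-- Maps to a structure in which all relations hold. -/
def homFullEquiv (A : Str L F.M) (X : V) :
    (A.carrier ⟶ X) ≃ (A ⟶ fullStr hL X) where
  toFun m :=
    { map := m
      fn_comm := fun f => (hL.false f).elim
      rel_lift := fun _ => ⟨A.incl _ ≫ (ihom _).map m, Category.comp_id _⟩ }
  invFun h := Str.Hom.map h
  left_inv _ := rfl
  right_inv _ := rfl

/-- The carrier functor. -/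
def carrierFunctor (L : Lang.{u, v} V) (M : MorphismProperty V) : Str L M ⥤ V where
  obj A := A.carrier
  map h := Str.Hom.map h

-- Making all relations hold is right adjoint to taking the carrier when there are no operations to
-- define. Hence carriers of colimits are colimits of carriers.
include hL in
theorem isLeftAdjoint_carrierFunctor :
    (carrierFunctor L F.M).IsLeftAdjoint :=
  (Adjunction.adjunctionOfEquivRight (F := carrierFunctor L F.M) (homFullEquiv hL)
    (fun _ _ _ _ _ => rfl)).isLeftAdjoint

theorem relEl_fullStr {X P : V} (R : L.Rel) (a : L.arity R ⊗ P ⟶ X) :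
    (fullStr hL X : Str L F.M).RelEl R a := ⟨curry a, Category.comp_id _⟩

include hL in
/-- The generic element of a structure represented by relational atomic formulas is invertible. -/
theorem IsRep.isIso_of_relational (hF : F.IsProper) {A : Str L F.M} {X : V} {I : Type v}
    {φ : I → Formula L X} {x₀ : X ⟶ A.carrier} (h : IsRep A φ x₀) (hφ : ∀ i, (φ i).IsAtomic)
    (hφ' : ∀ i (Y : V) (x : X ⟶ Y),
      Sat (fullStr (F := F) hL Y) (φ i) ((ρ_ X).hom ≫ x)) : IsIso x₀ := by
  obtain ⟨g, hg, -⟩ := h.existsUnique (fullStr hL X) (𝟙 X) (fun i => hφ' i X (𝟙 X))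
  refine ⟨Str.Hom.map g, hg, ?_⟩
  -- The composite through X need not preserve relations into A; it is compared with the identity as
  -- a morphism into the structure on A in which all relations hold.
  have e : homFullEquiv hL A A.carrier (Str.Hom.map g ≫ x₀) =
      homFullEquiv hL A A.carrier (𝟙 _) := by
    refine h.hom_ext hF hφ ?_
    have : x₀ ≫ Str.Hom.map g ≫ x₀ = x₀ ≫ 𝟙 A.carrier := by
      rw [← Category.assoc]
      exact (congrArg (· ≫ x₀) hg).trans ((Category.id_comp x₀).trans (Category.comp_id x₀).symm)
    exact this
  exact congrArg Str.Hom.map e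

variable {κ : Cardinal.{v}} [Fact κ.IsRegular]

-- The carrier of the colimit is a κ-small colimit of presentable objects, so it can serve as the
-- arity, with the identity as generic element. The axioms are those of the stages, and no equation
-- for arrows is needed.
include hL in
theorem exists_presentation_of_isColimit_of_relational (hF : F.IsProper)
    {J : Type v} [SmallCategory J]
    (hJ : HasCardinalLT (Arrow J) κ) {D : J ⥤ Str L F.M} {c : Cocone D} (hc : IsColimit c)
    (hD : ∀ j, HasPresentation κ (fun _ _ x₀ => IsIso x₀) (D.obj j)) :
    HasPresentation κ (fun _ _ x₀ => IsIso x₀) c.pt := by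
  choose X I φ x hX hI hφ hφκ hx hiso using hD
  have := isLeftAdjoint_carrierFunctor (F := F) hL
  have hc' : IsColimit ((carrierFunctor L F.M).mapCocone c) := isColimitOfPreserves _ hc
  have hpt : IsCardinalPresentable c.pt.carrier κ := by
    have (j : J) : IsCardinalPresentable ((D ⋙ carrierFunctor L F.M).obj j) κ :=
      isCardinalPresentable_of_iso (asIso (x j)) κ
    exact isCardinalPresentable_of_isColimit _ hc' κ hJ
  have hext : ∀ {Y : V} {a b : c.pt.carrier ⟶ Y},
      (∀ j, Str.Hom.map (c.ι.app j) ≫ a = Str.Hom.map (c.ι.app j) ≫ b) → a = b :=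
    fun h => hc'.hom_ext h
  have hsat : ∀ (K : Str L F.M) (y : c.pt.carrier ⟶ K.carrier) (j : J) (i : I j),
      Sat K ((φ j i).subst (x j ≫ Str.Hom.map (c.ι.app j))) ((ρ_ _).hom ≫ y) ↔
        Sat K (φ j i) ((ρ_ _).hom ≫ x j ≫ Str.Hom.map (c.ι.app j) ≫ y) := by
    intro K y j i
    rw [sat_subst_rightUnitor_iff hF (hφ j i), Category.assoc]
  refine ⟨c.pt.carrier, Σ j, I j,
    fun i => (φ i.1 i.2).subst (x i.1 ≫ Str.Hom.map (c.ι.app i.1)), 𝟙 _, hpt, ?_,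
    fun i => (hφ i.1 i.2).subst _,
    fun i => (hφκ i.1 i.2).subst (hφ i.1 i.2) _ (hX i.1) hpt, ⟨?_, ?_⟩, inferInstance⟩
  · rw [← hasCardinalLT_iff_cardinal_mk_lt]
    exact hasCardinalLT_sigma _ _ (hasCardinalLT_of_arrow hJ)
      (fun j => (hasCardinalLT_iff_cardinal_mk_lt _ _).2 (hI j))
  · rintro ⟨j, i⟩
    refine (hsat c.pt (𝟙 _) j i).2 ?_
    have h := ((hx j).sat i).hom_comp hF (c.ι.app j) (hφ j i)
    have e : (ρ_ (X j)).hom ≫ x j ≫ Str.Hom.map (c.ι.app j) ≫ 𝟙 c.pt.carrier =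
        ((ρ_ (X j)).hom ≫ x j) ≫ Str.Hom.map (c.ι.app j) :=
      (congrArg (fun k => (ρ_ (X j)).hom ≫ x j ≫ k) (Category.comp_id _)).trans
        (Category.assoc _ _ _).symm
    exact Eq.mpr (congrArg (Sat c.pt (φ j i)) e) h
  · intro K y hy
    choose h hh hu using fun j => (hx j).existsUnique K (x j ≫ Str.Hom.map (c.ι.app j) ≫ y)
      (fun i => (hsat K y j i).1 (hy ⟨j, i⟩))
    have hh' : ∀ j, Str.Hom.map (h j) = Str.Hom.map (c.ι.app j) ≫ y := by
      intro j
      have := hiso j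
      exact (cancel_epi (x j)).1 (hh j)
    have hcomp : ∀ {j k : J} (u : j ⟶ k), D.map u ≫ h k = h j := by
      intro j k u
      apply Str.Hom.ext
      refine (congrArg (Str.Hom.map (D.map u) ≫ ·) (hh' k)).trans ?_
      refine Eq.trans ?_ (hh' j).symm
      refine (Category.assoc _ _ _).symm.trans ?_
      exact congrArg (fun k : D.obj j ⟶ c.pt => Str.Hom.map k ≫ y) (c.w u)
    let s : Cocone D :=
      ⟨K, { app := h, naturality := fun _ _ u => (hcomp u).trans (Category.comp_id _).symm }⟩
    have hs : ∀ j, c.ι.app j ≫ hc.desc s = h j := fun j => hc.fac s j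
    refine ⟨hc.desc s, ?_, fun g hg => Str.Hom.ext ?_⟩
    · beta_reduce
      rw [Category.id_comp]
      refine hext (fun j => ?_)
      rw [← hh', ← hs]
      rfl
    · beta_reduce at hg
      rw [Category.id_comp] at hg
      rw [hg]
      refine hext (fun j => ?_)
      rw [← hh', ← hs]
      rfl

end Relational

/-! ### Presentability and presentations -/

section Main

variable {L : Lang.{u, v} V} {F F₀ : EnrichedFactorizationSystem V} {κ : Cardinal.{v}}
  [Fact κ.IsRegular]

theorem HasPresentation.of_iso (hF : F.IsProper)
    {C : ∀ (A : Str L F.M) (X : V), (X ⟶ A.carrier) → Prop}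
    (hC : ∀ {A B : Str L F.M} {X : V} (x : X ⟶ A.carrier) (e : A ≅ B), C A X x →
      C B X (x ≫ Str.Hom.map e.hom)) {A B : Str L F.M} (e : A ≅ B) (h : HasPresentation κ C A) :
    HasPresentation κ C B := by
  obtain ⟨X, I, φ, x, hX, hI, hφ, hφκ, hx, hc⟩ := h
  exact ⟨X, I, φ, _, hX, hI, hφ, hφκ, hx.of_iso hF hφ e, hC x e hc⟩

theorem natCast_lt (n : ℕ) : (n : Cardinal.{v}) < κ :=
  Cardinal.natCast_lt_aleph0.trans_le (Cardinal.IsRegular.aleph0_le Fact.out)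

theorem mk_pempty_lt : Cardinal.mk PEmpty.{v + 1} < κ := by
  simpa using natCast_lt (κ := κ) 0

theorem mk_punit_lt : Cardinal.mk PUnit.{v + 1} < κ := by
  simpa using natCast_lt (κ := κ) 1

/-- When the generic element is invertible, every element is a substitution of variables into it, so
no cover is needed. -/
theorem Lifts.of_isIso {A : Str L F.M} {X : V} (x₀ : X ⟶ A.carrier)
    (hX : IsCardinalPresentable X κ) [IsIso x₀] : Lifts κ x₀ := by
  intro Y y hY
  refine ⟨Y, 𝟙 Y, inferInstance, .ofHom (y ≫ inv x₀), ?_, ?_⟩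
  · simp only [Term.IsAry]
    exact ⟨hX, hY⟩
  · rw [Term.eval_ofHom]
    simp

variable (hV : IsLocallyPresentableAsClosed V κ) (hF : F.IsProper)
  (hFκ : F.MClosedUnderFilteredColimits κ) (hL : L.IsAry κ)

include hV hF hFκ hL

theorem exists_presentation_of_relational (hLr : L.IsRelational) {A : Str L F.M}
    (hA : A.IsPresentable κ) : HasPresentation κ (fun _ _ x₀ => IsIso x₀) A := by
  let T : ObjectProperty (Str L F.M) := HasPresentation κ (fun _ _ x₀ => IsIso x₀)
  have : T.IsClosedUnderIsomorphisms := ⟨fun e h => h.of_iso hF (fun x e hx => by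
    have : IsIso x := hx
    have : IsIso (Str.Hom.map e.hom) := ((carrierFunctor L F.M).mapIso e).isIso_hom
    exact IsIso.comp_isIso' ‹_› ‹_›) e⟩
  refine isPresentable_induction hV hF hFκ hL T (fun X A x₀ hX h => ?_)
    (fun R Y A x₀ hY h => ?_) (fun J _ hJ => ⟨?_⟩) hA
  · exact ⟨X, PEmpty, _, x₀, hX, mk_pempty_lt, fun i => i.elim, fun i => i.elim, h,
      h.isIso_of_relational hLr hF (fun i => i.elim) (fun i => i.elim)⟩
  · have ha : (Formula.rel R Y (.ofHom (𝟙 (L.arity R ⊗ Y))) : Formula L _).IsAtomic := by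
      simp only [Formula.IsAtomic]
    exact ⟨_, PUnit, _, x₀, hV.tensor _ _ (hL.2.2 R) hY, mk_punit_lt, fun _ => ha,
      fun _ => isAry_rel_ofHom_id hV hL R hY, h,
      h.isIso_of_relational hLr hF (fun _ => ha)
        (fun _ Z x => (sat_rel_ofHom_id_iff (K := fullStr hLr Z) x).2 (relEl_fullStr hLr R x))⟩
  · rintro B ⟨h⟩
    exact exists_presentation_of_isColimit_of_relational hLr hF hJ h.isColimit h.prop_diag_obj

theorem exists_presentation_of_stable (hF₀ : F₀.IsProper) (hdom : ∀ f, F₀.IsStable (L.dom f))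
    {G : Set V} (hG : F₀.IsGenerator κ G) (hG' : ∀ Y ∈ G, F₀.IsProjective Y) {A : Str L F.M}
    (hA : A.IsPresentable κ) : HasPresentation κ (fun A _ x₀ => Lifts κ (A := A) x₀) A := by
  -- Local generation by terms is automatic for any presentation, so the induction runs with no
  -- extra condition and recovers it at each stage of a colimit.
  have hl : ∀ {A : Str L F.M}, HasPresentation κ (fun _ _ _ => True) A →
      HasPresentation κ (fun A _ x₀ => Lifts κ (A := A) x₀) A := by
    rintro A ⟨X, I, φ, x, hX, hI, hφ, hφκ, hx, -⟩
    exact ⟨X, I, φ, x, hX, hI, hφ, hφκ, hx, hx.lifts hV hF₀ hG hG' hF hL hdom hφ hX⟩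
  let T : ObjectProperty (Str L F.M) := HasPresentation κ (fun _ _ _ => True)
  have : T.IsClosedUnderIsomorphisms := ⟨fun e h => h.of_iso hF (fun _ _ _ => trivial) e⟩
  refine hl (isPresentable_induction hV hF hFκ hL T (fun X A x₀ hX h => ?_)
    (fun R Y A x₀ hY h => ?_) (fun J _ hJ => ⟨?_⟩) hA)
  · exact ⟨X, PEmpty, _, x₀, hX, mk_pempty_lt, fun i => i.elim, fun i => i.elim, h, trivial⟩
  · have ha : (Formula.rel R Y (.ofHom (𝟙 (L.arity R ⊗ Y))) : Formula L _).IsAtomic := by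
      simp only [Formula.IsAtomic]
    exact ⟨_, PUnit, _, x₀, hV.tensor _ _ (hL.2.2 R) hY, mk_punit_lt, fun _ => ha,
      fun _ => isAry_rel_ofHom_id hV hL R hY, h, trivial⟩
  · rintro B ⟨h⟩
    exact exists_presentation_of_isColimit hV hF hJ h.isColimit (fun j => hl (h.prop_diag_obj j))

/-- Presentable structures have small presentations. -/
theorem exists_presentation (hF₀ : F₀.IsProper) (hLF₀ : L.IsRelational ∨
      ((∀ f : L.Fn, F₀.IsStable (L.dom f)) ∧ (∀ R : L.Rel, F₀.IsStable (L.arity R)) ∧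
        ∃ G : Set V, F₀.IsGenerator κ G ∧ ∀ Y ∈ G, F₀.IsProjective Y)) {A : Str L F.M}
    (hA : A.IsPresentable κ) : HasPresentation κ (fun A _ x₀ => Lifts κ (A := A) x₀) A := by
  rcases hLF₀ with h | ⟨hdom, -, G, hG, hG'⟩
  · obtain ⟨X, I, φ, x, hX, hI, hφ, hφκ, hx, hiso⟩ :=
      exists_presentation_of_relational hV hF hFκ hL h hA
    exact ⟨X, I, φ, x, hX, hI, hφ, hφκ, hx, Lifts.of_isIso x hX⟩
  · exact exists_presentation_of_stable hV hF hFκ hL hF₀ hdom hG hG' hA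

end Main

end EnrichedLogic

namespace EnrichedLogic

open MonoidalClosed

variable {V : Type u} [Category.{v} V] [MonoidalCategory V] [MonoidalClosed V]
  [SymmetricCategory V] [IsLocallyPresentable.{v} V]

/-! ### Images of hom-objects and positive-existential formulas -/

theorem exists_iso_of_factors_iff {C : Type u} [Category.{v} C] {S S' Y : C} (m : S ⟶ Y)
    (m' : S' ⟶ Y) [Mono m] [Mono m'] (h : ∀ (P : C) (y : P ⟶ Y), Factors m y ↔ Factors m' y) :
    ∃ i : S ⟶ S', IsIso i ∧ i ≫ m' = m := by
  obtain ⟨i, hi⟩ := (h _ m).1 (factors_self m)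
  obtain ⟨k, hk⟩ := (h _ m').2 (factors_self m')
  refine ⟨i, ⟨k, ?_, ?_⟩, hi⟩
  · rw [← cancel_mono m, Category.assoc, hk, hi, Category.id_comp]
  · rw [← cancel_mono m', Category.assoc, hi, hk, Category.id_comp]

section Images

variable {L : Lang.{u, v} V} {F : EnrichedFactorizationSystem V} (hF : F.IsProper)
  {A : Str L F.M} {X : V} {x₀ : X ⟶ A.carrier}

include hF

theorem isElementaryFor_iff {K N : Str L F.M} (f : K ⟶ N) (φ : Formula L X) :
    IsElementaryFor F f φ ↔ ∀ (P : V) (y : P ⟶ (ihom X).obj K.carrier),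
      Factors (φ.interp F K).hom y ↔
        Factors (φ.interp F N).hom (y ≫ (ihom X).map (Str.Hom.map f)) := by
  have := hF.mono _ (M_interp K hF φ)
  have := hF.mono _ (M_interp N hF φ)
  exact exists_isPullback_iff _ _ _

/-- The interpretation of a conjunction is the hom-object out of a representing structure. -/
theorem IsRep.exists_iso_interp_conj {I : Type v} {φ : I → Formula L X} (h : IsRep A φ x₀)
    (hφ : ∀ i, (φ i).IsAtomic) (K : Str L F.M) :
    ∃ i : Str.homObj A K ⟶ ((Formula.conj φ).interp F K).left, IsIso i ∧
      i ≫ ((Formula.conj φ).interp F K).hom = homEval x₀ K := by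
  have := h.mono_homEval hF hφ K
  have := hF.mono _ (M_interp K hF (.conj φ))
  refine exists_iso_of_factors_iff (homEval x₀ K) ((Formula.conj φ).interp F K).hom (fun P y => ?_)
  obtain ⟨x, rfl⟩ : ∃ x, y = curry x := ⟨uncurry y, (curry_uncurry y).symm⟩
  exact (h.factors_homEval_iff hF hφ K x).trans (sat_conj_iff φ x).symm

theorem homPost_homPre {B K N : Str L F.M} (g : A ⟶ B) (f : K ⟶ N) :
    Str.homPre g K ≫ Str.homPost A f = Str.homPost B f ≫ Str.homPre g N := by
  rw [← cancel_mono (Str.homι A N)]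
  simp only [Category.assoc, Str.homPre, Str.homPost, Str.homLift_homι]
  rw [← Category.assoc, Str.homLift_homι, ← Category.assoc, Str.homLift_homι, Category.assoc,
    Category.assoc, pre_comm_ihom_map]

variable (hA : ∀ K : Str L F.M, F.M (homEval x₀ K))

include hA

/-- Str(B, K) is the interpretation of the conjunction in the power by X ⨿ Z, and `Str.homPre g K`
becomes the projection that forgets z. Its image is the existential formula. -/
theorem factors_imageι_homPre_iff {B : Str L F.M} (g : A ⟶ B) {Z : V} {I : Type v}
    {χ : I → Formula L (X ⨿ Z)} (hχ : ∀ i, (χ i).IsAtomic) {z : X ⨿ Z ⟶ B.carrier}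
    (h : IsRep B χ z) (hz : coprod.inl ≫ z = x₀ ≫ Str.Hom.map g) (K : Str L F.M) {P : V}
    (y : P ⟶ Str.homObj A K) : Factors (F.imageι (Str.homPre g K)) y ↔
      Factors ((Formula.ex Z (.conj χ)).interp F K).hom (y ≫ homEval x₀ K) := by
  obtain ⟨i, hi, hi'⟩ := h.exists_iso_interp_conj hF hχ K
  refine (EnrichedFactorizationSystem.factors_imageι_comp_M hF _ _ (hA K) y).symm.trans ?_
  have e : Str.homPre g K ≫ homEval x₀ K = i ≫ ((Formula.conj χ).interp F K).hom ≫
      (pre coprod.inl).app K.carrier := by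
    rw [homPre_homEval, ← hz, reassoc_of% hi', homEval, homEval, Category.assoc, pre_map,
      NatTrans.comp_app]
  rw [e]
  exact EnrichedFactorizationSystem.factors_imageι_E_comp i (F.E_iso i hi) _ _

/-- The disjunction of existential formulas takes images twice, while the cone takes one image of
the whole sum; closure of E under coproducts reconciles them. -/
theorem factors_imageι_coneMap_iff {J : Type v} {B : J → Str L F.M} (g : ∀ j, A ⟶ B j)
    {Z : J → V} {I : J → Type v} {χ : ∀ j, I j → Formula L (X ⨿ Z j)}
    (hχ : ∀ j i, (χ j i).IsAtomic) {z : ∀ j, X ⨿ Z j ⟶ (B j).carrier}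
    (h : ∀ j, IsRep (B j) (χ j) (z j))
    (hz : ∀ j, coprod.inl ≫ z j = x₀ ≫ Str.Hom.map (g j)) (K : Str L F.M) {P : V}
    (y : P ⟶ Str.homObj A K) : Factors (F.imageι (coneMap F g K)) y ↔
      Factors ((Formula.disj fun j => .ex (Z j) (.conj (χ j))).interp F K).hom
        (y ≫ homEval x₀ K) := by
  choose i hi hi' using fun j => (h j).exists_iso_interp_conj hF (hχ j) K
  refine (EnrichedFactorizationSystem.factors_imageι_comp_M hF _ _ (hA K) y).symm.trans ?_
  refine Iff.trans ?_ (EnrichedFactorizationSystem.factors_imageι_desc_imageι hF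
    (fun j => ((Formula.conj (χ j)).interp F K).left)
    (fun j => ((Formula.conj (χ j)).interp F K).hom ≫ (pre coprod.inl).app K.carrier) _).symm
  have e : coneMap F g K ≫ homEval x₀ K = Limits.Sigma.map i ≫
      Sigma.desc (fun j => ((Formula.conj (χ j)).interp F K).hom ≫
        (pre coprod.inl).app K.carrier) := by
    refine Sigma.hom_ext _ _ (fun j => ?_)
    rw [coneMap, Sigma.ι_desc_assoc, Sigma.ι_map_assoc, Sigma.ι_desc, homPre_homEval, ← hz,
      reassoc_of% (hi' j), homEval, homEval, Category.assoc, pre_map, NatTrans.comp_app]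
  rw [e]
  exact EnrichedFactorizationSystem.factors_imageι_E_comp _
    (EnrichedFactorizationSystem.E_sigmaMap hF _ _ i (fun j => F.E_iso _ (hi j))) _ _

/-- Purity for `g` is the elementarity condition restricted to elements of K^X that come from Str(A,
K). -/
theorem imageSquareIsPullback_homPre_iff {B : Str L F.M} (g : A ⟶ B) {Z : V} {I : Type v}
    {χ : I → Formula L (X ⨿ Z)} (hχ : ∀ i, (χ i).IsAtomic) {z : X ⨿ Z ⟶ B.carrier}
    (h : IsRep B χ z) (hz : coprod.inl ≫ z = x₀ ≫ Str.Hom.map g) {K N : Str L F.M}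
    (f : K ⟶ N) :
    F.ImageSquareIsPullback (Str.homPre g K) (Str.homPre g N) (Str.homPost B f)
        (Str.homPost A f) ↔
      ∀ (P : V) (y : P ⟶ Str.homObj A K),
        Factors ((Formula.ex Z (.conj χ)).interp F K).hom (y ≫ homEval x₀ K) ↔
          Factors ((Formula.ex Z (.conj χ)).interp F N).hom
            ((y ≫ homEval x₀ K) ≫ (ihom X).map (Str.Hom.map f)) := by
  rw [EnrichedFactorizationSystem.imageSquareIsPullback_iff hF (homPost_homPre hF g f)]
  refine forall_congr' (fun P => forall_congr' (fun y => ?_))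
  rw [factors_imageι_homPre_iff hF hA g hχ h hz, factors_imageι_homPre_iff hF hA g hχ h hz,
    Category.assoc, homPost_homEval, Category.assoc]

theorem coneImageSquareIsPullback_iff {J : Type v} {B : J → Str L F.M} (g : ∀ j, A ⟶ B j)
    {Z : J → V} {I : J → Type v} {χ : ∀ j, I j → Formula L (X ⨿ Z j)}
    (hχ : ∀ j i, (χ j i).IsAtomic) {z : ∀ j, X ⨿ Z j ⟶ (B j).carrier}
    (h : ∀ j, IsRep (B j) (χ j) (z j))
    (hz : ∀ j, coprod.inl ≫ z j = x₀ ≫ Str.Hom.map (g j)) {K N : Str L F.M} (f : K ⟶ N) :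
    ConeImageSquareIsPullback F f g ↔
      ∀ (P : V) (y : P ⟶ Str.homObj A K),
        Factors ((Formula.disj fun j => .ex (Z j) (.conj (χ j))).interp F K).hom
            (y ≫ homEval x₀ K) ↔
          Factors ((Formula.disj fun j => .ex (Z j) (.conj (χ j))).interp F N).hom
            ((y ≫ homEval x₀ K) ≫ (ihom X).map (Str.Hom.map f)) := by
  have w : coneMap F g K ≫ Str.homPost A f =
      Limits.Sigma.map (fun j => Str.homPost (B j) f) ≫ coneMap F g N :=
    Sigma.hom_ext _ _ (fun j => by
      rw [coneMap, coneMap, Sigma.ι_desc_assoc, Sigma.ι_map_assoc, Sigma.ι_desc,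
        homPost_homPre hF])
  rw [ConeImageSquareIsPullback, EnrichedFactorizationSystem.imageSquareIsPullback_iff hF w]
  refine forall_congr' (fun P => forall_congr' (fun y => ?_))
  rw [factors_imageι_coneMap_iff hF hA g hχ h hz, factors_imageι_coneMap_iff hF hA g hχ h hz,
    Category.assoc, homPost_homEval, Category.assoc]

end Images

/-! ### Elementary and pure morphisms -/

section Main

variable {L : Lang.{u, v} V} {F F₀ : EnrichedFactorizationSystem V} {κ : Cardinal.{v}}
  [Fact κ.IsRegular]

/-- A morphism of presented structures is presented relative to its source. -/
theorem IsRep.exists_relative (hV : IsLocallyPresentableAsClosed V κ) (hF : F.IsProper)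
    {A B : Str L F.M} {X Z : V} (x₀ : X ⟶ A.carrier) (hX : IsCardinalPresentable X κ) {I : Type v}
    {φ : I → Formula L Z} {z : Z ⟶ B.carrier} (hZ : IsCardinalPresentable Z κ)
    (hI : Cardinal.mk I < κ) (hφ : ∀ i, (φ i).IsAtomic) (hφκ : ∀ i, (φ i).IsAry κ)
    (h : IsRep B φ z) (hz : Lifts κ z) (g : A ⟶ B) :
    ∃ (I' : Type v) (χ : I' → Formula L (X ⨿ Z)) (w : X ⨿ Z ⟶ B.carrier),
      (∀ i, (χ i).IsAtomic) ∧ (Formula.ex Z (.conj χ)).IsAry κ ∧ IsRep B χ w ∧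
        coprod.inl ≫ w = x₀ ≫ Str.Hom.map g := by
  obtain ⟨P, e, he, t, ht, hte⟩ := hz X (x₀ ≫ Str.Hom.map g) hX
  have hXZ := isCardinalPresentable_coprod κ X Z hX hZ
  -- The new variables x are defined from z by one extra equation, so adjoining them does not change
  -- the represented structure.
  let χ : I ⊕ PUnit.{v + 1} → Formula L (X ⨿ Z) := Sum.elim
    (fun i => (φ i).subst coprod.inr)
    (fun _ => .eq (.ofHom (e ≫ coprod.inl)) (.comp (.ofHom coprod.inr) t))
  have hχ : ∀ (K : Str L F.M) (y : X ⨿ Z ⟶ K.carrier), (∀ i, Sat K (χ i) ((ρ_ _).hom ≫ y)) ↔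
      (∀ i, Sat K (φ i) ((ρ_ _).hom ≫ coprod.inr ≫ y)) ∧
        e ≫ coprod.inl ≫ y = t.eval K (coprod.inr ≫ y) := by
    intro K y
    rw [Sum.forall]
    refine and_congr (forall_congr' (fun i => sat_subst_rightUnitor_iff hF (hφ i) _ _)) ?_
    refine (Iff.intro (fun h => h ⟨⟩) (fun h _ => h) : _ ↔ Sat K (χ (Sum.inr ⟨⟩)) _).trans ?_
    refine (sat_eq_rightUnitor_iff hF _ _ _).trans ?_
    rw [Term.eval_comp, Term.eval_ofHom, Term.eval_ofHom, Category.assoc]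
  refine ⟨_, χ, coprod.desc (x₀ ≫ Str.Hom.map g) z, ?_, ?_, ⟨?_, fun K y hy => ?_⟩,
    coprod.inl_desc _ _⟩
  · rintro (i | _)
    · exact (hφ i).subst _
    · exact isAtomic_eq _ _
  · simp only [Formula.IsAry]
    refine ⟨hX, hZ, hXZ, ?_, ?_⟩
    · rw [Cardinal.mk_sum, Cardinal.lift_id, Cardinal.lift_id]
      exact Cardinal.add_lt_of_lt (Cardinal.IsRegular.aleph0_le Fact.out) hI mk_punit_lt
    · rintro (i | _)
      · exact (hφκ i).subst (hφ i) _ hZ hXZ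
      · simp only [χ, Sum.elim_inr, Formula.IsAry, Term.IsAry]
        exact ⟨⟨hXZ, ht.cod hV⟩, ⟨hXZ, hZ⟩, ht⟩
  · rw [hχ, coprod.inl_desc, coprod.inr_desc, hte]
    exact ⟨h.sat, rfl⟩
  · obtain ⟨hy₁, hy₂⟩ := (hχ K y).1 hy
    obtain ⟨k, hk, hu⟩ := h.existsUnique K (coprod.inr ≫ y) hy₁
    beta_reduce at hk hu
    refine ⟨k, coprod.hom_ext ?_ ?_, fun k' hk' => hu k' ?_⟩
    -- The extra equation fixes the x-variables only after e; since e is epi, they are determined.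
    · rw [coprod.inl_desc_assoc, ← cancel_epi e, hy₂, ← hk, Str.Hom.eval_comp, hte,
        Category.assoc, Category.assoc, Category.assoc]
    · rw [coprod.inr_desc_assoc, hk]
    · rw [← hk', coprod.inr_desc_assoc]

variable (hV : IsLocallyPresentableAsClosed V κ) (hF : F.IsProper)
  (hFκ : F.MClosedUnderFilteredColimits κ) (hL : L.IsAry κ)

include hV hF hFκ hL

/-- A presentable free structure. -/
theorem exists_free_isPresentable {X : V} (hX : IsCardinalPresentable X κ) :
    ∃ (A : Str L F.M) (x₀ : X ⟶ A.carrier), A.IsPresentable κ ∧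
      (∀ K : Str L F.M, F.M (homEval x₀ K)) ∧
      (∀ (K : Str L F.M) (P : V) (y : P ⟶ (ihom X).obj K.carrier), Factors (homEval x₀ K) y) ∧
      ∀ (K : Str L F.M) (x : X ⟶ K.carrier), ∃ g : A ⟶ K, x₀ ≫ Str.Hom.map g = x := by
  obtain ⟨A, x₀, h⟩ := exists_free hV hF hL X
  refine ⟨A, x₀, h.isPresentable hV hF hFκ hL hX (fun i => i.elim) mk_pempty_lt
    (fun i => i.elim), h.M_homEval hF (fun i => i.elim), fun K P y => ?_, fun K x => ?_⟩
  · rw [← curry_uncurry y]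
    exact (h.factors_homEval_iff hF (fun i => i.elim) K _).2 (fun i => i.elim)
  · exact (h.existsUnique K x (fun i => i.elim)).exists

theorem exists_rep_isPresentable {X Y : V} {I : Type v} {φ : I → Formula L (X ⨿ Y)}
    (hφ : ∀ i, (φ i).IsAtomic) (hφκ : (Formula.ex Y (.conj φ)).IsAry κ) :
    ∃ (B : Str L F.M) (z : X ⨿ Y ⟶ B.carrier), B.IsPresentable κ ∧ IsRep B φ z := by
  obtain ⟨B, z, h⟩ := exists_rep hV hF hL hφ
  exact ⟨B, z, h.isPresentable hV hF hFκ hL hφκ.2.2.1 hφ hφκ.2.2.2.1 hφκ.2.2.2.2, h⟩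

/-- Pure morphisms are elementary. -/
theorem IsPure.isElementary {K N : Str L F.M} {f : K ⟶ N} (hf : IsPure F κ f) :
    IsElementary F κ f := by
  rintro X _ hψ ⟨Y, I, φ, rfl, hφ⟩
  obtain ⟨A, x₀, hA, hM, hfac, hfree⟩ := exists_free_isPresentable hV hF hFκ hL (L := L) hψ.1
  obtain ⟨B, z, hB, h⟩ := exists_rep_isPresentable hV hF hFκ hL hφ hψ
  obtain ⟨g, hg⟩ := hfree B (coprod.inl ≫ z)
  rw [isElementaryFor_iff hF]
  intro P y
  -- A is free on X, so every element of K^X comes from Str(A, K) and the restricted condition is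
  -- full elementarity.
  obtain ⟨y', rfl⟩ := hfac K P y
  exact (imageSquareIsPullback_homPre_iff hF hM g hφ h hg.symm f).1 (hf A B hA hB g) P y'

/-- If the squares of small cones are pullbacks, the morphism is elementary for positive-existential
formulas. -/
theorem isElementaryFor_of_coneImageSquareIsPullback {K N : Str L F.M} {f : K ⟶ N}
    (hf : ∀ (A : Str L F.M) (J : Type v) (B : J → Str L F.M) (g : ∀ j, A ⟶ B j),
      Cardinal.mk J < κ → A.IsPresentable κ → (∀ j, (B j).IsPresentable κ) →
        ConeImageSquareIsPullback F f g) {X : V} {ψ : Formula L X} (hψ : ψ.IsAry κ)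
    (hψ' : ψ.IsPositiveExistential) : IsElementaryFor F f ψ := by
  obtain ⟨J, ψ, rfl, hψ'⟩ := hψ'
  choose Y I φ e hφ using hψ'
  obtain rfl : ψ = _ := funext e
  obtain ⟨A, x₀, hA, hM, hfac, hfree⟩ := exists_free_isPresentable hV hF hFκ hL (L := L) hψ.1
  choose B z hB h using fun j => exists_rep_isPresentable hV hF hFκ hL (hφ j) (hψ.2.2 j)
  choose g hg using fun j => hfree (B j) (coprod.inl ≫ z j)
  rw [isElementaryFor_iff hF]
  intro P y
  obtain ⟨y', rfl⟩ := hfac K P y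
  exact (coneImageSquareIsPullback_iff hF hM g hφ h (fun j => (hg j).symm) f).1
    (hf A J B g hψ.2.1 hA hB) P y'

variable (hF₀ : F₀.IsProper) (hLF₀ : L.IsRelational ∨
      ((∀ f : L.Fn, F₀.IsStable (L.dom f)) ∧ (∀ R : L.Rel, F₀.IsStable (L.arity R)) ∧
        ∃ G : Set V, F₀.IsGenerator κ G ∧ ∀ Y ∈ G, F₀.IsProjective Y))

include hF₀ hLF₀

/-- Elementary morphisms are pure. -/
theorem IsElementary.isPure {K N : Str L F.M} {f : K ⟶ N} (hf : IsElementary F κ f) :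
    IsPure F κ f := by
  intro A B hA hB g
  obtain ⟨X, I, φ, x₀, hX, -, hφ, -, h, -⟩ := exists_presentation hV hF hFκ hL hF₀ hLF₀ hA
  obtain ⟨Z, I', φ', z, hZ, hI', hφ', hφκ', h', hz⟩ :=
    exists_presentation hV hF hFκ hL hF₀ hLF₀ hB
  obtain ⟨I'', χ, w, hχ, hχκ, hw, hwg⟩ := h'.exists_relative hV hF x₀ hX hZ hI' hφ' hφκ' hz g
  -- Only the presentation of B enters the formula; that of A is used to know that Str(A, K) is an
  -- M-subobject of K^X.
  refine (imageSquareIsPullback_homPre_iff hF (h.M_homEval hF hφ) g hχ hw hwg f).2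
    (fun P y => ?_)
  exact (isElementaryFor_iff hF f _).1 (hf _ _ hχκ ⟨_, _, _, rfl, hχ⟩) _ _

/-- If a morphism is elementary for positive-existential formulas, the squares of small cones are
pullbacks. -/
theorem coneImageSquareIsPullback_of_isElementaryFor {K N : Str L F.M} {f : K ⟶ N}
    (hf : ∀ (X : V) (φ : Formula L X), φ.IsAry κ → φ.IsPositiveExistential →
      IsElementaryFor F f φ) {A : Str L F.M} {J : Type v} {B : J → Str L F.M}
    (g : ∀ j, A ⟶ B j) (hJ : Cardinal.mk J < κ) (hA : A.IsPresentable κ)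
    (hB : ∀ j, (B j).IsPresentable κ) : ConeImageSquareIsPullback F f g := by
  obtain ⟨X, I, φ, x₀, hX, -, hφ, -, h, -⟩ := exists_presentation hV hF hFκ hL hF₀ hLF₀ hA
  choose Z I' φ' z hZ hI' hφ' hφκ' h' hz using
    fun j => exists_presentation hV hF hFκ hL hF₀ hLF₀ (hB j)
  choose I'' χ w hχ hχκ hw hwg using fun j =>
    (h' j).exists_relative hV hF x₀ hX (hZ j) (hI' j) (hφ' j) (hφκ' j) (hz j) (g j)
  refine (coneImageSquareIsPullback_iff hF (h.M_homEval hF hφ) g hχ hw hwg f).2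
    (fun P y => ?_)
  exact (isElementaryFor_iff hF f _).1
    (hf _ (.disj fun j => .ex (Z j) (.conj (χ j))) ⟨hX, hJ, hχκ⟩
      ⟨J, _, rfl, fun j => ⟨_, _, _, rfl, hχ j⟩⟩) _ _

end Main

end EnrichedLogic

end

/-! ### The equivalence, from the four implications. -/

theorem mainTheorem11
    {V : Type u} [Category.{v} V] [MonoidalCategory V] [SymmetricCategory V] [MonoidalClosed V]
    [IsLocallyPresentable.{v} V]
    (κ : Cardinal.{v}) [Fact κ.IsRegular]
    (hV : EnrichedLogic.IsLocallyPresentableAsClosed V κ)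
    (F₀ F : EnrichedLogic.EnrichedFactorizationSystem V)
    (hF₀ : F₀.IsProper) (hF₀κ : F₀.MClosedUnderFilteredColimits κ)
    (hF : F.IsProper) (hFκ : F.MClosedUnderFilteredColimits κ)
    (hE : F₀.E ≤ F.E)
    (L : EnrichedLogic.Lang.{u, v} V) (hL : L.IsAry κ)
    (hLF₀ : L.IsRelational ∨
      ((∀ f : L.Fn, F₀.IsStable (L.dom f)) ∧ (∀ R : L.Rel, F₀.IsStable (L.arity R)) ∧
        ∃ G : Set V, F₀.IsGenerator κ G ∧ ∀ Y ∈ G, F₀.IsProjective Y))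
    (hJ : ∀ A : EnrichedLogic.Str L F.M, A.IsPresentable κ →
      (A.ofLE (EnrichedLogic.EnrichedFactorizationSystem.M_le_of_E_le hE)).IsPresentable κ) :
    EnrichedLogic.ElementaryIsPEStable F L κ ↔
      ∀ (K N : EnrichedLogic.Str L F.M) (f : K ⟶ N), EnrichedLogic.IsPure F κ f →
        ∀ (A : EnrichedLogic.Str L F.M) (J : Type v) (B : J → EnrichedLogic.Str L F.M) (g : ∀ j, A ⟶ B j),
          Cardinal.mk J < κ → A.IsPresentable κ → (∀ j, (B j).IsPresentable κ) →
            EnrichedLogic.ConeImageSquareIsPullback F f g := by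
  constructor
  · intro h K N f hf A J B g hJ hA hB
    exact EnrichedLogic.coneImageSquareIsPullback_of_isElementaryFor hV hF hFκ hL hF₀ hLF₀
      (h K N f (EnrichedLogic.IsPure.isElementary hV hF hFκ hL hf)) g hJ hA hB
  · intro h K N f hf X φ hφ hφ'
    exact EnrichedLogic.isElementaryFor_of_coneImageSquareIsPullback hV hF hFκ hL
      (h K N f (EnrichedLogic.IsElementary.isPure hV hF hFκ hL hF₀ hLF₀ hf)) hφ hφ'
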